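/- Let $d\ge 1$, $\mathcal H_s=\mathbb C^d$ with canonical basis $e_0,\dots,e_{d-1}$, $\mathcal H_r=\ell^2(\mathbb Z)$ with canonical basis $(\Psi_j)_{j\in\mathbb Z}$, and let $a^\#$, $b^\#$ be the fermionic creation/annihilation operators on the antisymmetric Fock spaces $\mathcal F_-(\mathcal H_s)$, $\mathcal F_-(\mathcal H_r)$, with $a_j^\#=a^\#(e_j)$, $b_j^\#=b^\#(\Psi_j)$. Let $S\Psi_j=\Psi_{j-1}$ on $\mathcal H_r$, $S_pe_j=e_{j-1}$, $S_pe_0=e_{d-1}$ on $\mathcal H_s$, and for $\alpha\in\mathbb R$ let $$U=(\Gamma(S)\otimes\Gamma(S_p))\,e^{-i\alpha(b_0^*\otimes a_0+b_0\otimes a_0^*)}\quad\text{on }\mathcal F_-(\mathcal H_r)\otimes\mathcal F_-(\mathcal H_s),\qquad \tau^t(T)=U^{*t}TU^t .$$ Let $0\le\Sigma\le 1$ be an operator on $\mathcal H_r$ commuting with $S$, $\sigma(k)=\langle\Psi_0,\Sigma\Psi_k\rangle$, and let $\omega_\Sigma$ be the gauge-invariant quasi-free state on the $C^*$-algebra generated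 by the $b^\#(\phi)$ with density $\Sigma$, that is $\omega_\Sigma(b^*(\phi_m)\cdots b^*(\phi_1)b(\psi_1)\cdots b(\psi_n))=\delta_{nm}\det(\langle\psi_j,\Sigma\phi_k\rangle)$. Let $\rho$ be a density matrix on $\mathcal F_-(\mathcal H_s)$ which is even, i.e. $\mathrm{tr}(\rho\, a^\#_{k_1}\cdots a^\#_{k_s})=0$ for all odd $s$, and let $\rho_t$ be the reduced density matrix at time $t$: $\mathrm{tr}(\rho_tA)=(\omega_\Sigma\otimes\rho)(\tau^t(1\otimes A))$ for all $A$. Assume $|\cos\alpha|<1$ and put $$R=\rho^{(1)}_\infty=\sigma^{(0)}+\sum_{u\ge1}\cos^u(\alpha)\,(\sigma^{(u)}+\sigma^{(-u)}),\qquad \sigma^{(s)}_{jk}=\sigma(k-j+sd),\quad 0\le j,k<d.$$ Then $\rho_\infty=\lim_{m\to\infty}\rho_{md}$ exists and is a density matrix; it is gauge-invariant quasi-free with symbol $R$, i.e. $\mathrm{tr}(\rho_\infty a^*(\phi_m)\cdots a^*(\phi_1)a(\psi_1)\cdots a(\psi_n))=\delta_{nm}\det(\langle\psi_j,R\phi_k\rangle)$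 for all $n,m$ and all $\phi_k,\psi_j\in\mathcal H_s$. Moreover $R$ is the limit of the one-body reduced density matrices $(\mathrm{tr}(\rho_{md}a_k^*a_j))_{j,k}$, and $0\le R\le1$. With $M(R)=R(1-R)^{-1}$: 1. if $R<1$, then on $\mathbb C\oplus\mathcal H_s\oplus\mathcal H_s^{\wedge2}\oplus\dots\oplus\mathcal H_s^{\wedge d}$ $$\rho_\infty=\det(1-R)\,\bigl[1\oplus M(R)\oplus (M(R)\wedge M(R))\oplus\cdots\oplus\det M(R)\bigr];$$ 2. if $0<R<1$, then also $\rho_\infty=\det(1-R)\,\exp\bigl(d\Gamma(\ln M(R))\bigr)$; 3. in all cases the formulas hold by continuity: $\rho_\infty$ is the limit of $\det(1-R')\,[1\oplus M(R')\oplus\cdots\oplus\det M(R')]$ as $R'\to R$ with $0<R'<1$. -/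

import Mathlib

open scoped ComplexOrder

namespace FermionWalk

/-! ### Fermionic Fock space over `ℓ²(ι)` in the occupation number basis

For a linearly ordered set `ι` with canonical orthonormal basis `(e_j)` of `ℓ²(ι)`, the vectors
`e_A = e_{i₁} ∧ ⋯ ∧ e_{i_q}`, `A = {i₁ < ⋯ < i_q}`, form an orthonormal basis of the antisymmetric
Fock space over `ℓ²(ι)`, so that this space is `ℓ²` of the finite subsets of `ι`; `e_∅` is the
vacuum, and `e_j ∧ e_{i₁} ∧ ⋯ ∧ e_{i_q} = (-1)^{#{i ∈ A, i < j}} e_{A ∪ {j}}` for `j ∉ A`. -/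

/-- The Hilbert space `ℓ²(κ)`. -/
noncomputable abbrev L2 (κ : Type) := lp (fun _ : κ => ℂ) 2

/-- The antisymmetric Fock space over `ℓ²(ι)`. -/
noncomputable abbrev Fock (ι : Type) := L2 (Finset ι)

theorem weightedComp_aux {κ : Type} (f : κ → κ) (s : Set κ) (hf : Set.InjOn f s) (w : κ → ℂ)
    (hw : ∀ k, ‖w k‖ ≤ 1) (hw0 : ∀ k, k ∉ s → w k = 0) (x : L2 κ) :
    Memℓp (fun k => w k * x (f k)) 2 ∧ ∑' k, ‖w k * x (f k)‖ ^ (2:ℝ) ≤ ‖x‖ ^ (2:ℝ) := by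
  have h2 : (0:ℝ) < (2 : ENNReal).toReal := by norm_num
  have hx : HasSum (fun k => ‖x k‖ ^ (2:ℝ)) (‖x‖ ^ (2:ℝ)) := by
    simpa using lp.hasSum_norm h2 x
  have hx' : Summable (fun k : s => ‖x (f k)‖ ^ (2:ℝ)) :=
    hx.summable.comp_injective (i := fun k : s => f k) (fun a b h => Subtype.ext (hf a.2 b.2 h))
  have hle : ∀ k, ‖w k * x (f k)‖ ^ (2:ℝ) ≤ s.indicator (fun k => ‖x (f k)‖ ^ (2:ℝ)) k := by
    intro k
    by_cases hk : k ∈ s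
    · rw [Set.indicator_of_mem hk, norm_mul]
      gcongr
      exact mul_le_of_le_one_left (norm_nonneg _) (hw k)
    · rw [Set.indicator_of_notMem hk, hw0 k hk]; simp
  have hs : Summable (s.indicator (fun k => ‖x (f k)‖ ^ (2:ℝ))) :=
    summable_subtype_iff_indicator.1 hx'
  have hs' : Summable (fun k => ‖w k * x (f k)‖ ^ (2:ℝ)) :=
    Summable.of_nonneg_of_le (fun k => by positivity) hle hs
  refine ⟨memℓp_gen (by simpa using hs'), ?_⟩
  calc _ ≤ ∑' k, s.indicator (fun k => ‖x (f k)‖ ^ (2:ℝ)) k := hs'.tsum_le_tsum hle hs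
    _ = ∑' k : s, ‖x (f k)‖ ^ (2:ℝ) := (tsum_subtype s _).symm
    _ ≤ ∑' k, ‖x k‖ ^ (2:ℝ) := by
        refine Summable.tsum_le_tsum_of_inj (fun k : s => f k)
          (fun a b h => Subtype.ext (hf a.2 b.2 h)) ?_ ?_ hx' hx.summable
        · intros; positivity
        · intros; exact le_rfl
    _ = _ := hx.tsum_eq

/-- The bounded operator `(T x)(k) = w(k) x(f(k))` on `ℓ²(κ)`, for weights `|w| ≤ 1` supported in a
set on which `f` is injective. -/
noncomputable def weightedComp {κ : Type} (f : κ → κ) (s : Set κ) (hf : Set.InjOn f s) (w : κ → ℂ)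
    (hw : ∀ k, ‖w k‖ ≤ 1) (hw0 : ∀ k, k ∉ s → w k = 0) : L2 κ →L[ℂ] L2 κ :=
  LinearMap.mkContinuous
    { toFun := fun x => ⟨fun k => w k * x (f k), (weightedComp_aux f s hf w hw hw0 x).1⟩
      map_add' := fun x y => by
        ext k
        exact mul_add (w k) (x (f k)) (y (f k))
      map_smul' := fun c x => by ext k; simp; ring } 1 (fun x => by
      refine lp.norm_le_of_tsum_le (by norm_num) (by positivity) ?_
      simpa using (weightedComp_aux f s hf w hw hw0 x).2)

/-- The sign `(-1)^{#{i ∈ A, i < j}}`. -/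
noncomputable def sgn {ι : Type} [LinearOrder ι] (j : ι) (A : Finset ι) : ℂ :=
  (-1) ^ (A.filter (· < j)).card

/-- The creation operator `c*(e_j)`: `(c*(e_j) ψ)(A) = sgn j A · ψ(A \ {j})` if `j ∈ A`, else `0`;
that is, `c*(e_j) e_B = e_j ∧ e_B`. -/
noncomputable def createAt {ι : Type} [LinearOrder ι] (j : ι) : Fock ι →L[ℂ] Fock ι :=
  weightedComp (fun A => A.erase j) {A | j ∈ A} (Finset.erase_injOn' j)
    (fun A => if j ∈ A then sgn j A else 0)
    (fun A => by split_ifs <;> simp [sgn]) (fun A hA => if_neg hA)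

/-- The annihilation operator `c(e_j)`, the adjoint of `c*(e_j)`. -/
noncomputable def annihilateAt {ι : Type} [LinearOrder ι] (j : ι) : Fock ι →L[ℂ] Fock ι :=
  star (createAt j)

/-- The creation operator `c*(φ) = ∑_j φ(j) c*(e_j)`, `φ ∈ ℓ²(ι)`; the series converges in operator
norm, see `summable_create`. -/
noncomputable def create {ι : Type} [LinearOrder ι] (φ : L2 ι) : Fock ι →L[ℂ] Fock ι :=
  ∑' j, φ j • createAt j

/-- The annihilation operator `c(φ)`, the adjoint of `c*(φ)`. -/
noncomputable def annihilate {ι : Type} [LinearOrder ι] (φ : L2 ι) : Fock ι →L[ℂ] Fock ι :=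
  star (create φ)

theorem createAt_apply {ι : Type} [LinearOrder ι] (j : ι) (x : Fock ι) (A : Finset ι) :
    createAt j x A = if j ∈ A then sgn j A * x (A.erase j) else 0 := by
  change (if j ∈ A then sgn j A else 0) * x (A.erase j) = _
  split_ifs <;> simp

theorem annihilateAt_apply {ι : Type} [LinearOrder ι] (j : ι) (x : Fock ι) (A : Finset ι) :
    annihilateAt j x A = if j ∈ A then 0 else sgn j A * x (insert j A) := by
  have h1 : annihilateAt j x A = inner ℂ (lp.single 2 A (1:ℂ)) (annihilateAt j x) := by
    rw [lp.inner_single_left]; simp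
  rw [h1, annihilateAt, ContinuousLinearMap.star_eq_adjoint,
    ContinuousLinearMap.adjoint_inner_right, lp.inner_eq_tsum]
  simp only [createAt_apply]
  rw [tsum_eq_single (insert j A)]
  · by_cases h : j ∈ A
    · have : A ≠ A.erase j := fun hh => by rw [hh] at h; simp at h
      simp [h, lp.single_apply, this.symm]
    · have hs : sgn j (insert j A) = sgn j A := by simp [sgn, Finset.filter_insert]
      have hr : (starRingEnd ℂ) (sgn j A) = sgn j A := by simp [sgn]
      simp [h, lp.single_apply, hs, hr, mul_comm]
  · intro B hB
    by_cases h : j ∈ B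
    · have : B.erase j ≠ A := fun hh => hB (by rw [← hh, Finset.insert_erase h])
      simp [h, lp.single_apply, this]
    · simp [h]

theorem sgn_erase {ι : Type} [LinearOrder ι] (i j : ι) (A : Finset ι) (h : j ∈ A) :
    sgn i (A.erase j) = (if j < i then -1 else 1) * sgn i A := by
  unfold sgn
  rw [Finset.filter_erase]
  split_ifs with hji
  · have hm : j ∈ A.filter (· < i) := by simp [h, hji]
    rw [← Finset.card_erase_add_one hm, pow_succ]; ring
  · rw [Finset.erase_eq_of_notMem (by simp [hji]), one_mul]

theorem sgn_insert {ι : Type} [LinearOrder ι] (i j : ι) (A : Finset ι) (h : j ∉ A) :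
    sgn i (insert j A) = (if j < i then -1 else 1) * sgn i A := by
  have := sgn_erase i j (insert j A) (by simp)
  rw [Finset.erase_insert h] at this
  rw [this]; split_ifs <;> simp

theorem sgn_mul_self {ι : Type} [LinearOrder ι] (i : ι) (A : Finset ι) : sgn i A * sgn i A = 1 := by
  rw [sgn, ← mul_pow]; simp

/-- The canonical anticommutation relation `c(e_i) c*(e_j) + c*(e_j) c(e_i) = δ_{ij}`. -/
theorem car {ι : Type} [LinearOrder ι] (i j : ι) :
    annihilateAt i * createAt j + createAt j * annihilateAt i
      = if i = j then (1 : Fock ι →L[ℂ] Fock ι) else 0 := by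
  ext x A
  have : (if i = j then (1 : Fock ι →L[ℂ] Fock ι) else 0) x A = if i = j then x A else 0 := by
    split_ifs <;> simp
  rw [this]
  change annihilateAt i (createAt j x) A + createAt j (annihilateAt i x) A = _
  simp only [createAt_apply, annihilateAt_apply]
  by_cases hij : i = j
  · subst hij
    by_cases h : i ∈ A
    · simp [h, sgn_erase, ← mul_assoc, sgn_mul_self]
    · simp [h, sgn_insert, ← mul_assoc, sgn_mul_self]
  · by_cases hi : i ∈ A <;> by_cases hj : j ∈ A
    · simp [hi, hj, hij]
    · have : ¬ (j = i) := fun h => hij h.symm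
      simp [hi, hj, hij]
    · have he : (insert i A).erase j = insert i (A.erase j) :=
        Finset.erase_insert_of_ne hij
      rw [he]
      simp only [hi, hj, hij, Finset.mem_insert, Finset.mem_erase, sgn_insert _ _ _ hi,
        sgn_erase _ _ _ hj, if_true, if_false, or_true, and_false]
      rcases lt_or_gt_of_ne hij with h | h <;> simp [h, h.not_gt] <;> ring
    · have : ¬ (j = i) := fun h => hij h.symm
      simp [hi, hj, hij, this]

theorem norm_sum_createAt_sq_le {ι : Type} [LinearOrder ι] (φ : ι → ℂ) (s : Finset ι) :
    ‖∑ j ∈ s, φ j • (createAt j : Fock ι →L[ℂ] Fock ι)‖ ^ 2 ≤ ∑ j ∈ s, ‖φ j‖ ^ 2 := by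
  set T := ∑ j ∈ s, φ j • (createAt j : Fock ι →L[ℂ] Fock ι) with hT
  have hstar : star T = ∑ j ∈ s, star (φ j) • (annihilateAt j : Fock ι →L[ℂ] Fock ι) := by
    simp [hT, star_sum, annihilateAt]
  have h1 : star T * T + T * star T
      = ((∑ j ∈ s, ‖φ j‖ ^ 2 : ℝ) : ℂ) • (1 : Fock ι →L[ℂ] Fock ι) := by
    rw [hstar, hT, Finset.sum_mul_sum, Finset.sum_mul_sum, Finset.sum_comm (s := s) (t := s)
      (f := fun i j => (φ i • (createAt i : Fock ι →L[ℂ] Fock ι)) * star (φ j) • annihilateAt j),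
      ← Finset.sum_add_distrib]
    simp only [← Finset.sum_add_distrib, smul_mul_smul_comm]
    have : ∀ i ∈ s, ∑ j ∈ s, ((star (φ i) * φ j) • ((annihilateAt i : Fock ι →L[ℂ] Fock ι)
        * createAt j) + (φ j * star (φ i)) • (createAt j * annihilateAt i))
        = ((‖φ i‖ ^ 2 : ℝ) : ℂ) • (1 : Fock ι →L[ℂ] Fock ι) := by
      intro i hi
      rw [Finset.sum_eq_single i]
      · rw [mul_comm (φ i), ← smul_add, car, if_pos rfl]
        congr 1
        rw [Complex.star_def, Complex.conj_mul']; simp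
      · intro j _ hj
        rw [mul_comm (φ j), ← smul_add, car, if_neg (Ne.symm hj), smul_zero]
      · exact fun h => absurd hi h
    rw [Finset.sum_congr rfl this, ← Finset.sum_smul]
    push_cast; rfl
  have hS : 0 ≤ ∑ j ∈ s, ‖φ j‖ ^ 2 := Finset.sum_nonneg fun _ _ => by positivity
  have h2 : ∀ x, ‖T x‖ ^ 2 ≤ (∑ j ∈ s, ‖φ j‖ ^ 2) * ‖x‖ ^ 2 := by
    intro x
    have h3 := congrArg (fun A : Fock ι →L[ℂ] Fock ι => (inner ℂ (A x) x).re) h1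
    simp only [add_apply, mul_apply_eq_comp, inner_add_left,
      Complex.add_re] at h3
    have e := ContinuousLinearMap.adjoint_inner_right T (ContinuousLinearMap.adjoint T x) x
    rw [ContinuousLinearMap.star_eq_adjoint, ContinuousLinearMap.adjoint_inner_left, ← e] at h3
    simp only [inner_self_eq_norm_sq_to_K, smul_apply,
      one_apply_eq_self, inner_smul_left, Complex.conj_ofReal] at h3
    norm_cast at h3
    have : 0 ≤ ‖(ContinuousLinearMap.adjoint T) x‖ ^ 2 := by positivity
    simp only [Complex.ofReal_re, RCLike.ofReal_pow, Complex.coe_algebraMap, ← Complex.ofReal_pow, ← Complex.ofReal_mul] at h3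
    linarith
  have h4 : ‖T‖ ≤ √(∑ j ∈ s, ‖φ j‖ ^ 2) := by
    refine T.opNorm_le_bound (by positivity) fun x => ?_
    rw [← Real.sqrt_sq (norm_nonneg x), ← Real.sqrt_mul hS]
    exact Real.le_sqrt_of_sq_le (h2 x)
  calc ‖T‖ ^ 2 ≤ √(∑ j ∈ s, ‖φ j‖ ^ 2) ^ 2 := by gcongr
    _ = _ := Real.sq_sqrt hS

/-- The series defining `c*(φ)` converges in operator norm. -/
theorem summable_create {ι : Type} [LinearOrder ι] (φ : L2 ι) :
    Summable fun j => φ j • (createAt j : Fock ι →L[ℂ] Fock ι) := by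
  have hφ : Summable fun j => ‖φ j‖ ^ 2 := by
    have := (lp.hasSum_norm (p := 2) (by norm_num) φ).summable
    simpa using this
  rw [summable_iff_vanishing_norm]
  intro ε hε
  obtain ⟨s, hs⟩ := summable_iff_vanishing_norm.1 hφ (ε ^ 2) (by positivity)
  refine ⟨s, fun t ht => ?_⟩
  have h1 := hs t ht
  rw [Real.norm_of_nonneg (Finset.sum_nonneg fun _ _ => by positivity)] at h1
  exact lt_of_pow_lt_pow_left₀ 2 hε.le ((norm_sum_createAt_sq_le _ t).trans_lt h1)

theorem create_single {ι : Type} [LinearOrder ι] (j : ι) :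
    create (lp.single 2 j (1 : ℂ)) = createAt j := by
  rw [create, tsum_eq_single j]
  · simp [lp.single_apply]
  · intro i hi
    simp [lp.single_apply, hi]

/-! ### The reservoir: `ℋ_r = ℓ²(ℤ)` -/

/-- The unitary operator `(T x)(k) = x(e k)` on `ℓ²(κ)`. -/
noncomputable def permute {κ : Type} (e : κ ≃ κ) : L2 κ →L[ℂ] L2 κ :=
  weightedComp e Set.univ e.injective.injOn (fun _ => 1) (by simp) (by simp)

theorem permute_apply {κ : Type} (e : κ ≃ κ) (x : L2 κ) (k : κ) : permute e x k = x (e k) :=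
  one_mul _

theorem permute_mul {κ : Type} (e f : κ ≃ κ) : permute e * permute f = permute (e.trans f) := by
  ext x k
  change permute e (permute f x) k = _
  simp [permute_apply]

theorem permute_refl {κ : Type} : permute (Equiv.refl κ) = 1 := by
  ext x k
  simp [permute_apply]

theorem star_permute {κ : Type} (e : κ ≃ κ) : star (permute e) = permute e.symm := by
  rw [ContinuousLinearMap.star_eq_adjoint, eq_comm, ContinuousLinearMap.eq_adjoint_iff]
  intro x y
  rw [lp.inner_eq_tsum, lp.inner_eq_tsum, ← e.tsum_eq]
  simp [permute_apply]

/-- The shift `S` on `ℓ²(ℤ)`, `S Ψ_j = Ψ_{j-1}`, that is `(S φ)(i) = φ(i + 1)`. -/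
noncomputable def shift : L2 ℤ →L[ℂ] L2 ℤ := permute (Equiv.addRight (1 : ℤ))

/-- The second quantization `Γ(S)` of the shift, `U_r Ψ_{i₁} ∧ ⋯ ∧ Ψ_{i_q} =
Ψ_{i₁-1} ∧ ⋯ ∧ Ψ_{i_q-1}`, that is `(U_r ψ)(A) = ψ(A + 1)`. No sign occurs, since the
shift preserves the order of `ℤ`. -/
noncomputable def fockShift : Fock ℤ →L[ℂ] Fock ℤ :=
  permute (Equiv.addRight (1 : ℤ)).finsetCongr

/-- The `C*`-algebra `ℬ` generated by all `b*(φ)`, `b(φ)`, `φ ∈ ℓ²(ℤ)`. -/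
noncomputable def carAlgebra : StarSubalgebra ℂ (Fock ℤ →L[ℂ] Fock ℤ) :=
  (StarAlgebra.adjoin ℂ (Set.range (create (ι := ℤ)))).topologicalClosure

theorem create_mem (φ : L2 ℤ) : create φ ∈ carAlgebra :=
  StarSubalgebra.le_topologicalClosure _ (StarAlgebra.subset_adjoin ℂ _ ⟨φ, rfl⟩)

theorem annihilate_mem (φ : L2 ℤ) : annihilate φ ∈ carAlgebra := star_mem (create_mem φ)

theorem createAt_mem (j : ℤ) : createAt j ∈ carAlgebra := by
  rw [← create_single]; exact create_mem _

theorem annihilateAt_mem (j : ℤ) : annihilateAt j ∈ carAlgebra := star_mem (createAt_mem j)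

/-- `b*(φ)` as an element of `ℬ`. -/
noncomputable def bStar (φ : L2 ℤ) : carAlgebra := ⟨create φ, create_mem φ⟩

/-- `b(φ)` as an element of `ℬ`. -/
noncomputable def bOp (φ : L2 ℤ) : carAlgebra := ⟨annihilate φ, annihilate_mem φ⟩

/-- States on `ℬ`: positive normalized (continuous) linear functionals. -/
def IsState (ω : carAlgebra →L[ℂ] ℂ) : Prop :=
  ω 1 = 1 ∧ ∀ x : carAlgebra, 0 ≤ ω (star x * x)

/-- Gauge invariant quasi-free states on `ℬ` with density `D`:
`ω(b*(φ_m) ⋯ b*(φ_1) b(ψ_1) ⋯ b(ψ_n)) = δ_{nm} det (⟨ψ_j, D φ_k⟩)_{j,k}`. -/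
def IsQuasiFree (ω : carAlgebra →L[ℂ] ℂ) (D : L2 ℤ →L[ℂ] L2 ℤ) : Prop :=
  (∀ (n : ℕ) (φ ψ : Fin n → L2 ℤ),
    ω ((List.ofFn fun i => bStar (φ i)).reverse.prod * (List.ofFn fun i => bOp (ψ i)).prod)
      = (Matrix.of fun j k : Fin n => inner ℂ (ψ j) (D (φ k))).det) ∧
  ∀ (m n : ℕ) (φ : Fin m → L2 ℤ) (ψ : Fin n → L2 ℤ), m ≠ n →
    ω ((List.ofFn fun i => bStar (φ i)).reverse.prod * (List.ofFn fun i => bOp (ψ i)).prod) = 0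

/-! ### The sample: `ℋ_s = ℂ^d`, operators on its Fock space as matrices in the basis `(e_A)` -/

/-- Operators on the Fock space of the sample. -/
abbrev SampleOp (d : ℕ) := Matrix (Finset (Fin d)) (Finset (Fin d)) ℂ

/-- The creation operator `a*(v) = ∑_j v_j a*(e_j)`, where `a*(e_j) e_B = e_j ∧ e_B`. -/
noncomputable def aStar {d : ℕ} (v : Fin d → ℂ) : SampleOp d :=
  Matrix.of fun A B => ∑ j, v j * (if j ∈ A ∧ B = A.erase j then sgn j A else 0)

/-- The annihilation operator `a(v)`, the adjoint of `a*(v)`. -/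
noncomputable def aOp {d : ℕ} (v : Fin d → ℂ) : SampleOp d := (aStar v).conjTranspose

/-- The canonical basis vectors of `ℂ^d`. -/
noncomputable def eVec {d : ℕ} (j : Fin d) : Fin d → ℂ := Pi.single j 1

/-- `u_1 ∧ ⋯ ∧ u_q = a*(u_1) ⋯ a*(u_q) Ω`, with `Ω = e_∅`. -/
noncomputable def wedge {d : ℕ} (u : List (Fin d → ℂ)) : Finset (Fin d) → ℂ :=
  (u.map aStar).prod.mulVec (Pi.single ∅ 1)

/-- The operator `Γ(M) = 1 ⊕ M ⊕ (M ∧ M) ⊕ ⋯ ⊕ M^{∧ d}` on `ℂ ⊕ ℋ_s ⊕ ℋ_s^{∧ 2} ⊕ ⋯ ⊕ ℋ_s^{∧ d}`: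
`Γ(M) (e_{i₁} ∧ ⋯ ∧ e_{i_q}) = M e_{i₁} ∧ ⋯ ∧ M e_{i_q}`. -/
noncomputable def secondQuant {d : ℕ} (M : Matrix (Fin d) (Fin d) ℂ) : SampleOp d :=
  Matrix.of fun A B => wedge ((B.sort (· ≤ ·)).map fun j => M.mulVec (eVec j)) A

/-- `dΓ(L) = ∑_{j,k} L_{jk} a_j^* a_k`. -/
noncomputable def dGamma {d : ℕ} (L : Matrix (Fin d) (Fin d) ℂ) : SampleOp d :=
  ∑ j, ∑ k, L j k • (aStar (eVec j) * aOp (eVec k))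

/-- The periodic shift `S_p e_j = e_{j-1}`, `S_p e_0 = e_{d-1}` (subtraction is modulo `d`). -/
def cyclicShift (d : ℕ) [NeZero d] : Matrix (Fin d) (Fin d) ℂ :=
  Matrix.of fun i j => if i = j - 1 then 1 else 0

/-- Density matrices on the Fock space of the sample. -/
def IsDensityMatrix {d : ℕ} (ρ : SampleOp d) : Prop := ρ.PosSemidef ∧ ρ.trace = 1

/-- Even states: `tr (ρ a^#_{k_1} ⋯ a^#_{k_s}) = 0` for all odd `s`; the boolean selects whether
`a^#_k` is `a_k^*` or `a_k`. -/
def IsEven {d : ℕ} (ρ : SampleOp d) : Prop :=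
  ∀ l : List (Fin d × Bool), Odd l.length →
    (ρ * (l.map fun p => if p.2 then aStar (eVec p.1) else aOp (eVec p.1)).prod).trace = 0

/-- Gauge invariant quasi-free density matrices with symbol `R`:
`tr (ρ a*(φ_m) ⋯ a*(φ_1) a(ψ_1) ⋯ a(ψ_n)) = δ_{nm} det (⟨ψ_j, R φ_k⟩)_{j,k}`. -/
def IsQuasiFreeSample {d : ℕ} (ρ : SampleOp d) (R : Matrix (Fin d) (Fin d) ℂ) : Prop :=
  (∀ (n : ℕ) (φ ψ : Fin n → Fin d → ℂ),
    (ρ * ((List.ofFn fun i => aStar (φ i)).reverse.prod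
        * (List.ofFn fun i => aOp (ψ i)).prod)).trace
      = (Matrix.of fun j k : Fin n => dotProduct (star (ψ j)) (R.mulVec (φ k))).det) ∧
  ∀ (m n : ℕ) (φ : Fin m → Fin d → ℂ) (ψ : Fin n → Fin d → ℂ), m ≠ n →
    (ρ * ((List.ofFn fun i => aStar (φ i)).reverse.prod
        * (List.ofFn fun i => aOp (ψ i)).prod)).trace = 0

/-- The one-body reduced density matrix: `⟨e_j, ρ^{(1)} e_k⟩ = tr (ρ a_k^* a_j)`. -/
noncomputable def oneBody {d : ℕ} (ρ : SampleOp d) : Matrix (Fin d) (Fin d) ℂ :=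
  Matrix.of fun j k => (ρ * (aStar (eVec k) * aOp (eVec j))).trace

/-! ### The coupled dynamics -/

/-- Bounded operators on `ℱ = ℱ_-(ℋ_r) ⊗ ℱ_-(ℋ_s)`. Since `ℱ_-(ℋ_s)` has the finite orthonormal
basis `(e_A)`, these are the matrices `(T_{AB})` of bounded operators on `ℱ_-(ℋ_r)`,
`T = ∑_{A,B} T_{AB} ⊗ |e_A⟩⟨e_B|`. -/
abbrev TotalOp (d : ℕ) :=
  CStarMatrix (Finset (Fin d)) (Finset (Fin d)) (Fock ℤ →L[ℂ] Fock ℤ)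

/-- The operator `X ⊗ M` on `ℱ`. -/
noncomputable def tensorOp {d : ℕ} (X : Fock ℤ →L[ℂ] Fock ℤ) (M : SampleOp d) : TotalOp d :=
  CStarMatrix.ofMatrix (Matrix.of fun A B => M A B • X)

/-- The coupling `K = exp (-iα (b_0^* ⊗ a_0 + b_0 ⊗ a_0^*))`. -/
noncomputable def coupling (d : ℕ) [NeZero d] (α : ℝ) : TotalOp d :=
  NormedSpace.exp ((-(Complex.I * (α : ℂ))) •
    (tensorOp (createAt 0) (aOp (eVec 0)) + tensorOp (annihilateAt 0) (aStar (eVec 0))))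

/-- The one step evolution operator `U = (Γ(S) ⊗ Γ(S_p)) K`. -/
noncomputable def evolution (d : ℕ) [NeZero d] (α : ℝ) : TotalOp d :=
  tensorOp fockShift (secondQuant (cyclicShift d)) * coupling d α

/-- `τ^t(T) = U^{*t} T U^t`. -/
noncomputable def heisenberg (d : ℕ) [NeZero d] (α : ℝ) (t : ℕ) (T : TotalOp d) : TotalOp d :=
  star (evolution d α) ^ t * T * evolution d α ^ t

/-- The tensor product algebra `ℬ ⊗ 𝒜`: the operators `∑_{A,B} T_{AB} ⊗ |e_A⟩⟨e_B|` on `ℱ` with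
all `T_{AB}` in `ℬ`. (As `𝒜` consists of all operators on the Fock space of the sample.) -/
noncomputable def totalAlgebra (d : ℕ) : Subalgebra ℂ (TotalOp d) where
  carrier := {T | ∀ A B, T A B ∈ carAlgebra}
  mul_mem' := fun {S T} hS hT A B => by
    rw [CStarMatrix.mul_apply]
    exact sum_mem fun C _ => mul_mem (hS A C) (hT C B)
  add_mem' := fun {S T} hS hT A B => add_mem (hS A B) (hT A B)
  algebraMap_mem' := fun c A B => by
    rw [CStarMatrix.algebraMap_apply]
    split_ifs
    · exact algebraMap_mem _ _
    · exact zero_mem _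

theorem isClosed_carAlgebra : IsClosed (carAlgebra : Set (Fock ℤ →L[ℂ] Fock ℤ)) :=
  StarSubalgebra.isClosed_topologicalClosure _

theorem isClosed_totalAlgebra (d : ℕ) : IsClosed (totalAlgebra d : Set (TotalOp d)) := by
  have : (totalAlgebra d : Set (TotalOp d))
      = ⋂ A, ⋂ B, (fun T : TotalOp d => T A B) ⁻¹' (carAlgebra : Set _) := by
    ext T
    simp only [Set.mem_iInter, Set.mem_preimage]
    rfl
  rw [this]
  refine isClosed_iInter fun A => isClosed_iInter fun B => isClosed_carAlgebra.preimage ?_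
  exact (continuous_apply B).comp (continuous_apply A)

theorem star_mem_totalAlgebra {d : ℕ} {T : TotalOp d} (hT : T ∈ totalAlgebra d) :
    star T ∈ totalAlgebra d := fun A B => star_mem (hT B A)

theorem tensorOp_mem {d : ℕ} {X : Fock ℤ →L[ℂ] Fock ℤ} (hX : X ∈ carAlgebra) (M : SampleOp d) :
    tensorOp X M ∈ totalAlgebra d := fun A B => carAlgebra.toSubalgebra.smul_mem hX (M A B)

theorem coupling_mem (d : ℕ) [NeZero d] (α : ℝ) : coupling d α ∈ totalAlgebra d := by
  refine NormedSpace.exp_mem (s := (totalAlgebra d)) (isClosed_totalAlgebra d) ?_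
  exact (totalAlgebra d).smul_mem (add_mem (tensorOp_mem (createAt_mem 0) _)
    (tensorOp_mem (annihilateAt_mem 0) _)) _

theorem star_fockShift_mul : star fockShift * fockShift = 1 := by
  rw [fockShift, star_permute, permute_mul, Equiv.symm_trans_self, permute_refl]

theorem fockShift_mul_star : fockShift * star fockShift = 1 := by
  rw [fockShift, star_permute, permute_mul, Equiv.self_trans_symm, permute_refl]

theorem sgn_shift (j : ℤ) (A : Finset ℤ) :
    sgn j ((Equiv.addRight (1 : ℤ)).finsetCongr.symm A) = sgn (j + 1) A := by
  unfold sgn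
  congr 1
  rw [← Finset.card_map (Equiv.addRight (1 : ℤ)).toEmbedding]
  congr 1
  ext i
  simp only [Finset.mem_map, Finset.mem_filter, Equiv.finsetCongr_symm, Equiv.finsetCongr_apply]
  constructor
  · rintro ⟨a, ⟨⟨c, hc, rfl⟩, h⟩, rfl⟩
    simp at h ⊢
    exact ⟨hc, by linarith⟩
  · rintro ⟨h1, h2⟩
    exact ⟨i - 1, ⟨⟨i, h1, by simp [sub_eq_add_neg]⟩, by linarith⟩, by simp⟩

theorem conj_createAt (j : ℤ) :
    star fockShift * createAt j * fockShift = createAt (j + 1) := by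
  ext x A
  rw [fockShift, star_permute]
  change permute _ (createAt j (permute _ x)) A = _
  rw [permute_apply, createAt_apply, createAt_apply, permute_apply, sgn_shift]
  have h1 : j ∈ (Equiv.addRight (1 : ℤ)).finsetCongr.symm A ↔ j + 1 ∈ A := by
    simp only [Equiv.finsetCongr_symm, Equiv.finsetCongr_apply, Finset.mem_map]
    constructor
    · rintro ⟨c, hc, rfl⟩; simpa using hc
    · exact fun h => ⟨j + 1, h, by simp⟩
  have h2 : (Equiv.addRight (1 : ℤ)).finsetCongr
      (((Equiv.addRight (1 : ℤ)).finsetCongr.symm A).erase j) = A.erase (j + 1) := by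
    rw [Equiv.finsetCongr_apply, Finset.map_erase, ← Equiv.finsetCongr_apply,
      Equiv.apply_symm_apply]
    rfl
  simp only [h1, h2]

theorem conj_create (φ : L2 ℤ) :
    star fockShift * create φ * fockShift = create (star shift φ) := by
  have hc : star fockShift * create φ * fockShift
      = ∑' j, φ j • (createAt (j + 1) : Fock ℤ →L[ℂ] Fock ℤ) := by
    rw [create, ← (summable_create φ).tsum_mul_left,
      ← ((summable_create φ).mul_left _).tsum_mul_right]
    congr 1
    ext1 j
    rw [mul_smul_comm, smul_mul_assoc, conj_createAt]
  rw [hc, create, 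
    ← (Equiv.addRight (1 : ℤ)).tsum_eq fun j => (star shift φ) j • (createAt j : Fock ℤ →L[ℂ] Fock ℤ)]
  congr 1
  ext1 j
  rw [shift, star_permute, permute_apply]
  simp

/-- `ℬ` is invariant under the free dynamics `X ↦ U_r^* X U_r` of the reservoir. -/
theorem conj_mem {X : Fock ℤ →L[ℂ] Fock ℤ} (hX : X ∈ carAlgebra) :
    star fockShift * X * fockShift ∈ carAlgebra := by
  have hu : star fockShift ∈ unitary (Fock ℤ →L[ℂ] Fock ℤ) :=
    Unitary.mem_iff.2 ⟨by rw [star_star, fockShift_mul_star], by rw [star_star, star_fockShift_mul]⟩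
  let c := Unitary.conjStarAlgAut ℂ (Fock ℤ →L[ℂ] Fock ℤ) ⟨_, hu⟩
  have hcv : ∀ Y, c Y = star fockShift * Y * fockShift := fun Y => by
    simp [c, Unitary.conjStarAlgAut_apply]
  have hcont : Continuous c := by
    have : (c : (Fock ℤ →L[ℂ] Fock ℤ) → _) = fun Y => star fockShift * Y * fockShift := funext hcv
    rw [this]
    fun_prop
  have hle : carAlgebra ≤ carAlgebra.comap (c : (Fock ℤ →L[ℂ] Fock ℤ) →⋆ₐ[ℂ] _) := by
    refine StarSubalgebra.topologicalClosure_minimal (StarAlgebra.adjoin_le ?_)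
      (isClosed_carAlgebra.preimage hcont)
    rintro _ ⟨φ, rfl⟩
    change c (create φ) ∈ carAlgebra
    rw [hcv, conj_create]
    exact create_mem _
  have := hle hX
  change c X ∈ carAlgebra at this
  rwa [hcv] at this

theorem conj_tensorOp_mem {d : ℕ} (M : SampleOp d) {T : TotalOp d} (hT : T ∈ totalAlgebra d) :
    star (tensorOp fockShift M) * T * tensorOp fockShift M ∈ totalAlgebra d := by
  intro A B
  rw [CStarMatrix.mul_apply]
  refine sum_mem fun C _ => ?_
  rw [CStarMatrix.mul_apply, Finset.sum_mul]
  refine sum_mem fun D _ => ?_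
  change star (M D A • fockShift) * T D C * (M C B • fockShift) ∈ carAlgebra
  rw [star_smul, smul_mul_assoc, smul_mul_assoc, mul_smul_comm]
  exact carAlgebra.toSubalgebra.smul_mem (carAlgebra.toSubalgebra.smul_mem (conj_mem (hT D C)) _) _

/-- The dynamics `τ^t` preserves `ℬ ⊗ 𝒜`. -/
theorem heisenberg_mem (d : ℕ) [NeZero d] (α : ℝ) (t : ℕ) {T : TotalOp d}
    (hT : T ∈ totalAlgebra d) : heisenberg d α t T ∈ totalAlgebra d := by
  induction t with
  | zero => simpa [heisenberg] using hT
  | succ t ih =>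
    have : heisenberg d α (t + 1) T = star (coupling d α) *
        (star (tensorOp fockShift (secondQuant (cyclicShift d))) * heisenberg d α t T *
          tensorOp fockShift (secondQuant (cyclicShift d))) * coupling d α := by
      simp only [heisenberg, evolution]
      rw [pow_succ', pow_succ, star_mul]
      simp only [mul_assoc]
    rw [this]
    exact mul_mem (mul_mem (star_mem_totalAlgebra (coupling_mem d α)) (conj_tensorOp_mem _ ih))
      (coupling_mem d α)

/-- The product state `ω ⊗ ρ` on `ℬ ⊗ 𝒜`, `(ω ⊗ ρ)(X ⊗ M) = ω(X) tr(ρ M)`. -/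
noncomputable def productState {d : ℕ} (ω : carAlgebra →L[ℂ] ℂ) (ρ : SampleOp d)
    (T : totalAlgebra d) : ℂ :=
  ∑ A, ∑ B, ρ B A * ω ⟨(T : TotalOp d) A B, T.2 A B⟩

/-- The evolved observable `τ^t(1 ⊗ M)` as an element of `ℬ ⊗ 𝒜`. -/
noncomputable def evolved (d : ℕ) [NeZero d] (α : ℝ) (t : ℕ) (M : SampleOp d) : totalAlgebra d :=
  ⟨heisenberg d α t (tensorOp 1 M), heisenberg_mem d α t (tensorOp_mem (one_mem _) M)⟩

/-- The reduced density matrix `ρ_t` on the sample at time `t`, i.e. the matrix with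
`tr (ρ_t M) = (ω ⊗ ρ)(τ^t(1 ⊗ M))` for all `M`; see `trace_reducedDensity_mul`. -/
noncomputable def reducedDensity (d : ℕ) [NeZero d] (α : ℝ) (ω : carAlgebra →L[ℂ] ℂ)
    (ρ : SampleOp d) (t : ℕ) : SampleOp d :=
  Matrix.of fun A B => productState ω ρ (evolved d α t (Matrix.single B A 1))

theorem productState_tensorOp {d : ℕ} (ω : carAlgebra →L[ℂ] ℂ) (ρ M : SampleOp d)
    (X : carAlgebra) :
    productState ω ρ ⟨tensorOp (X : Fock ℤ →L[ℂ] Fock ℤ) M, tensorOp_mem X.2 M⟩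
      = ω X * (ρ * M).trace := by
  simp only [productState, Matrix.trace, Matrix.diag, Matrix.mul_apply, Finset.mul_sum]
  rw [Finset.sum_comm]
  refine Finset.sum_congr rfl fun B _ => Finset.sum_congr rfl fun A _ => ?_
  have : (⟨(tensorOp (X : Fock ℤ →L[ℂ] Fock ℤ) M : TotalOp d) A B, tensorOp_mem X.2 M A B⟩
      : carAlgebra) = M A B • X := rfl
  rw [this, map_smul, smul_eq_mul]; ring

theorem trace_reducedDensity_mul (d : ℕ) [NeZero d] (α : ℝ) (ω : carAlgebra →L[ℂ] ℂ)
    (ρ : SampleOp d) (t : ℕ) (M : SampleOp d) :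
    (reducedDensity d α ω ρ t * M).trace = productState ω ρ (evolved d α t M) := by
  let Φ : totalAlgebra d →ₗ[ℂ] ℂ :=
    { toFun := productState ω ρ
      map_add' := fun S T => by
        simp only [productState, ← Finset.sum_add_distrib, ← mul_add, ← map_add]; rfl
      map_smul' := fun c T => by
        simp only [productState, Finset.smul_sum, RingHom.id_apply]
        refine Finset.sum_congr rfl fun A _ => Finset.sum_congr rfl fun B _ => ?_
        rw [← mul_smul_comm, ← map_smul]; rfl }
  let Ψ : SampleOp d →ₗ[ℂ] totalAlgebra d :=
    { toFun := evolved d α t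
      map_add' := fun M N => Subtype.ext <| by
        have : (tensorOp 1 (M + N) : TotalOp d) = tensorOp 1 M + tensorOp 1 N := by
          ext A B : 2; exact add_smul (M A B) (N A B) _
        simp [evolved, heisenberg, this, mul_add, add_mul]
      map_smul' := fun c M => Subtype.ext <| by
        have : (tensorOp 1 (c • M) : TotalOp d) = c • tensorOp 1 M := by
          ext A B : 2; exact mul_smul c (M A B) _
        simp [evolved, heisenberg, this] }
  have h : productState ω ρ (evolved d α t M) = ∑ A, ∑ B, M A B *
      productState ω ρ (evolved d α t (Matrix.single A B 1)) := by
    change Φ (Ψ M) = ∑ A, ∑ B, M A B * Φ (Ψ (Matrix.single A B 1))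
    conv_lhs => rw [Matrix.matrix_eq_sum_single M]
    simp only [map_sum]
    refine Finset.sum_congr rfl fun A _ => Finset.sum_congr rfl fun B _ => ?_
    rw [← smul_eq_mul, ← map_smul, ← map_smul, Matrix.smul_single, smul_eq_mul, mul_one]
  rw [h, Finset.sum_comm]
  simp only [Matrix.trace, Matrix.diag, Matrix.mul_apply, reducedDensity, Matrix.of_apply]
  exact Finset.sum_congr rfl fun B _ => Finset.sum_congr rfl fun A _ => mul_comm _ _

/-! ### The asymptotic one-body density and the quasi-free density matrix with a given symbol -/

/-- `σ(k)`, so that the matrix elements of a shift invariant `D` are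
`⟨Ψ_j, D Ψ_k⟩ = σ(k - j)`. -/
noncomputable def symbol (D : L2 ℤ →L[ℂ] L2 ℤ) (k : ℤ) : ℂ :=
  inner ℂ (lp.single 2 (0 : ℤ) (1 : ℂ) : L2 ℤ) (D (lp.single 2 k (1 : ℂ)))

/-- The matrices `σ^{(s)}_{jk} = σ(k - j + s d)`. -/
noncomputable def sigmaBlock (d : ℕ) (D : L2 ℤ →L[ℂ] L2 ℤ) (s : ℤ) : Matrix (Fin d) (Fin d) ℂ :=
  Matrix.of fun j k => symbol D ((k : ℤ) - (j : ℤ) + s * d)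

/-- `ρ^{(1)}_∞ = σ^{(0)} + ∑_{u ≥ 1} cos^u(α) (σ^{(u)} + σ^{(-u)})`. -/
noncomputable def asymptoticOneBody (d : ℕ) (α : ℝ) (D : L2 ℤ →L[ℂ] L2 ℤ) :
    Matrix (Fin d) (Fin d) ℂ :=
  sigmaBlock d D 0 + ∑' u : ℕ, ((Real.cos α : ℂ) ^ (u + 1)) •
    (sigmaBlock d D ((u : ℤ) + 1) + sigmaBlock d D (-((u : ℤ) + 1)))

/-- `det(1 - R) [1 ⊕ M ⊕ (M ∧ M) ⊕ ⋯ ⊕ det M]` with `M = R (1 - R)⁻¹`. -/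
noncomputable def quasiFreeDensity {d : ℕ} (R : Matrix (Fin d) (Fin d) ℂ) : SampleOp d :=
  (1 - R).det • secondQuant (R * (1 - R)⁻¹)

/-- `det(1 - R) exp (dΓ (ln (R (1 - R)⁻¹)))`. -/
noncomputable def gibbsDensity {d : ℕ} (R : Matrix (Fin d) (Fin d) ℂ) : SampleOp d :=
  (1 - R).det • NormedSpace.exp (dGamma (cfc Real.log (R * (1 - R)⁻¹)))

end FermionWalk

open FermionWalk

namespace FermionWalk

/-! ### Canonical anticommutation relations -/

/-! The coupling is quadratic in the fermions, so one Heisenberg step acts linearly on annihilation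
operators. To see this, the mutually commuting operators of sample and reservoir are twisted by the
sample parity: `sampleGen v` is 1 ⊗ i(-1)^N a(v) and `reservoirGen d φ` is b(φ) ⊗ (-1)^N. These form
one anticommuting family, and conjugation by the coupling rotates the pair at site 0 by the angle α
(`coupling_conj_sampleGen_zero`). During a turn of d steps each sample site meets the reservoir
exactly once. Hence after m turns the generator of a(v) is cos^m α times itself plus the reservoir
generator of a vector T_m v = `outgoingVec d α m v`, a superposition of the modes already emitted
(`heisenberg_sampleGen`).

Since |cos α| < 1, the memory of the sample disappears in norm, and an even word in the a's becomes
asymptotically the same word in the b's with vectors T_m v (`tendsto_heisenberg_word`).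
Quasi-freeness evaluates it as a determinant of the numbers ⟨T_m ψ_j, D T_m φ_k⟩. Odd words vanish
at all times by conservation of total parity. The Gram matrices of the T_m e_j satisfy G_{m+1} =
cos²α G_m + sin²α S_m, where S_m are the partial sums of the series for R, so G_m tends to R
(`tendsto_outgoingGram`). As a limit of such Gram matrices R is positive, and the same argument for
1 - D gives R ≤ 1.

Normally ordered words span all operators on the sample (`span_sampleWord`). Convergence of the
correlation functions is therefore convergence of the reduced density matrices, and a quasi-free
matrix is determined by its symbol. The limit is identified by showing that det(1-R) Γ(R(1-R)⁻¹) is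
quasi-free with symbol R when 1 - R > 0: this is Wick's theorem, obtained from cyclicity of the
trace and Γ(M) a*(v) = a*(Mv) Γ(M) (`trace_secondQuant_mul`). Diagonalization gives the exponential
form (`exp_dGamma_log`). For singular symbols the determinants are still continuous in the symbol,
so the densities converge (`tendsto_quasiFreeDensity`). -/

theorem createAt_anticomm {ι : Type} [LinearOrder ι] (i j : ι) :
    createAt i * createAt j = -(createAt j * createAt i : Fock ι →L[ℂ] Fock ι) := by
  ext x A
  change createAt i (createAt j x) A = -(createAt j (createAt i x) A)
  simp only [createAt_apply]
  by_cases hij : i = j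
  · subst hij; simp
  · have hji : ¬ j = i := fun h => hij h.symm
    by_cases hi : i ∈ A <;> by_cases hj : j ∈ A
    · simp only [hi, hj, hij, hji, Finset.mem_erase, ne_eq, not_false_eq_true, and_self, if_true,
        sgn_erase _ _ _ hi, sgn_erase _ _ _ hj, Finset.erase_right_comm (a := i) (b := j)]
      -- Erasing the smaller index flips the sign attached to the larger one, but not conversely, so
      -- the two orders differ by exactly one factor -1.
      rcases lt_or_gt_of_ne hij with h | h <;> simp [h, h.not_gt] <;> ring
    all_goals simp [hi, hj]

theorem annihilateAt_anticomm {ι : Type} [LinearOrder ι] (i j : ι) :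
    annihilateAt i * annihilateAt j = -(annihilateAt j * annihilateAt i : Fock ι →L[ℂ] Fock ι) := by
  have := congrArg star (createAt_anticomm j i)
  simpa [annihilateAt] using this

section Sample

variable {d : ℕ}

/-- A vector of `ℂ^{2^d}` as an element of the Fock space over `ℂ^d`. -/
noncomputable def toFock (x : Finset (Fin d) → ℂ) : Fock (Fin d) := ⟨x, memℓp_gen (Summable.of_finite)⟩

theorem toFock_apply (x : Finset (Fin d) → ℂ) (A : Finset (Fin d)) : toFock x A = x A := rfl

theorem aStar_eVec_apply (j : Fin d) (A B : Finset (Fin d)) :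
    aStar (eVec j) A B = if j ∈ A ∧ B = A.erase j then sgn j A else 0 := by
  simp only [aStar, eVec, Pi.single_apply, Matrix.of_apply]
  rw [Finset.sum_eq_single j (fun i _ hi => by simp [hi]) (by simp)]
  simp

theorem aStar_eVec_mulVec (j : Fin d) (x : Finset (Fin d) → ℂ) :
    toFock ((aStar (eVec j)).mulVec x) = createAt j (toFock x) := by
  ext A
  rw [createAt_apply, toFock_apply, toFock_apply, Matrix.mulVec, dotProduct]
  simp [aStar_eVec_apply, ite_and]

theorem aOp_eVec_mulVec (j : Fin d) (x : Finset (Fin d) → ℂ) :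
    toFock ((aOp (eVec j)).mulVec x) = annihilateAt j (toFock x) := by
  ext A
  rw [annihilateAt_apply, toFock_apply, toFock_apply, Matrix.mulVec, dotProduct]
  simp only [aOp, Matrix.conjTranspose_apply, aStar_eVec_apply]
  rw [Finset.sum_eq_single (insert j A)]
  · by_cases h : j ∈ A
    · have : A ≠ A.erase j := fun hh => by rw [hh] at h; simp at h
      simp [h, this]
    · have hs : sgn j (insert j A) = sgn j A := by simp [sgn, Finset.filter_insert]
      have hr : star (sgn j A) = sgn j A := by simp [sgn]
      simp [h, hs, hr]
  · intro B _ hB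
    by_cases h : j ∈ B
    · have : A ≠ B.erase j := fun hh => hB (by rw [hh, Finset.insert_erase h])
      simp [h, this]
    · simp [h]
  · simp

/-- Transfers to the sample matrices the relations `car` and `createAt_anticomm`, which hold on the
Fock space over any linearly ordered index set. -/
theorem ext_toFock {M N : SampleOp d} (h : ∀ x, toFock (M.mulVec x) = toFock (N.mulVec x)) :
    M = N := by
  refine Matrix.ext_of_mulVec_single fun i => ?_
  funext A
  exact congrArg (fun y : Fock (Fin d) => y A) (h _)

theorem toFock_add (x y : Finset (Fin d) → ℂ) : toFock (x + y) = toFock x + toFock y := rfl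

theorem toFock_neg (x : Finset (Fin d) → ℂ) : toFock (-x) = -toFock x := rfl

theorem car_eVec (i j : Fin d) :
    aOp (eVec i) * aStar (eVec j) + aStar (eVec j) * aOp (eVec i)
      = if i = j then (1 : SampleOp d) else 0 := by
  refine ext_toFock fun x => ?_
  have := congrArg (fun T : Fock (Fin d) →L[ℂ] Fock (Fin d) => T (toFock x)) (car i j)
  simp only [Matrix.add_mulVec, ← Matrix.mulVec_mulVec, toFock_add, aStar_eVec_mulVec,
    aOp_eVec_mulVec]
  refine Eq.trans this ?_
  split_ifs
  · simp
  · simp; rfl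

theorem aStar_eVec_anticomm (i j : Fin d) :
    aStar (eVec i) * aStar (eVec j) = -(aStar (eVec j) * aStar (eVec i)) := by
  refine ext_toFock fun x => ?_
  simp only [Matrix.neg_mulVec, ← Matrix.mulVec_mulVec, toFock_neg, aStar_eVec_mulVec]
  exact congrArg (fun T : Fock (Fin d) →L[ℂ] Fock (Fin d) => T (toFock x)) (createAt_anticomm i j)

theorem aStar_eq_sum (v : Fin d → ℂ) : aStar v = ∑ j, v j • aStar (eVec j) := by
  ext A B
  simp only [Matrix.sum_apply, Matrix.smul_apply, aStar_eVec_apply, smul_eq_mul]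
  rfl

theorem aOp_eq_sum (v : Fin d → ℂ) : aOp v = ∑ j, star (v j) • aOp (eVec j) := by
  rw [aOp, aStar_eq_sum, Matrix.conjTranspose_sum]
  simp [aOp]

theorem star_aStar (v : Fin d → ℂ) : star (aStar v) = aOp v := rfl

theorem star_aOp (v : Fin d → ℂ) : star (aOp v) = aStar v := Matrix.conjTranspose_conjTranspose _

theorem car_sample (v w : Fin d → ℂ) :
    aOp v * aStar w + aStar w * aOp v = (star v ⬝ᵥ w) • (1 : SampleOp d) := by
  rw [aOp_eq_sum, aStar_eq_sum, Finset.sum_mul_sum, Finset.sum_mul_sum,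
    Finset.sum_comm (γ := Fin d) (f := fun i j => w i • aStar (eVec i) * star (v j) • aOp (eVec j)),
    ← Finset.sum_add_distrib]
  simp only [← Finset.sum_add_distrib, smul_mul_smul_comm]
  rw [dotProduct, Finset.sum_smul]
  refine Finset.sum_congr rfl fun i _ => ?_
  rw [Finset.sum_eq_single i]
  · rw [mul_comm (w i), ← smul_add, car_eVec, if_pos rfl]; rfl
  · intro j _ hj
    rw [mul_comm (w j), ← smul_add, car_eVec, if_neg (Ne.symm hj), smul_zero]
  · simp

theorem aStar_anticomm (v w : Fin d → ℂ) : aStar v * aStar w = -(aStar w * aStar v) := by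
  rw [aStar_eq_sum v, aStar_eq_sum w, Finset.sum_mul_sum, Finset.sum_mul_sum, Finset.sum_comm,
    ← Finset.sum_neg_distrib]
  refine Finset.sum_congr rfl fun i _ => ?_
  rw [← Finset.sum_neg_distrib]
  refine Finset.sum_congr rfl fun j _ => ?_
  rw [smul_mul_smul_comm, smul_mul_smul_comm, aStar_eVec_anticomm, smul_neg, mul_comm]

theorem aOp_anticomm (v w : Fin d → ℂ) : aOp v * aOp w = -(aOp w * aOp v) := by
  have := congrArg star (aStar_anticomm w v)
  simpa only [star_neg, star_mul, star_aStar] using this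

theorem aStar_add (v w : Fin d → ℂ) : aStar (v + w) = aStar v + aStar w := by
  rw [aStar_eq_sum, aStar_eq_sum v, aStar_eq_sum w, ← Finset.sum_add_distrib]
  simp [add_smul]

theorem aStar_smul (c : ℂ) (v : Fin d → ℂ) : aStar (c • v) = c • aStar v := by
  rw [aStar_eq_sum, aStar_eq_sum v, Finset.smul_sum]
  simp [mul_smul]

/-! ### Ordered products of anticommuting elements -/

/-- `c_{i₁} ⋯ c_{i_q}` for `A = {i₁ < ⋯ < i_q}`. -/
noncomputable def orderedProd {R : Type*} [Monoid R] (c : Fin d → R) (A : Finset (Fin d)) : R :=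
  ((A.sort (· ≤ ·)).map c).prod

theorem orderedProd_insert_of_lt {R : Type*} [Monoid R] (c : Fin d → R) {j : Fin d}
    {A : Finset (Fin d)} (h : ∀ i ∈ A, j < i) :
    orderedProd c (insert j A) = c j * orderedProd c A := by
  rw [orderedProd, Finset.sort_insert _ (fun b hb => (h b hb).le) (fun hj => (h j hj).false),
    List.map_cons, List.prod_cons, orderedProd]

theorem orderedProd_empty {R : Type*} [Monoid R] (c : Fin d → R) : orderedProd c ∅ = 1 := by
  simp [orderedProd]

theorem sgn_of_lt {ι : Type} [LinearOrder ι] {j : ι} {A : Finset ι} (h : ∀ i ∈ A, j < i) :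
    sgn j A = 1 := by
  rw [sgn, Finset.filter_false_of_mem fun i hi => (h i hi).not_gt]; simp

/-- The letter `c j` is moved to its sorted place, one sign for each smaller index. Only
anticommutation enters, so the sign is the same for the creators of arbitrary vectors as for those
of the basis. -/
theorem mul_orderedProd {R : Type*} [Ring R] [Algebra ℂ R] (c : Fin d → R)
    (hc : ∀ i j, c i * c j = -(c j * c i)) (j : Fin d) (A : Finset (Fin d)) :
    c j * orderedProd c A = if j ∈ A then 0 else sgn j A • orderedProd c (insert j A) := by
  have hsq : ∀ i, c i * c i = 0 := fun i => by
    have h := hc i i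
    have h2 : (2 : ℂ) • (c i * c i) = 0 := by
      rw [two_smul]; nth_rewrite 1 [h]; simp
    exact (smul_eq_zero_iff_right (two_ne_zero)).1 h2
  induction A using Finset.induction_on_min with
  | empty => 
    rw [if_neg (by simp), sgn_of_lt (by simp), one_smul, orderedProd_insert_of_lt c (by simp)]
  | insert a s ha ih =>
    have has : a ∉ s := fun h => (ha a h).false
    rcases lt_trichotomy j a with h | h | h
    · have hl : ∀ i ∈ insert a s, j < i := by
        intro i hi
        rcases Finset.mem_insert.1 hi with rfl | hi
        · exact h
        · exact h.trans (ha i hi)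
      rw [if_neg (fun hj => (hl j hj).false), sgn_of_lt hl, one_smul, orderedProd_insert_of_lt c hl]
    · subst h
      rw [if_pos (by simp), orderedProd_insert_of_lt c ha, ← mul_assoc, hsq, zero_mul]
    · rw [orderedProd_insert_of_lt c ha, ← mul_assoc, hc j a, neg_mul, mul_assoc, ih]
      by_cases hj : j ∈ s
      · simp [hj]
      · have hl : ∀ i ∈ insert j s, a < i := by
          intro i hi
          rcases Finset.mem_insert.1 hi with rfl | hi
          · exact h
          · exact ha i hi
        rw [if_neg hj, if_neg (by simp [hj, h.ne']), Finset.insert_comm,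
          orderedProd_insert_of_lt c hl, sgn_insert _ _ _ has, if_pos h]
        simp

/-! ### Second quantization -/

/-- The basis vector `e_A`. -/
noncomputable def basisVec (A : Finset (Fin d)) : Finset (Fin d) → ℂ := Pi.single A 1

theorem ext_basisVec {M N : SampleOp d} (h : ∀ A, M.mulVec (basisVec A) = N.mulVec (basisVec A)) :
    M = N := Matrix.ext_of_mulVec_single h

theorem aStar_eVec_basisVec (j : Fin d) (A : Finset (Fin d)) :
    (aStar (eVec j)).mulVec (basisVec A)
      = if j ∈ A then 0 else sgn j A • basisVec (insert j A) := by
  funext B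
  rw [basisVec, Matrix.mulVec_single_one, Matrix.col_apply, aStar_eVec_apply]
  by_cases hj : j ∈ A
  · have : ¬ (j ∈ B ∧ A = B.erase j) := by
      rintro ⟨-, h⟩; rw [h] at hj; simp at hj
    simp [hj, this]
  · have hiff : (j ∈ B ∧ A = B.erase j) ↔ B = insert j A := by
      constructor
      · rintro ⟨h1, rfl⟩; rw [Finset.insert_erase h1]
      · rintro rfl; simp [hj]
    simp only [hiff, if_neg hj, Pi.smul_apply, basisVec, Pi.single_apply, smul_eq_mul]
    split_ifs with h
    · subst h; simp [sgn_insert _ _ _ hj]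
    · simp

theorem orderedProd_vacuum (A : Finset (Fin d)) :
    (orderedProd (fun j => aStar (eVec j)) A).mulVec (basisVec ∅) = basisVec A := by
  induction A using Finset.induction_on_min with
  | empty => simp [orderedProd_empty]
  | insert a s ha ih =>
    rw [orderedProd_insert_of_lt _ ha, ← Matrix.mulVec_mulVec, ih, aStar_eVec_basisVec,
      if_neg (fun h => (ha a h).false), sgn_of_lt ha, one_smul]

theorem secondQuant_basisVec (M : Matrix (Fin d) (Fin d) ℂ) (A : Finset (Fin d)) :
    (secondQuant M).mulVec (basisVec A)
      = (orderedProd (fun j => aStar (M.mulVec (eVec j))) A).mulVec (basisVec ∅) := by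
  funext B
  rw [basisVec, Matrix.mulVec_single_one, Matrix.col_apply, secondQuant, Matrix.of_apply, wedge,
    orderedProd, List.map_map]
  rfl

theorem secondQuant_vacuum (M : Matrix (Fin d) (Fin d) ℂ) :
    (secondQuant M).mulVec (basisVec ∅) = basisVec ∅ := by
  rw [secondQuant_basisVec, orderedProd_empty, Matrix.one_mulVec]

theorem vec_eq_sum_eVec (v : Fin d → ℂ) : v = ∑ j, v j • eVec j := by
  funext i
  simp [eVec, Finset.sum_apply, Pi.single_apply]

theorem aStar_mulVec_eq_sum (M : Matrix (Fin d) (Fin d) ℂ) (v : Fin d → ℂ) :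
    aStar (M.mulVec v) = ∑ j, v j • aStar (M.mulVec (eVec j)) := by
  let L : (Fin d → ℂ) →ₗ[ℂ] SampleOp d :=
    { toFun := fun v => aStar (M.mulVec v)
      map_add' := fun v w => by rw [Matrix.mulVec_add, aStar_add]
      map_smul' := fun c v => by rw [Matrix.mulVec_smul, aStar_smul]; rfl }
  change L v = ∑ j, v j • L (eVec j)
  conv_lhs => rw [vec_eq_sum_eVec v]
  simp

/-- By `mul_orderedProd`, inserting j into a sorted word produces the same sign for the creators of
M e_j as for those of e_j; linearity in v does the rest. -/
theorem secondQuant_mul_aStar (M : Matrix (Fin d) (Fin d) ℂ) (v : Fin d → ℂ) :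
    secondQuant M * aStar v = aStar (M.mulVec v) * secondQuant M := by
  rw [aStar_mulVec_eq_sum, aStar_eq_sum, Finset.mul_sum, Finset.sum_mul]
  refine Finset.sum_congr rfl fun j _ => ?_
  rw [mul_smul_comm, smul_mul_assoc]
  congr 1
  refine ext_basisVec fun A => ?_
  rw [← Matrix.mulVec_mulVec, ← Matrix.mulVec_mulVec, aStar_eVec_basisVec, secondQuant_basisVec,
    Matrix.mulVec_mulVec, mul_orderedProd (fun j => aStar (M.mulVec (eVec j))) (fun i j => aStar_anticomm _ _)]
  split_ifs
  · simp
  · rw [Matrix.mulVec_smul, secondQuant_basisVec, Matrix.smul_mulVec]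

/-- An operator is determined by its value on the vacuum and its commutation with creators. -/
theorem eq_of_vacuum_of_intertwine {S T : SampleOp d}
    (h0 : S.mulVec (basisVec ∅) = T.mulVec (basisVec ∅)) (C : Fin d → SampleOp d)
    (hS : ∀ j, S * aStar (eVec j) = C j * S) (hT : ∀ j, T * aStar (eVec j) = C j * T) : S = T := by
  refine ext_basisVec fun A => ?_
  rw [← orderedProd_vacuum, Matrix.mulVec_mulVec, Matrix.mulVec_mulVec]
  induction A using Finset.induction_on_min with
  | empty => simpa [orderedProd_empty] using h0
  | insert a s ha ih =>
    rw [orderedProd_insert_of_lt _ ha, ← mul_assoc, ← mul_assoc, hS, hT, mul_assoc, mul_assoc,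
      ← Matrix.mulVec_mulVec, ← Matrix.mulVec_mulVec (M := C a), ih]

theorem secondQuant_one : secondQuant (1 : Matrix (Fin d) (Fin d) ℂ) = 1 := by
  refine eq_of_vacuum_of_intertwine (by rw [secondQuant_vacuum, Matrix.one_mulVec])
    (fun j => aStar (eVec j)) (fun j => ?_) (fun j => by rw [one_mul, mul_one])
  rw [secondQuant_mul_aStar, Matrix.one_mulVec]

theorem secondQuant_mul (M N : Matrix (Fin d) (Fin d) ℂ) :
    secondQuant (M * N) = secondQuant M * secondQuant N := by
  refine eq_of_vacuum_of_intertwine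
    (by rw [secondQuant_vacuum, ← Matrix.mulVec_mulVec, secondQuant_vacuum, secondQuant_vacuum])
    (fun j => aStar ((M * N).mulVec (eVec j))) (fun j => secondQuant_mul_aStar _ _) (fun j => ?_)
  rw [mul_assoc, secondQuant_mul_aStar, ← mul_assoc, secondQuant_mul_aStar, Matrix.mulVec_mulVec,
    mul_assoc]

theorem aOp_vacuum (v : Fin d → ℂ) : (aOp v).mulVec (basisVec ∅) = 0 := by
  funext A
  rw [basisVec, Matrix.mulVec_single_one, Matrix.col_apply, aOp, Matrix.conjTranspose_apply]
  simp [aStar]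

/-- Both sides annihilate the vacuum. Commuting either of them past a creator gives the same scalar,
because ⟨v, M e_a⟩ = ⟨M* v, e_a⟩, and a remainder of the same form, so they agree on every basis
vector by induction. -/
theorem aOp_mul_secondQuant (M : Matrix (Fin d) (Fin d) ℂ) (v : Fin d → ℂ) :
    aOp v * secondQuant M = secondQuant M * aOp (M.conjTranspose.mulVec v) := by
  refine ext_basisVec fun A => ?_
  rw [← orderedProd_vacuum, Matrix.mulVec_mulVec, Matrix.mulVec_mulVec]
  induction A using Finset.induction_on_min with
  | empty =>
    rw [orderedProd_empty, mul_one, mul_one, ← Matrix.mulVec_mulVec, secondQuant_vacuum,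
      ← Matrix.mulVec_mulVec, aOp_vacuum, aOp_vacuum, Matrix.mulVec_zero]
  | insert a s ha ih =>
    have e1 : aOp v * secondQuant M * aStar (eVec a)
        = (star v ⬝ᵥ M.mulVec (eVec a)) • secondQuant M
          - aStar (M.mulVec (eVec a)) * (aOp v * secondQuant M) := by
      rw [mul_assoc, secondQuant_mul_aStar, ← mul_assoc,
        eq_sub_of_add_eq (car_sample v (M.mulVec (eVec a))), sub_mul, smul_mul_assoc, one_mul,
        mul_assoc]
    have e2 : secondQuant M * aOp (M.conjTranspose.mulVec v) * aStar (eVec a)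
        = (star v ⬝ᵥ M.mulVec (eVec a)) • secondQuant M
          - aStar (M.mulVec (eVec a)) * (secondQuant M * aOp (M.conjTranspose.mulVec v)) := by
      rw [mul_assoc, eq_sub_of_add_eq (car_sample _ (eVec a)), mul_sub, mul_smul_comm, mul_one,
        ← mul_assoc, secondQuant_mul_aStar, mul_assoc, Matrix.star_mulVec,
        Matrix.conjTranspose_conjTranspose, Matrix.dotProduct_mulVec]
    rw [orderedProd_insert_of_lt _ ha, ← mul_assoc, ← mul_assoc, e1, e2, sub_mul, sub_mul,
      Matrix.sub_mulVec, Matrix.sub_mulVec, mul_assoc (aStar _), mul_assoc (aStar _),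
      ← Matrix.mulVec_mulVec (M := aStar _), ih, Matrix.mulVec_mulVec]

theorem orderedProd_aStar_vacuum_empty (u : Fin d → Fin d → ℂ) (A : Finset (Fin d)) :
    (orderedProd (fun j => aStar (u j)) A).mulVec (basisVec ∅) ∅ = if A = ∅ then 1 else 0 := by
  induction A using Finset.induction_on_min with
  | empty => simp [orderedProd_empty, basisVec]
  | insert a s ha ih =>
    rw [orderedProd_insert_of_lt _ ha, ← Matrix.mulVec_mulVec, if_neg (by simp)]
    simp [Matrix.mulVec, dotProduct, aStar]

/-- The adjoint of `aOp_mul_secondQuant` is the intertwining relation characterizing Γ(M*). The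
vacuum is fixed because a nonempty wedge has no vacuum component. -/
theorem star_secondQuant (M : Matrix (Fin d) (Fin d) ℂ) :
    star (secondQuant M) = secondQuant M.conjTranspose := by
  refine eq_of_vacuum_of_intertwine ?_ (fun j => aStar (M.conjTranspose.mulVec (eVec j)))
    (fun j => ?_) (fun j => secondQuant_mul_aStar _ _)
  · rw [secondQuant_vacuum]
    funext A
    have : secondQuant M ∅ A = (secondQuant M).mulVec (basisVec A) ∅ := by
      rw [basisVec, Matrix.mulVec_single_one]; rfl
    rw [basisVec, Matrix.mulVec_single_one, Matrix.col_apply, Matrix.star_apply, this,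
      secondQuant_basisVec, orderedProd_aStar_vacuum_empty]
    simp [Pi.single_apply, apply_ite]
  · have := congrArg star (aOp_mul_secondQuant M (eVec j))
    rwa [star_mul, star_mul, star_aOp, star_aOp] at this

end Sample

/-! ### Wick's theorem for second quantized operators -/

/-- While travelling to the left, x has passed n - k letters when it is contracted with letter k;
this is the sign (-1)^(n-k) = (-1)^(n+k). -/
theorem ofFn_prod_mul_of_anticomm {R : Type*} [Ring R] [Algebra ℂ R] {n : ℕ} (f : Fin (n + 1) → R)
    (x : R) (s : Fin (n + 1) → ℂ) (h : ∀ i, f i * x + x * f i = s i • (1 : R)) :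
    (List.ofFn f).prod * x
      = ∑ k : Fin (n + 1), ((-1) ^ (n + (k : ℕ)) * s k) • (List.ofFn fun i => f (k.succAbove i)).prod
        + (-1 : ℂ) ^ (n + 1) • (x * (List.ofFn f).prod) := by
  induction n with
  | zero =>
    have := eq_sub_of_add_eq (h 0)
    simp [this, sub_eq_add_neg]
  | succ n ih =>
    rw [List.ofFn_succ, List.prod_cons, mul_assoc, ih _ _ fun i => h i.succ, mul_add, Finset.mul_sum,
      Fin.sum_univ_succ (n := n + 1), add_comm (∑ i, _), mul_smul_comm, ← mul_assoc (f 0),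
      eq_sub_of_add_eq (h 0), sub_mul, smul_mul_assoc, one_mul, smul_sub, smul_smul, mul_assoc x]
    simp only [Fin.succAbove_zero, Fin.val_zero, add_zero, Fin.val_succ, mul_smul_comm,
      List.ofFn_succ (n := n), Fin.succ_succAbove_zero, Fin.succ_succAbove_succ, List.prod_cons]
    have e : ∀ k : ℕ, (-1 : ℂ) ^ (n + 1 + (k + 1)) = (-1) ^ (n + k) := fun k => by
      rw [show n + 1 + (k + 1) = n + k + 2 by ring, pow_add]; simp
    simp only [e]
    simp only [pow_succ, mul_neg, mul_one, neg_smul, neg_mul, add_zero]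
    abel

theorem prod_mul_of_anticomm {R : Type*} [Ring R] [Algebra ℂ R] (l : List R) (x : R)
    (h : ∀ y ∈ l, y * x = -(x * y)) : l.prod * x = (-1 : ℂ) ^ l.length • (x * l.prod) := by
  induction l with
  | nil => simp
  | cons a l ih =>
    rw [List.prod_cons, mul_assoc, ih fun y hy => h y (List.mem_cons_of_mem a hy), mul_smul_comm,
      ← mul_assoc, h a (by simp), List.length_cons, pow_succ, neg_mul, mul_assoc]
    simp

theorem star_reverse_prod {R : Type*} [Monoid R] [StarMul R] (l : List R) :
    star l.reverse.prod = (l.map star).prod := by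
  induction l with
  | nil => simp
  | cons a l ih => simp [ih]

section Sample

variable {d : ℕ}

/-- Wick's theorem as a KMS argument. The outermost creation vector is split as φ = (1-R)φ + Rφ; the
first part is carried around the trace and comes back as Rφ at the other end, where commuting it
through the word leaves only contractions. -/
theorem trace_secondQuant_mul (M R : Matrix (Fin d) (Fin d) ℂ) (hM : M * (1 - R) = R) (n : ℕ)
    (φ ψ : Fin n → Fin d → ℂ) :
    (secondQuant M * ((List.ofFn fun i => aStar (φ i)).reverse.prod
        * (List.ofFn fun i => aOp (ψ i)).prod)).trace
      = (secondQuant M).trace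
        * (Matrix.of fun j k : Fin n => dotProduct (star (ψ j)) (R.mulVec (φ k))).det := by
  induction n with
  | zero => simp
  | succ n ih =>
    set C := (List.ofFn fun i : Fin n => aStar (φ i.castSucc)).reverse.prod with hC
    set Y := C * (List.ofFn fun i => aOp (ψ i)).prod with hY
    have hsplit : (List.ofFn fun i => aStar (φ i)).reverse.prod
        * (List.ofFn fun i => aOp (ψ i)).prod = aStar (φ (Fin.last n)) * Y := by
      rw [List.ofFn_succ' (fun i => aStar (φ i)), List.concat_eq_append, List.reverse_append,
        List.reverse_singleton, List.singleton_append, List.prod_cons, mul_assoc]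
    -- `Y` has n creators and n + 1 annihilators, an odd number of letters, hence the minus sign of
    -- the uncontracted term.
    have hYχ : ∀ χ, Y * aStar χ = ∑ k : Fin (n + 1), ((-1) ^ (n + (k : ℕ)) * (star (ψ k) ⬝ᵥ χ)) •
        (C * (List.ofFn fun i => aOp (ψ (k.succAbove i))).prod) - aStar χ * Y := by
      intro χ
      rw [hY, mul_assoc, ofFn_prod_mul_of_anticomm _ _ _ fun i => car_sample (ψ i) χ, mul_add,
        Finset.mul_sum, mul_smul_comm, ← mul_assoc, hC, prod_mul_of_anticomm _ (aStar χ) (by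
          intro y hy
          obtain ⟨i, rfl⟩ := by simpa [List.mem_ofFn] using hy
          exact aStar_anticomm _ _), smul_mul_assoc, smul_smul, List.length_reverse,
        List.length_ofFn, pow_succ, mul_neg, mul_one, neg_mul, ← mul_pow, sub_eq_add_neg]
      simp [mul_assoc]
    have hφ : aStar (φ (Fin.last n)) = aStar ((1 - R).mulVec (φ (Fin.last n)))
        + aStar (R.mulVec (φ (Fin.last n))) := by
      rw [← aStar_add, ← Matrix.add_mulVec, sub_add_cancel, Matrix.one_mulVec]
    -- Passing Γ(M) replaces the vector (1-R)φ by M(1-R)φ = Rφ.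
    have hcyc : (secondQuant M * (aStar ((1 - R).mulVec (φ (Fin.last n))) * Y)).trace
        = (secondQuant M * (Y * aStar (R.mulVec (φ (Fin.last n))))).trace := by
      rw [← mul_assoc, secondQuant_mul_aStar, Matrix.mulVec_mulVec, hM, mul_assoc,
        Matrix.trace_mul_comm, mul_assoc]
    -- The uncontracted term cancels the Rφ half of the splitting. What remains is the Laplace
    -- expansion of the determinant along its last column.
    rw [hsplit, hφ, add_mul, mul_add, Matrix.trace_add, hcyc, hYχ, mul_sub, Matrix.trace_sub,
      sub_add_cancel, Finset.mul_sum, Matrix.trace_sum, Matrix.det_succ_column _ (Fin.last n),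
      Finset.mul_sum]
    refine Finset.sum_congr rfl fun k _ => ?_
    rw [mul_smul_comm, Matrix.trace_smul, hC, ih]
    simp only [Fin.val_last, Matrix.of_apply, Fin.succAbove_last, smul_eq_mul]
    have : (Matrix.of fun j k => star (ψ j) ⬝ᵥ R.mulVec (φ k)).submatrix k.succAbove Fin.castSucc
      = Matrix.of fun i j => star (ψ (k.succAbove i)) ⬝ᵥ R.mulVec (φ j.castSucc) := rfl
    rw [this, add_comm n]
    ring

theorem secondQuant_scalar_mul_prod (z : ℂ) {m : ℕ} (φ : Fin m → Fin d → ℂ) :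
    secondQuant (z • (1 : Matrix (Fin d) (Fin d) ℂ)) * (List.ofFn fun i => aStar (φ i)).reverse.prod
      = z ^ m • ((List.ofFn fun i => aStar (φ i)).reverse.prod
        * secondQuant (z • (1 : Matrix (Fin d) (Fin d) ℂ))) := by
  induction m with
  | zero => simp
  | succ m ih =>
    rw [List.ofFn_succ' (fun i => aStar (φ i)), List.concat_eq_append, List.reverse_append,
        List.reverse_singleton, List.singleton_append, List.prod_cons, ← mul_assoc,
        secondQuant_mul_aStar, mul_assoc, ih, Matrix.smul_mulVec, Matrix.one_mulVec, aStar_smul,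
        smul_mul_assoc, mul_smul_comm, smul_smul, mul_assoc, pow_succ']

theorem prod_aOp_mul_secondQuant_scalar (z : ℂ) {m : ℕ} (ψ : Fin m → Fin d → ℂ) :
    (List.ofFn fun i => aOp (ψ i)).prod * secondQuant (z • (1 : Matrix (Fin d) (Fin d) ℂ))
      = z ^ m • (secondQuant (z • (1 : Matrix (Fin d) (Fin d) ℂ))
        * (List.ofFn fun i => aOp (ψ i)).prod) := by
  have h := congrArg star (secondQuant_scalar_mul_prod (star z) ψ)
  have hl : star (List.ofFn fun i => aStar (ψ i)).reverse.prod
      = (List.ofFn fun i => aOp (ψ i)).prod := by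
    rw [star_reverse_prod, List.map_ofFn]
    rfl
  rw [star_mul, star_smul, star_mul, star_secondQuant, hl] at h
  simpa using h

/-- Gauge invariance of second quantized operators. -/
theorem trace_secondQuant_mul_of_ne (M : Matrix (Fin d) (Fin d) ℂ) {m n : ℕ}
    (φ : Fin m → Fin d → ℂ) (ψ : Fin n → Fin d → ℂ) (hmn : m ≠ n) :
    (secondQuant M * ((List.ofFn fun i => aStar (φ i)).reverse.prod
        * (List.ofFn fun i => aOp (ψ i)).prod)).trace = 0 := by
  -- `N` is 2 to the particle number: it commutes with Γ(M), and conjugating the word by it produces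
  -- the factor 2^(m-n). A phase of finite order would detect m - n only modulo that order.
  set N := secondQuant ((2 : ℂ) • (1 : Matrix (Fin d) (Fin d) ℂ)) with hN
  set N' := secondQuant ((2 : ℂ)⁻¹ • (1 : Matrix (Fin d) (Fin d) ℂ)) with hN'
  have hNN' : N * N' = 1 := by
    rw [hN, hN', ← secondQuant_mul, smul_mul_smul_comm, mul_one, mul_inv_cancel₀ two_ne_zero,
      one_smul, secondQuant_one]
  have hNM : N * secondQuant M = secondQuant M * N := by
    rw [hN, ← secondQuant_mul, ← secondQuant_mul]; simp
  set C := (List.ofFn fun i => aStar (φ i)).reverse.prod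
  set A := (List.ofFn fun i => aOp (ψ i)).prod
  have h1 : N * C = (2 : ℂ) ^ m • (C * N) := secondQuant_scalar_mul_prod 2 φ
  have h2 : A * N = (2 : ℂ) ^ n • (N * A) := prod_aOp_mul_secondQuant_scalar 2 ψ
  have h3 : (2 : ℂ) ^ n • (secondQuant M * (C * A)).trace
      = (2 : ℂ) ^ m • (secondQuant M * (C * A)).trace := by
    have hN'N : N' * N = 1 := mul_eq_one_comm.1 hNN'
    have e1 : secondQuant M * (C * (A * N)) * N' = secondQuant M * (C * A) := by
      simp only [mul_assoc]; rw [hNN', mul_one]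
    have e2 : (2 : ℂ) ^ m • (secondQuant M * (C * (A * N)) * N')
        = (2 : ℂ) ^ n • (N * (secondQuant M * (C * A)) * N') := by
      have e3 : (2 : ℂ) ^ m • (secondQuant M * C * N * A) = N * (secondQuant M * (C * A)) := by
        rw [mul_assoc _ C N, ← smul_mul_assoc, ← mul_smul_comm, ← h1, ← mul_assoc, ← hNM]
        simp only [mul_assoc]
      rw [← e3, h2, mul_smul_comm, mul_smul_comm, smul_mul_assoc, smul_mul_assoc,
        smul_comm ((2 : ℂ) ^ m)]
      simp only [mul_assoc]
    rw [← Matrix.trace_smul, ← Matrix.trace_smul, ← e1, e2, e1, Matrix.trace_smul,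
      Matrix.trace_smul, Matrix.trace_mul_comm (N * _), ← mul_assoc N', hN'N, one_mul]
  have h4 : ((2 : ℂ) ^ n - 2 ^ m) * (secondQuant M * (C * A)).trace = 0 := by
    rw [sub_mul, sub_eq_zero]; exact h3
  refine (mul_eq_zero.1 h4).resolve_left fun h => hmn ?_
  have h5 : (2 : ℕ) ^ n = 2 ^ m := by exact_mod_cast sub_eq_zero.1 h
  exact (Nat.pow_right_injective le_rfl h5).symm

/-! ### Diagonalization -/

theorem secondQuant_diagonal (l : Fin d → ℂ) :
    secondQuant (Matrix.diagonal l) = Matrix.diagonal fun A => ∏ i ∈ A, l i := by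
  refine eq_of_vacuum_of_intertwine ?_ (fun j => aStar ((Matrix.diagonal l).mulVec (eVec j)))
    (fun j => secondQuant_mul_aStar _ _) (fun j => ?_)
  · rw [secondQuant_vacuum]
    funext A
    rw [Matrix.mulVec_diagonal, basisVec, Pi.single_apply]
    split_ifs with h <;> simp [h]
  · have : (Matrix.diagonal l).mulVec (eVec j) = l j • eVec j := by
      funext i
      rw [Matrix.mulVec_diagonal, eVec, Pi.smul_apply, Pi.single_apply]
      split_ifs with h <;> simp [h]
    rw [this, aStar_smul]
    ext A B
    rw [Matrix.diagonal_mul, Matrix.mul_diagonal, Matrix.smul_apply, aStar_eVec_apply]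
    split_ifs with h
    · rw [h.2, ← Finset.mul_prod_erase A l h.1, smul_eq_mul]; ring
    · simp

theorem dGamma_diagonal (l : Fin d → ℂ) :
    dGamma (Matrix.diagonal l) = Matrix.diagonal fun A => ∑ i ∈ A, l i := by
  have h : ∀ j : Fin d, aStar (eVec j) * aOp (eVec j)
      = Matrix.diagonal fun A : Finset (Fin d) => if j ∈ A then (1 : ℂ) else 0 := by
    intro j
    refine ext_toFock fun x => ?_
    ext A
    rw [← Matrix.mulVec_mulVec, aStar_eVec_mulVec, aOp_eVec_mulVec, createAt_apply,
      annihilateAt_apply, toFock_apply, toFock_apply, Matrix.mulVec_diagonal]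
    split_ifs with h1 h2
    · simp at h2
    · rw [Finset.insert_erase h1, sgn_erase _ _ _ h1, if_neg (lt_irrefl j), one_mul, ← mul_assoc,
        sgn_mul_self]
    · simp
  rw [dGamma]
  have : ∀ j, ∑ k, Matrix.diagonal l j k • (aStar (eVec j) * aOp (eVec k))
      = Matrix.diagonal fun A : Finset (Fin d) => if j ∈ A then l j else 0 := by
    intro j
    rw [Finset.sum_eq_single j]
    · rw [Matrix.diagonal_apply_eq, h, ← Matrix.diagonal_smul]
      congr 1
      funext A
      simp
    · intro k _ hk
      rw [Matrix.diagonal_apply_ne' _ hk, zero_smul]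
    · simp
  simp only [this]
  ext A B
  rw [Matrix.sum_apply]
  by_cases hAB : A = B
  · subst hAB; simp
  · simp [hAB]

theorem aOp_mulVec_eq_sum (U : Matrix (Fin d) (Fin d) ℂ) (k : Fin d) :
    aOp (U.mulVec (eVec k)) = ∑ q, star (U q k) • aOp (eVec q) := by
  rw [aOp_eq_sum]
  simp [eVec]

theorem aStar_mulVec_eVec_eq_sum (U : Matrix (Fin d) (Fin d) ℂ) (k : Fin d) :
    aStar (U.mulVec (eVec k)) = ∑ q, U q k • aStar (eVec q) := by
  rw [aStar_eq_sum]
  simp [eVec]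

theorem sum_comm_reverse {ι R : Type*} [Fintype ι] [AddCommMonoid R] (F : ι → ι → ι → ι → R) :
    ∑ p, ∑ q, ∑ k, ∑ j, F p q k j = ∑ j, ∑ k, ∑ q, ∑ p, F p q k j := by
  have h3 : ∀ G : ι → ι → ι → R, ∑ a, ∑ b, ∑ c, G a b c = ∑ c, ∑ b, ∑ a, G a b c := fun G =>
    ((Finset.sum_congr rfl fun _ _ => Finset.sum_comm).trans Finset.sum_comm).trans
      (Finset.sum_congr rfl fun _ _ => Finset.sum_comm)
  rw [Finset.sum_congr rfl fun p _ => h3 (F p), Finset.sum_comm]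
  refine Finset.sum_congr rfl fun j _ => ?_
  rw [Finset.sum_comm]
  exact Finset.sum_congr rfl fun k _ => Finset.sum_comm

/-- Conjugation by Γ(U) replaces e_j and e_k in a*(e_j) a(e_k) by U e_j and U e_k; expanding these
in the basis gives the entries of U L U*. -/
theorem secondQuant_conj_dGamma (U L : Matrix (Fin d) (Fin d) ℂ) (hU : U * star U = 1) :
    dGamma (U * L * star U) = secondQuant U * dGamma L * secondQuant (star U) := by
  have h : ∀ j k, secondQuant U * (aStar (eVec j) * aOp (eVec k)) * secondQuant (star U)
      = aStar (U.mulVec (eVec j)) * aOp (U.mulVec (eVec k)) := by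
    intro j k
    rw [← mul_assoc, secondQuant_mul_aStar, mul_assoc, aOp_mul_secondQuant, mul_assoc,
      ← mul_assoc (secondQuant U), ← secondQuant_mul, hU, secondQuant_one, one_mul]
    simp [Matrix.star_eq_conjTranspose]
  rw [dGamma, dGamma, Finset.mul_sum, Finset.sum_mul]
  simp only [Finset.mul_sum, Finset.sum_mul, mul_smul_comm, smul_mul_assoc, h,
    aStar_mulVec_eVec_eq_sum, aOp_mulVec_eq_sum, Matrix.mul_apply, Finset.smul_sum, Finset.sum_smul,
    smul_smul]
  rw [sum_comm_reverse]
  refine Finset.sum_congr rfl fun j _ => Finset.sum_congr rfl fun k _ =>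
    Finset.sum_congr rfl fun q _ => Finset.sum_congr rfl fun p _ => ?_
  rw [Matrix.star_apply]
  congr 1
  ring

/-- In an eigenbasis this is the expansion ∏ (1 + λ_i) = ∑_A ∏_{i ∈ A} λ_i. -/
theorem trace_secondQuant {M : Matrix (Fin d) (Fin d) ℂ} (hM : M.IsHermitian) :
    (secondQuant M).trace = (1 + M).det := by
  have hU : (star (hM.eigenvectorUnitary : Matrix (Fin d) (Fin d) ℂ))
      * (hM.eigenvectorUnitary : Matrix (Fin d) (Fin d) ℂ) = 1 := by simp
  have hU' : (hM.eigenvectorUnitary : Matrix (Fin d) (Fin d) ℂ)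
      * star (hM.eigenvectorUnitary : Matrix (Fin d) (Fin d) ℂ) = 1 := by simp
  have hs := hM.spectral_theorem
  rw [Unitary.conjStarAlgAut_apply] at hs
  set U := (hM.eigenvectorUnitary : Matrix (Fin d) (Fin d) ℂ)
  set l : Fin d → ℂ := RCLike.ofReal ∘ hM.eigenvalues
  have h1 : (1 + M) = U * (1 + Matrix.diagonal l) * star U := by
    rw [mul_add, add_mul, mul_one, hU', ← hs]
  have h2 : (1 + M).det = (1 + Matrix.diagonal l).det := by
    rw [h1, Matrix.det_mul_right_comm, hU', one_mul]
  rw [h2, hs, secondQuant_mul, Matrix.trace_mul_comm, ← secondQuant_mul, ← mul_assoc, hU, one_mul, secondQuant_diagonal, Matrix.trace_diagonal,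
    ← Matrix.diagonal_one, Matrix.diagonal_add, Matrix.det_diagonal, Finset.prod_one_add,
    Finset.powerset_univ]

theorem posSemidef_secondQuant {M : Matrix (Fin d) (Fin d) ℂ} (hM : M.PosSemidef) :
    (secondQuant M).PosSemidef := by
  have hs := hM.1.spectral_theorem
  rw [Unitary.conjStarAlgAut_apply] at hs
  rw [hs, secondQuant_mul, secondQuant_mul, secondQuant_diagonal, Matrix.star_eq_conjTranspose,
    ← star_secondQuant]
  refine Matrix.PosSemidef.mul_mul_conjTranspose_same (Matrix.PosSemidef.diagonal fun A => ?_) _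
  refine Finset.prod_nonneg fun i _ => ?_
  have := hM.eigenvalues_nonneg i
  simpa using this

/-- In an eigenbasis dΓ(ln M) has the diagonal entries ∑_{i ∈ A} ln λ_i, whose exponentials ∏_{i ∈
A} λ_i are those of Γ(M); strict positivity of the λ_i makes exp(ln λ_i) = λ_i. -/
theorem exp_dGamma_log {M : Matrix (Fin d) (Fin d) ℂ} (hM : M.PosDef) :
    NormedSpace.exp (dGamma (cfc Real.log M)) = secondQuant M := by
  have hU' : (hM.1.eigenvectorUnitary : Matrix (Fin d) (Fin d) ℂ)
      * star (hM.1.eigenvectorUnitary : Matrix (Fin d) (Fin d) ℂ) = 1 := by simp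
  have hs := hM.1.spectral_theorem
  rw [Matrix.IsHermitian.cfc_eq hM.1, Matrix.IsHermitian.cfc]
  rw [Unitary.conjStarAlgAut_apply] at hs ⊢
  have hpos := hM.eigenvalues_pos
  set U := (hM.1.eigenvectorUnitary : Matrix (Fin d) (Fin d) ℂ)
  have hΓ : secondQuant U * secondQuant (star U) = 1 := by
    rw [← secondQuant_mul, hU', secondQuant_one]
  have hinv : secondQuant (star U) = (secondQuant U)⁻¹ := (Matrix.inv_eq_right_inv hΓ).symm
  have hunit : IsUnit (secondQuant U) := IsUnit.of_mul_eq_one _ hΓ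
  rw [secondQuant_conj_dGamma U _ hU', hinv, Matrix.exp_conj _ _ hunit, dGamma_diagonal,
    Matrix.exp_diagonal]
  conv_rhs => rw [hs, secondQuant_mul, secondQuant_mul, hinv, secondQuant_diagonal]
  congr 3
  funext A
  rw [Pi.coe_exp, ← Complex.exp_eq_exp_ℂ, Complex.exp_sum]
  refine Finset.prod_congr rfl fun i _ => ?_
  have := hpos i
  simp only [Function.comp_apply, Complex.coe_algebraMap]
  rw [← Complex.ofReal_exp, Real.exp_log this]

/-! ### The density `det(1 - R) Γ(R (1 - R)⁻¹)` -/

theorem quasiFree_ratio_mul {R : Matrix (Fin d) (Fin d) ℂ} (h : (1 - R).PosDef) :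
    R * (1 - R)⁻¹ * (1 - R) = R := by
  rw [mul_assoc, Matrix.nonsing_inv_mul _ ((Matrix.isUnit_iff_isUnit_det _).1 h.isUnit), mul_one]

theorem one_add_quasiFree_ratio {R : Matrix (Fin d) (Fin d) ℂ} (h : (1 - R).PosDef) :
    1 + R * (1 - R)⁻¹ = (1 - R)⁻¹ := by
  have hu := (Matrix.isUnit_iff_isUnit_det _).1 h.isUnit
  nth_rewrite 1 [← Matrix.mul_nonsing_inv _ hu]
  rw [← add_mul, sub_add_cancel, one_mul]

theorem isHermitian_quasiFree_ratio {R : Matrix (Fin d) (Fin d) ℂ} (h : (1 - R).PosDef) :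
    (R * (1 - R)⁻¹).IsHermitian := by
  have : R * (1 - R)⁻¹ = (1 - R)⁻¹ - 1 := eq_sub_of_add_eq' (one_add_quasiFree_ratio h)
  rw [this]
  exact h.inv.1.sub Matrix.isHermitian_one

theorem posSemidef_quasiFree_ratio {R : Matrix (Fin d) (Fin d) ℂ} (hR : R.PosSemidef)
    (h : (1 - R).PosDef) : (R * (1 - R)⁻¹).PosSemidef := by
  have hu := (Matrix.isUnit_iff_isUnit_det _).1 h.isUnit
  -- Since R commutes with 1 - R and R + (1 - R) = 1, the bracket equals (1 - R) R; written this way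
  -- it is a sum of congruences of positive matrices.
  have e : R * (1 - R)⁻¹ = (1 - R)⁻¹ * (R * (1 - R) * R.conjTranspose
      + (1 - R) * R * (1 - R).conjTranspose) * ((1 - R)⁻¹).conjTranspose := by
    rw [h.inv.1.eq, hR.1.eq, h.1.eq]
    have e1 : R * (1 - R) * R + (1 - R) * R * (1 - R) = (1 - R) * R := by noncomm_ring
    rw [e1, ← mul_assoc, Matrix.nonsing_inv_mul _ hu, one_mul]
  rw [e]
  exact ((h.posSemidef.mul_mul_conjTranspose_same R).add
    (hR.mul_mul_conjTranspose_same (1 - R))).mul_mul_conjTranspose_same _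

theorem trace_quasiFreeDensity {R : Matrix (Fin d) (Fin d) ℂ} (h : (1 - R).PosDef) :
    (1 - R).det * (secondQuant (R * (1 - R)⁻¹)).trace = 1 := by
  rw [trace_secondQuant (isHermitian_quasiFree_ratio h), one_add_quasiFree_ratio h, ← Matrix.det_mul,
    Matrix.mul_nonsing_inv _ ((Matrix.isUnit_iff_isUnit_det _).1 h.isUnit), Matrix.det_one]

theorem isQuasiFreeSample_quasiFreeDensity {R : Matrix (Fin d) (Fin d) ℂ} (h : (1 - R).PosDef) :
    IsQuasiFreeSample (quasiFreeDensity R) R := by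
  constructor
  · intro n φ ψ
    rw [quasiFreeDensity, smul_mul_assoc, Matrix.trace_smul,
      trace_secondQuant_mul _ R (quasiFree_ratio_mul h), smul_eq_mul, ← mul_assoc,
      trace_quasiFreeDensity h, one_mul]
  · intro m n φ ψ hmn
    rw [quasiFreeDensity, smul_mul_assoc, Matrix.trace_smul, trace_secondQuant_mul_of_ne _ _ _ hmn,
      smul_zero]

theorem isDensityMatrix_quasiFreeDensity {R : Matrix (Fin d) (Fin d) ℂ} (hR : R.PosSemidef)
    (h : (1 - R).PosDef) : IsDensityMatrix (quasiFreeDensity R) := by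
  refine ⟨?_, ?_⟩
  · exact (posSemidef_secondQuant (posSemidef_quasiFree_ratio hR h)).smul h.det_pos.le
  · rw [quasiFreeDensity, Matrix.trace_smul, smul_eq_mul, trace_quasiFreeDensity h]

theorem quasiFreeDensity_eq_gibbsDensity {R : Matrix (Fin d) (Fin d) ℂ} (hR : R.PosDef)
    (h : (1 - R).PosDef) : quasiFreeDensity R = gibbsDensity R := by
  rw [quasiFreeDensity, gibbsDensity, exp_dGamma_log]
  rw [(posSemidef_quasiFree_ratio hR.posSemidef h).posDef_iff_isUnit]
  exact hR.isUnit.mul h.inv.isUnit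

end Sample

/-! ### Normal ordering -/

theorem exists_ofFn_prod_eq {R V : Type*} [Monoid R] (c : V → R) (l : List V) :
    ∃ φ : Fin l.length → V, (l.map c).prod = (List.ofFn fun i => c (φ i)).prod := by
  refine ⟨l.get, ?_⟩
  conv_lhs => rw [← List.ofFn_get l, List.map_ofFn]
  rfl

theorem exists_ofFn_reverse_prod_eq {R V : Type*} [Monoid R] (c : V → R) (l : List V) :
    ∃ φ : Fin l.length → V, (l.map c).prod = (List.ofFn fun i => c (φ i)).reverse.prod := by
  have h : ∀ n, n = l.reverse.length →
      ∃ φ : Fin n → V, (l.map c).prod = (List.ofFn fun i => c (φ i)).reverse.prod := by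
    rintro _ rfl
    refine ⟨l.reverse.get, ?_⟩
    have : (List.ofFn fun i => c (l.reverse.get i)) = l.reverse.map c := by
      conv_rhs => rw [← List.ofFn_get l.reverse, List.map_ofFn]
      rfl
    rw [this, List.map_reverse, List.reverse_reverse]
  exact h _ List.length_reverse.symm

section NormalOrder

variable {R V : Type*} [Ring R] [Algebra ℂ R]

/-- The span of the normally ordered words `c*(v₁) ⋯ c*(v_m) c(w₁) ⋯ c(w_n)` with `m + n` of the
given parity. -/
def normalSpan (cr an : V → R) (p : ZMod 2) : Submodule ℂ R :=
  Submodule.span ℂ {x | ∃ cs as : List V, ((cs.length + as.length : ℕ) : ZMod 2) = p ∧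
    x = (cs.map cr).prod * (as.map an).prod}

variable {cr an : V → R}

theorem word_mem_normalSpan (cs as : List V) :
    (cs.map cr).prod * (as.map an).prod
      ∈ normalSpan cr an ((cs.length + as.length : ℕ) : ZMod 2) :=
  Submodule.subset_span ⟨cs, as, rfl, rfl⟩

theorem create_mul_mem_normalSpan (v : V) {p : ZMod 2} {x : R} (hx : x ∈ normalSpan cr an p) :
    cr v * x ∈ normalSpan cr an (p + 1) := by
  induction hx using Submodule.span_induction with
  | mem x h =>
    obtain ⟨cs, as, rfl, rfl⟩ := h
    have := word_mem_normalSpan (cr := cr) (an := an) (v :: cs) as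
    rw [List.map_cons, List.prod_cons, mul_assoc] at this
    convert this using 1
    push_cast [List.length_cons]
    ring_nf
  | zero => simp
  | add x y _ _ hx hy => rw [mul_add]; exact add_mem hx hy
  | smul c x _ hx => rw [mul_smul_comm]; exact Submodule.smul_mem _ c hx

/-- Moving the annihilator through the creators yields signs and contractions; a contraction deletes
two letters, so the parity grading survives. The index type `V` is abstract so that sample and
reservoir are treated at once. -/
theorem annihilate_mul_mem_normalSpan (g : V → V → ℂ)
    (hcar : ∀ v w, an v * cr w + cr w * an v = g v w • (1 : R)) (v : V) {p : ZMod 2} {x : R}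
    (hx : x ∈ normalSpan cr an p) : an v * x ∈ normalSpan cr an (p + 1) := by
  induction hx using Submodule.span_induction with
  | mem x h =>
    obtain ⟨cs, as, rfl, rfl⟩ := h
    induction cs with
    | nil =>
      have := word_mem_normalSpan (cr := cr) (an := an) [] (v :: as)
      simpa using this
    | cons c cs ih =>
      rw [List.map_cons, List.prod_cons, mul_assoc, ← mul_assoc, eq_sub_of_add_eq (hcar v c),
        sub_mul, smul_mul_assoc, one_mul, mul_assoc]
      refine sub_mem (Submodule.smul_mem _ _ ?_) ?_
      · have h2 : (1 : ZMod 2) + 1 = 0 := rfl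
        have e : ((((c :: cs).length + as.length : ℕ) : ZMod 2) + 1)
            = ((cs.length + as.length : ℕ) : ZMod 2) := by
          push_cast [List.length_cons]
          linear_combination h2
        rw [e]
        exact word_mem_normalSpan cs as
      · convert create_mul_mem_normalSpan c ih using 1
        push_cast [List.length_cons]
        ring_nf
  | zero => simp
  | add x y _ _ hx hy => rw [mul_add]; exact add_mem hx hy
  | smul c x _ hx => rw [mul_smul_comm]; exact Submodule.smul_mem _ c hx

theorem list_prod_mem_normalSpan (g : V → V → ℂ)
    (hcar : ∀ v w, an v * cr w + cr w * an v = g v w • (1 : R)) (l : List R)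
    (hl : ∀ x ∈ l, x ∈ Set.range cr ∪ Set.range an) :
    l.prod ∈ normalSpan cr an (l.length : ZMod 2) := by
  induction l with
  | nil => simpa using word_mem_normalSpan (cr := cr) (an := an) [] []
  | cons a l ih =>
    have h := ih fun x hx => hl x (List.mem_cons_of_mem a hx)
    rw [List.prod_cons, List.length_cons, Nat.cast_succ]
    rcases hl a (by simp) with ⟨v, rfl⟩ | ⟨v, rfl⟩
    · exact create_mul_mem_normalSpan v h
    · exact annihilate_mul_mem_normalSpan g hcar v h

end NormalOrder

/-! ### Operators on the sample are determined by their correlation functions -/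

section Sample

variable {d : ℕ}

/-- `a*(φ_m) ⋯ a*(φ_1) a(ψ_1) ⋯ a(ψ_n)`. -/
noncomputable def sampleWord {m n : ℕ} (φ : Fin m → Fin d → ℂ) (ψ : Fin n → Fin d → ℂ) :
    SampleOp d :=
  (List.ofFn fun i => aStar (φ i)).reverse.prod * (List.ofFn fun i => aOp (ψ i)).prod

theorem orderedProd_mul_vacuumProj (A : Finset (Fin d)) :
    orderedProd (fun j => aStar (eVec j)) A * Matrix.single ∅ ∅ 1 = Matrix.single A ∅ (1 : ℂ) := by
  refine ext_basisVec fun B => ?_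
  have h : ∀ C : Finset (Fin d), (Matrix.single C ∅ (1 : ℂ)).mulVec (basisVec B)
      = (if B = ∅ then (1 : ℂ) else 0) • basisVec C := by
    intro C
    funext E
    rw [basisVec, Matrix.mulVec_single_one, Matrix.col_apply, Matrix.single_apply]
    simp only [basisVec, Pi.smul_apply, Pi.single_apply, smul_eq_mul]
    by_cases h1 : B = ∅ <;> by_cases h2 : C = E <;> simp [h1, h2, eq_comm]
  rw [← Matrix.mulVec_mulVec, h, h, Matrix.mulVec_smul, orderedProd_vacuum]

/-- The operators `a_j^*` and `a_j` generate all operators on the Fock space of the sample. -/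
theorem adjoin_eVec : Algebra.adjoin ℂ (Set.range (fun j : Fin d => aStar (eVec j))
    ∪ Set.range (fun j : Fin d => aOp (eVec j))) = ⊤ := by
  set gen : Set (SampleOp d) := Set.range (fun j : Fin d => aStar (eVec j))
    ∪ Set.range (fun j : Fin d => aOp (eVec j)) with hgen
  rw [eq_top_iff]
  have hP : ∀ A, orderedProd (fun j : Fin d => aStar (eVec j)) A ∈ Algebra.adjoin ℂ gen := by
    intro A
    refine list_prod_mem fun x hx => ?_
    obtain ⟨j, -, rfl⟩ := List.mem_map.1 hx
    exact Algebra.subset_adjoin (Or.inl ⟨_, rfl⟩)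
  have hP' : ∀ A, star (orderedProd (fun j : Fin d => aStar (eVec j)) A)
      ∈ Algebra.adjoin ℂ gen := by
    intro A
    rw [orderedProd, ← List.reverse_reverse ((A.sort (· ≤ ·)).map _), star_reverse_prod]
    refine list_prod_mem fun x hx => ?_
    obtain ⟨y, hy, rfl⟩ := List.mem_map.1 hx
    obtain ⟨j, -, rfl⟩ := List.mem_map.1 (List.mem_reverse.1 hy)
    exact Algebra.subset_adjoin (Or.inr ⟨_, rfl⟩)
  have hvac : Matrix.single ∅ ∅ (1 : ℂ) ∈ Algebra.adjoin ℂ gen := by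
    -- The factor a_j a_j^* projects onto the sets that do not contain j; when all j have been used,
    -- only the vacuum projection is left.
    have hdiag : ∀ s : Finset (Fin d), Matrix.diagonal
        (fun A : Finset (Fin d) => if Disjoint A s then (1 : ℂ) else 0)
        ∈ Algebra.adjoin ℂ gen := by
      intro s
      induction s using Finset.induction_on with
      | empty => simp
      | insert j s hj ih =>
        have : Matrix.diagonal (fun A : Finset (Fin d) => if Disjoint A (insert j s) then (1 : ℂ)
            else 0) = (aOp (eVec j) * aStar (eVec j)) * Matrix.diagonal
              (fun A : Finset (Fin d) => if Disjoint A s then (1 : ℂ) else 0) := by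
          refine ext_toFock fun x => ?_
          ext A
          rw [← Matrix.mulVec_mulVec, ← Matrix.mulVec_mulVec, aOp_eVec_mulVec, aStar_eVec_mulVec,
            annihilateAt_apply, createAt_apply, toFock_apply, toFock_apply, Matrix.mulVec_diagonal,
            Matrix.mulVec_diagonal]
          simp only [Finset.disjoint_insert_right]
          by_cases h : j ∈ A
          · simp [h]
          · simp only [h, if_false, Finset.mem_insert_self, if_true, Finset.erase_insert h,
              not_false_eq_true, true_and, sgn_insert _ _ _ h, lt_irrefl, one_mul]
            rw [← mul_assoc, sgn_mul_self, one_mul]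
        rw [this]
        exact mul_mem (mul_mem (Algebra.subset_adjoin (Or.inr ⟨_, rfl⟩))
          (Algebra.subset_adjoin (Or.inl ⟨_, rfl⟩))) ih
    convert hdiag Finset.univ
    ext A B
    rw [Matrix.diagonal_apply, Matrix.single_apply]
    simp only [Finset.disjoint_iff_inter_eq_empty, Finset.inter_univ]
    by_cases h1 : A = B <;> by_cases h2 : A = ∅
    · subst h1 h2; simp
    · subst h1; simp [h2, Ne.symm h2]
    · subst h2; simp [h1]
    · simp [h1, Ne.symm h2]
  intro M _
  rw [Matrix.matrix_eq_sum_single M]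
  refine sum_mem fun A _ => sum_mem fun B _ => ?_
  -- The matrix unit is |e_A⟩⟨e_∅| |e_∅⟩⟨e_B|, and each factor is a word in creators or annihilators
  -- times the vacuum projection.
  have h1 : Matrix.single A B (M A B) = M A B • (orderedProd (fun j => aStar (eVec j)) A
      * Matrix.single ∅ ∅ 1 * star (orderedProd (fun j => aStar (eVec j)) B
      * Matrix.single ∅ ∅ 1)) := by
    rw [orderedProd_mul_vacuumProj, orderedProd_mul_vacuumProj, Matrix.star_eq_conjTranspose,
      Matrix.conjTranspose_single, Matrix.single_mul_single_same, Matrix.smul_single]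
    simp
  rw [h1, star_mul]
  refine Subalgebra.smul_mem _ (mul_mem (mul_mem (hP A) hvac) (mul_mem ?_ (hP' B))) _
  rw [Matrix.star_eq_conjTranspose, Matrix.conjTranspose_single, star_one]
  exact hvac

/-- Normal ordering applied to the products of generators from `adjoin_eVec`. It reduces both
convergence and uniqueness of states to their values on normally ordered words. -/
theorem span_sampleWord : Submodule.span ℂ {x : SampleOp d | ∃ (m n : ℕ) (φ : Fin m → Fin d → ℂ)
    (ψ : Fin n → Fin d → ℂ), x = sampleWord φ ψ} = ⊤ := by
  rw [eq_top_iff, ← Algebra.top_toSubmodule, ← adjoin_eVec, Algebra.adjoin_eq_span,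
    Submodule.span_le]
  intro x hx
  obtain ⟨l, hl, rfl⟩ := Submonoid.exists_list_of_mem_closure hx
  refine Submodule.span_mono ?_ (list_prod_mem_normalSpan (cr := aStar (d := d)) (an := aOp)
    (fun v w => star v ⬝ᵥ w) (fun v w => car_sample v w) l fun y hy => ?_)
  · rintro _ ⟨cs, as, -, rfl⟩
    obtain ⟨φ, hφ⟩ := exists_ofFn_reverse_prod_eq (aStar (d := d)) cs
    obtain ⟨ψ, hψ⟩ := exists_ofFn_prod_eq (aOp (d := d)) as
    exact ⟨_, _, φ, ψ, by rw [hφ, hψ, sampleWord]⟩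
  · rcases hl y hy with ⟨j, rfl⟩ | ⟨j, rfl⟩
    · exact Or.inl ⟨_, rfl⟩
    · exact Or.inr ⟨_, rfl⟩

theorem IsQuasiFreeSample.unique {ρ₁ ρ₂ : SampleOp d} {R : Matrix (Fin d) (Fin d) ℂ}
    (h₁ : IsQuasiFreeSample ρ₁ R) (h₂ : IsQuasiFreeSample ρ₂ R) : ρ₁ = ρ₂ := by
  have h : ∀ M, (ρ₁ * M).trace = (ρ₂ * M).trace := by
    intro M
    have hM : M ∈ Submodule.span ℂ {x : SampleOp d | ∃ (m n : ℕ) (φ : Fin m → Fin d → ℂ)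
        (ψ : Fin n → Fin d → ℂ), x = sampleWord φ ψ} := by rw [span_sampleWord]; trivial
    induction hM using Submodule.span_induction with
    | mem x h =>
      obtain ⟨m, n, φ, ψ, rfl⟩ := h
      by_cases hmn : m = n
      · subst hmn; exact (h₁.1 m φ ψ).trans (h₂.1 m φ ψ).symm
      · exact (h₁.2 m n φ ψ hmn).trans (h₂.2 m n φ ψ hmn).symm
    | zero => simp
    | add x y _ _ hx hy => rw [mul_add, mul_add, Matrix.trace_add, Matrix.trace_add, hx, hy]
    | smul c x _ hx => rw [mul_smul_comm, mul_smul_comm, Matrix.trace_smul, Matrix.trace_smul, hx]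
  ext A B
  simpa [Matrix.trace_mul_single] using h (Matrix.single B A 1)

/-- If the correlation functions of a family of matrices converge to quasi-free ones then the
matrices converge. -/
theorem exists_tendsto_of_tendsto_sampleWord {ι : Type*} {l : Filter ι} [l.NeBot]
    (ρ : ι → SampleOp d) (R : Matrix (Fin d) (Fin d) ℂ)
    (h₁ : ∀ (n : ℕ) (φ ψ : Fin n → Fin d → ℂ), Filter.Tendsto
      (fun i => (ρ i * sampleWord φ ψ).trace) l (nhds
        (Matrix.of fun j k : Fin n => dotProduct (star (ψ j)) (R.mulVec (φ k))).det))
    (h₂ : ∀ (m n : ℕ) (φ : Fin m → Fin d → ℂ) (ψ : Fin n → Fin d → ℂ), m ≠ n → Filter.Tendsto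
      (fun i => (ρ i * sampleWord φ ψ).trace) l (nhds 0)) :
    ∃ ρ' : SampleOp d, Filter.Tendsto ρ l (nhds ρ') ∧ IsQuasiFreeSample ρ' R := by
  have h : ∀ M, ∃ x, Filter.Tendsto (fun i => (ρ i * M).trace) l (nhds x) := by
    intro M
    have hM : M ∈ Submodule.span ℂ {x : SampleOp d | ∃ (m n : ℕ) (φ : Fin m → Fin d → ℂ)
        (ψ : Fin n → Fin d → ℂ), x = sampleWord φ ψ} := by rw [span_sampleWord]; trivial
    induction hM using Submodule.span_induction with
    | mem x h =>
      obtain ⟨m, n, φ, ψ, rfl⟩ := h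
      by_cases hmn : m = n
      · subst hmn; exact ⟨_, h₁ m φ ψ⟩
      · exact ⟨_, h₂ m n φ ψ hmn⟩
    | zero => exact ⟨0, by simp⟩
    | add x y _ _ hx hy =>
      obtain ⟨a, ha⟩ := hx
      obtain ⟨b, hb⟩ := hy
      exact ⟨a + b, by simpa only [mul_add, Matrix.trace_add] using ha.add hb⟩
    | smul c x _ hx =>
      obtain ⟨a, ha⟩ := hx
      exact ⟨c • a, by simpa only [mul_smul_comm, Matrix.trace_smul] using ha.const_smul c⟩
  choose x hx using h
  -- The entry (A, B) of a matrix is the trace of its product with the matrix unit (B, A).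
  have hlim : Filter.Tendsto ρ l (nhds (Matrix.of fun A B => x (Matrix.single B A 1))) := by
    refine tendsto_pi_nhds.2 fun A => tendsto_pi_nhds.2 fun B => ?_
    simpa [Matrix.trace_mul_single] using hx (Matrix.single B A 1)
  refine ⟨_, hlim, ?_⟩
  have htr : ∀ M, Filter.Tendsto (fun i => (ρ i * M).trace) l
      (nhds ((Matrix.of fun A B => x (Matrix.single B A 1)) * M).trace) := fun M =>
    ((Continuous.matrix_trace (continuous_id.matrix_mul continuous_const)).tendsto _).comp hlim
  exact ⟨fun n φ ψ => tendsto_nhds_unique (htr _) (h₁ n φ ψ),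
    fun m n φ ψ hmn => tendsto_nhds_unique (htr _) (h₂ m n φ ψ hmn)⟩

theorem isClosed_posSemidef {n : Type*} [Fintype n] :
    IsClosed {M : Matrix n n ℂ | M.PosSemidef} := by
  simp only [Matrix.posSemidef_iff_dotProduct_mulVec, Set.ofPred_and, Set.ofPred_forall]
  refine IsClosed.inter ?_ (isClosed_iInter fun x => ?_)
  · exact isClosed_eq continuous_id.matrix_conjTranspose continuous_id
  · exact isClosed_le continuous_const
      (continuous_const.dotProduct (continuous_id.matrix_mulVec continuous_const))

/-- The ratio R'(1-R')⁻¹ need not converge when 1 - R is singular, but the correlation functions of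
the density are determinants depending continuously on R'. So the densities converge to a quasi-free
matrix with symbol R, which is ρ by uniqueness; positivity passes to the limit. -/
theorem tendsto_quasiFreeDensity {R : Matrix (Fin d) (Fin d) ℂ} {ρ : SampleOp d}
    (hρ : IsQuasiFreeSample ρ R) (hR : R.PosSemidef) (hR' : (1 - R).PosSemidef) :
    IsDensityMatrix ρ ∧ Filter.Tendsto quasiFreeDensity
      (nhdsWithin R {R' : Matrix (Fin d) (Fin d) ℂ | R'.PosDef ∧ (1 - R').PosDef}) (nhds ρ) := by
  set s := {R' : Matrix (Fin d) (Fin d) ℂ | R'.PosDef ∧ (1 - R').PosDef}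
  have hne : (nhdsWithin R s).NeBot := by
    rw [← mem_closure_iff_nhdsWithin_neBot]
    -- For 0 < ε < 1 the matrix (1 - ε) R + ε/2 lies strictly between 0 and 1, so R is a limit of
    -- nonsingular symbols.
    have hcont : Continuous fun ε : ℝ =>
        (1 - (ε : ℂ)) • R + ((ε / 2 : ℝ) : ℂ) • (1 : Matrix (Fin d) (Fin d) ℂ) := by fun_prop
    have h0 : Filter.Tendsto (fun ε : ℝ =>
        (1 - (ε : ℂ)) • R + ((ε / 2 : ℝ) : ℂ) • (1 : Matrix (Fin d) (Fin d) ℂ))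
        (nhdsWithin 0 (Set.Ioi 0)) (nhds R) := by
      have := (hcont.tendsto 0).mono_left (nhdsWithin_le_nhds (s := Set.Ioi 0))
      simpa using this
    refine mem_closure_of_tendsto h0 ?_
    filter_upwards [Ioo_mem_nhdsGT (show (0 : ℝ) < 1 by norm_num)] with ε hε
    have hε1 : (0 : ℂ) ≤ 1 - (ε : ℂ) := by
      rw [← Complex.ofReal_one, ← Complex.ofReal_sub, Complex.zero_le_real]; linarith [hε.2]
    have hε2 : (0 : ℂ) < ((ε / 2 : ℝ) : ℂ) := by
      rw [Complex.zero_lt_real]; linarith [hε.1]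
    have h1 : (((ε / 2 : ℝ) : ℂ) • (1 : Matrix (Fin d) (Fin d) ℂ)).PosDef :=
      Matrix.PosDef.one.smul hε2
    refine ⟨Matrix.PosDef.posSemidef_add (hR.smul hε1) h1, ?_⟩
    have e : 1 - ((1 - (ε : ℂ)) • R + ((ε / 2 : ℝ) : ℂ) • (1 : Matrix (Fin d) (Fin d) ℂ))
        = (1 - (ε : ℂ)) • (1 - R) + ((ε / 2 : ℝ) : ℂ) • (1 : Matrix (Fin d) (Fin d) ℂ) := by
      push_cast
      module
    rw [e]
    exact Matrix.PosDef.posSemidef_add (hR'.smul hε1) h1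
  have hmem : ∀ᶠ R' in nhdsWithin R s, R' ∈ s := self_mem_nhdsWithin
  obtain ⟨ρ', hlim, hqf⟩ := exists_tendsto_of_tendsto_sampleWord (l := nhdsWithin R s)
    quasiFreeDensity R (fun n φ ψ => by
      have hc : Continuous fun R' : Matrix (Fin d) (Fin d) ℂ =>
          (Matrix.of fun j k : Fin n => dotProduct (star (ψ j)) (R'.mulVec (φ k))).det := by
        refine Continuous.matrix_det (continuous_matrix fun i j => ?_)
        exact continuous_const.dotProduct (continuous_id.matrix_mulVec continuous_const)
      refine ((hc.tendsto R).mono_left nhdsWithin_le_nhds).congr' ?_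
      filter_upwards [hmem] with R' hR'
      exact ((isQuasiFreeSample_quasiFreeDensity hR'.2).1 n φ ψ).symm)
    (fun m n φ ψ hmn => by
      refine tendsto_const_nhds.congr' ?_
      filter_upwards [hmem] with R' hR'
      exact ((isQuasiFreeSample_quasiFreeDensity hR'.2).2 m n φ ψ hmn).symm)
  obtain rfl := hqf.unique hρ
  -- Trace one is quasi-freeness for the empty word.
  refine ⟨⟨?_, by simpa using hρ.1 0 Fin.elim0 Fin.elim0⟩, hlim⟩
  refine isClosed_posSemidef.mem_of_tendsto hlim ?_
  filter_upwards [hmem] with R' hR'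
  exact (isDensityMatrix_quasiFreeDensity hR'.1.posSemidef hR'.2).1

end Sample

/-! ### Creation operators on the Fock space over `ℓ²(ι)` -/

/-- The parity operator `(-1)^N`. -/
noncomputable def fockParity (ι : Type) : Fock ι →L[ℂ] Fock ι :=
  weightedComp id Set.univ Function.injective_id.injOn (fun A => (-1) ^ A.card) (by simp) (by simp)

theorem fockParity_apply {ι : Type} (x : Fock ι) (A : Finset ι) : fockParity ι x A = (-1) ^ A.card * x A := rfl

theorem fockParity_mul_self {ι : Type} : fockParity ι * fockParity ι = 1 := by
  ext x A
  change fockParity ι (fockParity ι x) A = x A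
  rw [fockParity_apply, fockParity_apply, ← mul_assoc, ← mul_pow]
  simp

theorem star_fockParity {ι : Type} : star (fockParity ι) = fockParity ι := by
  rw [ContinuousLinearMap.star_eq_adjoint, eq_comm, ContinuousLinearMap.eq_adjoint_iff]
  intro x y
  rw [lp.inner_eq_tsum, lp.inner_eq_tsum]
  refine tsum_congr fun A => ?_
  rw [fockParity_apply, fockParity_apply]
  simp
  ring

section

variable {ι : Type} [LinearOrder ι]

theorem create_add (φ χ : L2 ι) : create (φ + χ) = create φ + create χ := by
  rw [create, create, create, ← (summable_create φ).tsum_add (summable_create χ)]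
  exact tsum_congr fun j => add_smul _ _ _

theorem create_smul (c : ℂ) (φ : L2 ι) : create (c • φ) = c • create φ := by
  rw [create, create, ← tsum_const_smul'' c]
  exact tsum_congr fun j => mul_smul _ _ _

theorem annihilate_add (φ χ : L2 ι) : annihilate (φ + χ) = annihilate φ + annihilate χ := by
  rw [annihilate, create_add, star_add]; rfl

theorem annihilate_smul (c : ℂ) (φ : L2 ι) : annihilate (c • φ) = star c • annihilate φ := by
  rw [annihilate, create_smul, star_smul]; rfl

theorem annihilate_zero : annihilate (0 : L2 ι) = 0 := by
  have := annihilate_smul (0 : ℂ) (0 : L2 ι)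
  simpa using this

theorem annihilate_single (j : ι) : annihilate (lp.single 2 j (1 : ℂ)) = annihilateAt j := by
  rw [annihilate, create_single]; rfl

theorem car_annihilateAt_create (i : ι) (χ : L2 ι) :
    annihilateAt i * create χ + create χ * annihilateAt i = χ i • (1 : Fock ι →L[ℂ] Fock ι) := by
  rw [create, ← (summable_create χ).tsum_mul_left, ← (summable_create χ).tsum_mul_right,
    ← ((summable_create χ).mul_left _).tsum_add ((summable_create χ).mul_right _)]
  simp only [mul_smul_comm, smul_mul_assoc, ← smul_add, car]
  rw [tsum_eq_single i]
  · simp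
  · intro j hj
    simp [hj.symm]

theorem car_annihilate_createAt (φ : L2 ι) (i : ι) :
    annihilate φ * createAt i + createAt i * annihilate φ
      = star (φ i) • (1 : Fock ι →L[ℂ] Fock ι) := by
  have := congrArg star (car_annihilateAt_create i φ)
  rwa [star_add, star_mul, star_mul, star_smul, star_one, annihilateAt, star_star] at this

theorem car_create (φ χ : L2 ι) :
    annihilate φ * create χ + create χ * annihilate φ
      = inner ℂ φ χ • (1 : Fock ι →L[ℂ] Fock ι) := by
  rw [create, ← (summable_create χ).tsum_mul_left, ← (summable_create χ).tsum_mul_right,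
    ← ((summable_create χ).mul_left _).tsum_add ((summable_create χ).mul_right _)]
  simp only [mul_smul_comm, smul_mul_assoc, ← smul_add, car_annihilate_createAt]
  rw [lp.inner_eq_tsum, ← (lp.summable_inner φ χ).tsum_smul_const]
  refine tsum_congr fun j => ?_
  rw [smul_smul]
  rfl

theorem fockParity_mul_createAt (j : ι) :
    fockParity ι * createAt j = -(createAt j * fockParity ι) := by
  ext x A
  change fockParity ι (createAt j x) A = -(createAt j (fockParity ι x) A)
  rw [fockParity_apply, createAt_apply, createAt_apply, fockParity_apply]
  split_ifs with h
  · rw [← Finset.card_erase_add_one h, pow_succ]; ring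
  · simp

theorem fockParity_mul_create (φ : L2 ι) :
    fockParity ι * create φ = -(create φ * fockParity ι) := by
  rw [create, ← (summable_create φ).tsum_mul_left, ← (summable_create φ).tsum_mul_right,
    ← tsum_neg]
  refine tsum_congr fun j => ?_
  rw [mul_smul_comm, fockParity_mul_createAt, smul_mul_assoc, smul_neg]

theorem fockParity_mul_annihilate (φ : L2 ι) :
    fockParity ι * annihilate φ = -(annihilate φ * fockParity ι) := by
  have := congrArg star (fockParity_mul_create φ)
  rw [star_neg, star_mul, star_mul, star_fockParity] at this
  rw [annihilate, this, neg_neg]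

theorem fockParity_mul_annihilateAt (j : ι) :
    fockParity ι * annihilateAt j = -(annihilateAt j * fockParity ι) := by
  rw [← annihilate_single, fockParity_mul_annihilate]

end

theorem fockParity_mul_fockShift : fockParity ℤ * fockShift = fockShift * fockParity ℤ := by
  ext x A
  change fockParity ℤ (fockShift x) A = fockShift (fockParity ℤ x) A
  rw [fockParity_apply, fockShift, permute_apply, permute_apply, fockParity_apply]
  simp

/-! ### Quasi-free states of the reservoir -/

/-- `b*(φ_m) ⋯ b*(φ_1) b(ψ_1) ⋯ b(ψ_n)`. -/
noncomputable def reservoirWord {m n : ℕ} (φ : Fin m → L2 ℤ) (ψ : Fin n → L2 ℤ) :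
    Fock ℤ →L[ℂ] Fock ℤ :=
  (List.ofFn fun i => create (φ i)).reverse.prod * (List.ofFn fun i => annihilate (ψ i)).prod

/-- A quasi-free state extends to a continuous functional on all bounded operators. -/
theorem exists_extension {ω : carAlgebra →L[ℂ] ℂ} {D : L2 ℤ →L[ℂ] L2 ℤ} (h : IsQuasiFree ω D) :
    ∃ ω' : (Fock ℤ →L[ℂ] Fock ℤ) →L[ℂ] ℂ, (∀ x : carAlgebra, ω' x = ω x) ∧
      (∀ (n : ℕ) (φ ψ : Fin n → L2 ℤ), ω' (reservoirWord φ ψ)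
        = (Matrix.of fun j k : Fin n => inner ℂ (ψ j) (D (φ k))).det) ∧
      ∀ (m n : ℕ) (φ : Fin m → L2 ℤ) (ψ : Fin n → L2 ℤ), m ≠ n → ω' (reservoirWord φ ψ) = 0 := by
  -- Hahn–Banach; the functional can then be evaluated on products and limits without tracking
  -- membership in the algebra.
  obtain ⟨ω', hω', -⟩ := exists_extension_norm_eq (Subalgebra.toSubmodule carAlgebra.toSubalgebra) ω
  have hext : ∀ x : carAlgebra, ω' x = ω x := hω'
  have hword : ∀ (m n : ℕ) (φ : Fin m → L2 ℤ) (ψ : Fin n → L2 ℤ), ω' (reservoirWord φ ψ)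
      = ω ((List.ofFn fun i => bStar (φ i)).reverse.prod
        * (List.ofFn fun i => bOp (ψ i)).prod) := by
    intro m n φ ψ
    rw [← hext]
    congr 1
    have hv : ∀ y : carAlgebra, (y : Fock ℤ →L[ℂ] Fock ℤ) = carAlgebra.subtype y := fun _ => rfl
    rw [hv, map_mul, map_list_prod, map_list_prod, List.map_reverse, List.map_ofFn, List.map_ofFn]
    rfl
  exact ⟨ω', hext, fun n φ ψ => (hword n n φ ψ).trans (h.1 n φ ψ),
    fun m n φ ψ hmn => (hword m n φ ψ).trans (h.2 m n φ ψ hmn)⟩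

/-- Quasi-free states are even. -/
theorem even_of_quasiFree {ω' : (Fock ℤ →L[ℂ] Fock ℤ) →L[ℂ] ℂ}
    (h : ∀ (m n : ℕ) (φ : Fin m → L2 ℤ) (ψ : Fin n → L2 ℤ), m ≠ n → ω' (reservoirWord φ ψ) = 0)
    {x : Fock ℤ →L[ℂ] Fock ℤ} (hx : x ∈ carAlgebra)
    (hodd : fockParity ℤ * x * fockParity ℤ = -x) : ω' x = 0 := by
  -- If m + n is odd then m ≠ n, so gauge invariance applies.
  have hodd_words : ∀ y ∈ normalSpan (create (ι := ℤ)) annihilate 1, ω' y = 0 := by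
    intro y hy
    induction hy using Submodule.span_induction with
    | mem y hy =>
      obtain ⟨cs, as, hp, rfl⟩ := hy
      obtain ⟨φ, hφ⟩ := exists_ofFn_reverse_prod_eq (create (ι := ℤ)) cs
      obtain ⟨ψ, hψ⟩ := exists_ofFn_prod_eq (annihilate (ι := ℤ)) as
      rw [hφ, hψ]
      refine h _ _ φ ψ fun hne => ?_
      rw [hne, ← two_mul, Nat.cast_mul, show ((2 : ℕ) : ZMod 2) = 0 from rfl, zero_mul] at hp
      exact zero_ne_one hp
    | zero => simp
    | add y z _ _ hy hz => rw [map_add, hy, hz, add_zero]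
    | smul c y _ hy => rw [map_smul, hy, smul_zero]
  set gen : Set (Fock ℤ →L[ℂ] Fock ℤ) := Set.range create ∪ Set.range annihilate with hgen
  have hconj : ∀ l : List (Fock ℤ →L[ℂ] Fock ℤ), (∀ y ∈ l, y ∈ gen) →
      fockParity ℤ * l.prod * fockParity ℤ = (-1 : ℂ) ^ l.length • l.prod := by
    intro l hl
    induction l with
    | nil => simp [fockParity_mul_self]
    | cons a l ih =>
      have ha : fockParity ℤ * a = -(a * fockParity ℤ) := by
        rcases hl a (by simp) with ⟨φ, rfl⟩ | ⟨φ, rfl⟩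
        · exact fockParity_mul_create φ
        · exact fockParity_mul_annihilate φ
      rw [List.prod_cons, ← mul_assoc, ha, neg_mul, neg_mul, mul_assoc, mul_assoc, ← mul_assoc _ l.prod,
        ih fun y hy => hl y (List.mem_cons_of_mem a hy), mul_smul_comm, List.length_cons, pow_succ]
      simp
  -- Invariance under the parity automorphism is a closed linear condition, so it is enough to test
  -- words: even ones are fixed, and odd ones have expectation zero.
  have heven : ∀ y ∈ carAlgebra, ω' (fockParity ℤ * y * fockParity ℤ) = ω' y := by
    intro y hy
    have hcl : IsClosed {y : Fock ℤ →L[ℂ] Fock ℤ | ω' (fockParity ℤ * y * fockParity ℤ) = ω' y} :=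
      isClosed_eq (by fun_prop) (by fun_prop)
    refine closure_minimal (fun z hz => ?_) hcl hy
    have hz' : z ∈ Subalgebra.toSubmodule (Algebra.adjoin ℂ gen) := by
      have hs : star (Set.range (create (ι := ℤ))) = Set.range annihilate := by
        ext z
        simp only [Set.mem_star, Set.mem_range]
        constructor
        · rintro ⟨φ, hφ⟩; exact ⟨φ, by rw [annihilate, hφ, star_star]⟩
        · rintro ⟨φ, rfl⟩; exact ⟨φ, by rw [annihilate, star_star]⟩
      rw [hgen, ← hs]
      exact hz
    rw [Algebra.adjoin_eq_span] at hz'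
    change ω' (fockParity ℤ * z * fockParity ℤ) = ω' z
    clear hz
    induction hz' using Submodule.span_induction with
    | mem z hzm =>
      obtain ⟨l, hl, rfl⟩ := Submonoid.exists_list_of_mem_closure hzm
      rw [hconj l hl, map_smul]
      rcases Nat.even_or_odd l.length with hp | hp
      · rw [hp.neg_one_pow, one_smul]
      · have hmem := list_prod_mem_normalSpan (fun φ χ => inner ℂ φ χ)
          (fun φ χ => car_create φ χ) l hl
        rw [(ZMod.natCast_eq_one_iff_odd).2 hp] at hmem
        rw [hodd_words _ hmem, smul_zero]
    | zero => simp
    | add y z _ _ hy hz => rw [mul_add, add_mul, map_add, map_add, hy, hz]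
    | smul c y _ hy => rw [mul_smul_comm, smul_mul_assoc, map_smul, map_smul, hy]
  have := heven x hx
  rw [hodd, map_neg] at this
  exact self_eq_neg.1 this.symm

/-! ### Rotations in algebras with anticommuting generators -/

section Rotation

variable {R : Type*} [NormedRing R] [NormedAlgebra ℂ R] [CompleteSpace R]

theorem exp_smul_mul_exp_neg_smul (Z : R) (z : ℂ) :
    NormedSpace.exp (z • Z) * NormedSpace.exp ((-z) • Z) = 1 := by
  let _ : NormedAlgebra ℚ R := .restrictScalars ℚ ℂ R
  rw [← NormedSpace.exp_add_of_commute (((Commute.refl Z).smul_left z).smul_right (-z)), ← add_smul,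
    add_neg_cancel, zero_smul, NormedSpace.exp_zero]

theorem exp_conj_of_commute {Z a : R} (h : Z * a = a * Z) (z : ℂ) :
    NormedSpace.exp (z • Z) * a * NormedSpace.exp ((-z) • Z) = a := by
  let _ : NormedAlgebra ℚ R := .restrictScalars ℚ ℂ R
  have hc : Commute (NormedSpace.exp (z • Z)) a := ((show Commute Z a from h).smul_left z).exp_left
  rw [hc.eq, mul_assoc, exp_smul_mul_exp_neg_smul, mul_one]

/-- The hypothesis reads w (Z - x) = Z w, an intertwining relation that passes to exponentials. -/
theorem exp_conj_of_eigenvector {Z w : R} {x : ℂ} (h : Z * w = w * Z - x • w) (z : ℂ) :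
    NormedSpace.exp (z • Z) * w * NormedSpace.exp ((-z) • Z) = Complex.exp (-(z * x)) • w := by
  let _ : NormedAlgebra ℚ R := .restrictScalars ℚ ℂ R
  have hs : SemiconjBy w (z • Z + algebraMap ℂ R (-(z * x))) (z • Z) := by
    rw [SemiconjBy, Algebra.algebraMap_eq_smul_one, mul_add, mul_smul_comm, mul_smul_comm, mul_one,
      smul_mul_assoc, h, smul_sub, smul_smul, neg_smul, sub_eq_add_neg]
  have he := hs.exp_right
  rw [SemiconjBy, NormedSpace.exp_add_of_commute (Algebra.commutes _ _).symm,
    ← NormedSpace.algebraMap_exp_comm, ← Complex.exp_eq_exp_ℂ, ← Algebra.commutes,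
    ← Algebra.smul_def, mul_smul_comm] at he
  rw [← he, smul_mul_assoc, mul_assoc, exp_smul_mul_exp_neg_smul, mul_one]

/-- The combinations a ± i b are eigenvectors of the commutator with Z, with eigenvalues ∓ i, and a
is their mean. -/
theorem exp_conj_rotation {Z a b : R} (ha : Z * a - a * Z = b) (hb : Z * b - b * Z = -a) (θ : ℝ) :
    NormedSpace.exp ((θ : ℂ) • Z) * a * NormedSpace.exp ((-(θ : ℂ)) • Z)
      = (Real.cos θ : ℂ) • a + (Real.sin θ : ℂ) • b := by
  have key : ∀ x : ℂ, x * x = -1 →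
      NormedSpace.exp ((θ : ℂ) • Z) * (a + x • b) * NormedSpace.exp ((-(θ : ℂ)) • Z)
        = Complex.exp (-(θ * x)) • (a + x • b) := by
    intro x hx
    refine exp_conj_of_eigenvector ?_ _
    rw [smul_add, smul_smul, hx, mul_add, add_mul, mul_smul_comm, smul_mul_assoc,
      sub_eq_iff_eq_add.1 ha, sub_eq_iff_eq_add.1 hb]
    module
  have h1 := key Complex.I Complex.I_mul_I
  have h2 := key (-Complex.I) (by simp)
  have e : a = (1 / 2 : ℂ) • ((a + Complex.I • b) + (a + (-Complex.I) • b)) := by module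
  conv_lhs => rw [e]
  rw [mul_smul_comm, smul_mul_assoc, mul_add, add_mul, h1, h2]
  have e1 : Complex.exp (-(θ * Complex.I)) = Real.cos θ - Real.sin θ * Complex.I := by
    rw [← neg_mul, Complex.exp_mul_I, Complex.cos_neg, Complex.sin_neg]
    push_cast; ring
  have e2 : Complex.exp (-(θ * -Complex.I)) = Real.cos θ + Real.sin θ * Complex.I := by
    rw [mul_neg, neg_neg, Complex.exp_mul_I]
    push_cast; ring
  rw [e1, e2]
  have hI : Complex.I * Complex.I = -1 := Complex.I_mul_I
  match_scalars
  · ring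
  · linear_combination (-(Complex.sin θ)) * hI

end Rotation

section Quadratic

variable {R : Type*} [Ring R] {a a' b b' : R}

/-- Here `a'` and `b'` play the role of the adjoints of `a` and `b`. The commutator with b' a - a' b
is the infinitesimal rotation of the pair (a, b). -/
theorem quadratic_commutator_left (haa' : a * a' + a' * a = 1) (haa : a * a = 0)
    (hab : a * b = -(b * a)) (hab' : a * b' = -(b' * a)) :
    (b' * a - a' * b) * a - a * (b' * a - a' * b) = b := by
  have e1 : a * (b' * a) = 0 := by
    rw [← mul_assoc, hab', neg_mul, mul_assoc, haa, mul_zero, neg_zero]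
  have e2 : b' * a * a = 0 := by rw [mul_assoc, haa, mul_zero]
  have e3 : a' * b * a = -(a' * a * b) := by
    rw [mul_assoc, show b * a = -(a * b) by rw [hab, neg_neg], mul_neg, mul_assoc]
  rw [sub_mul, mul_sub, e1, e2, e3, ← mul_assoc, zero_sub, zero_sub, neg_neg, sub_neg_eq_add,
    ← add_mul, add_comm, haa', one_mul]

theorem quadratic_commutator_right (hbb' : b * b' + b' * b = 1) (hbb : b * b = 0)
    (hab : a * b = -(b * a)) (hba' : b * a' = -(a' * b)) :
    (b' * a - a' * b) * b - b * (b' * a - a' * b) = -a := by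
  have e1 : b * (a' * b) = 0 := by
    rw [← mul_assoc, hba', neg_mul, mul_assoc, hbb, mul_zero, neg_zero]
  have e2 : a' * b * b = 0 := by rw [mul_assoc, hbb, mul_zero]
  have e3 : b' * a * b = -(b' * b * a) := by rw [mul_assoc, hab, mul_neg, mul_assoc]
  rw [sub_mul, mul_sub, e1, e2, e3, ← mul_assoc, sub_zero, sub_zero, ← neg_add', ← add_mul,
    add_comm, hbb', one_mul]

theorem quadratic_commute {x : R} (h1 : x * a = -(a * x)) (h2 : x * a' = -(a' * x))
    (h3 : x * b = -(b * x)) (h4 : x * b' = -(b' * x)) :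
    (b' * a - a' * b) * x = x * (b' * a - a' * b) := by
  have e : ∀ p q : R, x * p = -(p * x) → x * q = -(q * x) → p * q * x = x * (p * q) := by
    intro p q hp hq
    rw [← mul_assoc, hp, neg_mul, mul_assoc p x, hq, mul_neg, neg_neg, mul_assoc]
  rw [sub_mul, mul_sub, e _ _ h4 h1, e _ _ h2 h3]

end Quadratic

/-! ### Iterating a linear one-particle dynamics over full turns -/

section Dynamics

variable {R : Type*} [AddCommGroup R] [Module ℂ R]

/-- The dynamics of the sample generators over full turns. -/
theorem iterate_full_turns {d : ℕ} [NeZero d] (h : R →ₗ[ℂ] R) (a : Fin d → R) (b : ℤ → R) (c s : ℂ)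
    (hb : ∀ k : ℕ, h (b k) = b (k + 1)) (ha : ∀ j : Fin d, j + 1 ≠ 0 → h (a j) = a (j + 1))
    (ha0 : ∀ j : Fin d, j + 1 = 0 → h (a j) = c • a 0 + s • b 0)
    (B : ℕ → Fin d → R) (hB0 : ∀ j, B 0 j = 0)
    (hB : ∀ m j, B (m + 1) j = c • B m j + s • b ((j : ℤ) + m * d)) (m : ℕ) (j : Fin d) :
    (h ^ (m * d)) (a j) = c ^ m • a j + B m j := by
  have hbt : ∀ t k : ℕ, (h ^ t) (b k) = b (k + t) := by
    intro t
    induction t with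
    | zero => simp
    | succ t ih =>
      intro k
      rw [pow_succ, Module.End.mul_apply, hb, ← Nat.cast_succ, ih]
      congr 1
      push_cast; ring
  have hat : ∀ t : ℕ, ∀ i j : Fin d, (i : ℕ) + t = j → (h ^ t) (a i) = a j := by
    intro t
    induction t with
    | zero => intro i j hij; simp [Fin.ext (show (i : ℕ) = j by simpa using hij)]
    | succ t ih =>
      intro i j hij
      have hlt : (i : ℕ) + 1 < d := by have := j.2; omega
      have hv : ((i + 1 : Fin d) : ℕ) = i + 1 := by
        rw [Fin.val_add_one_of_lt' hlt]
      have hne : i + 1 ≠ 0 := fun h0 => by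
        have := congrArg Fin.val h0
        rw [hv] at this; simp at this
      rw [pow_succ, Module.End.mul_apply, ha i hne, ih (i + 1) j (by rw [hv]; omega)]
  have hturn : ∀ j : Fin d, (h ^ d) (a j) = c • a j + s • b j := by
    intro j
    have hd : 0 < d := Nat.pos_of_ne_zero (NeZero.ne d)
    let e : Fin d := ⟨d - 1, by omega⟩
    have he : e + 1 = 0 := by
      apply Fin.ext
      rw [Fin.val_add, Fin.val_zero]
      rw [Fin.val_one']
      simp only [e, Nat.add_mod_mod]
      rw [Nat.sub_add_cancel hd, Nat.mod_self]
    have hj := j.2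
    -- A turn consists of d - 1 - j steps up to the last site, the single step that mixes with the
    -- reservoir, and j steps back to the starting site.
    have hdec : h ^ d = h ^ (j : ℕ) * (h * h ^ (d - 1 - j)) := by
      rw [← pow_succ', ← pow_add]; congr 1; omega
    rw [hdec, Module.End.mul_apply, Module.End.mul_apply, hat (d - 1 - j) j e (by simp only [e]; omega),
      ha0 e he, map_add, map_smul, map_smul, hat j 0 j (by simp)]
    have := hbt j 0
    simp only [Nat.cast_zero, zero_add] at this
    rw [this]
  induction m with
  | zero => simp [hB0]
  | succ m ih =>
    -- The first turn is split off, so the mode b_j it emits is carried by the remaining m turns to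
    -- b_{j+md}.
    rw [Nat.succ_mul, pow_add, Module.End.mul_apply, hturn, map_add, map_smul, map_smul, ih,
      hB, smul_add, smul_smul, ← pow_succ', add_assoc]
    have := hbt (m * d) j
    rw [this]
    push_cast
    rfl

end Dynamics

/-! ### Asymptotic equality of products of bounded sequences -/

section Limits

/-- Telescoping: f F - g G = (f - g) F + g (F - G), where F and G are the products over the tail;
boundedness of g follows from that of f and f - g → 0. -/
theorem tendsto_list_prod_sub {R L : Type*} [NormedRing R] (f g : L → ℕ → R)
    (hf : ∀ x, f x =O[Filter.atTop] fun _ => (1 : ℝ))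
    (hfg : ∀ x, Filter.Tendsto (fun m => f x m - g x m) Filter.atTop (nhds 0)) (l : List L) :
    Filter.Tendsto (fun m => (l.map fun x => f x m).prod - (l.map fun x => g x m).prod)
      Filter.atTop (nhds 0) := by
  suffices h : ((fun m => (l.map fun x => f x m).prod) =O[Filter.atTop] fun _ => (1 : ℝ)) ∧
      (fun m => (l.map fun x => f x m).prod - (l.map fun x => g x m).prod)
        =o[Filter.atTop] fun _ => (1 : ℝ) from (Asymptotics.isLittleO_one_iff ℝ).1 h.2
  have hfg' : ∀ x, (fun m => f x m - g x m) =o[Filter.atTop] fun _ => (1 : ℝ) :=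
    fun x => (Asymptotics.isLittleO_one_iff ℝ).2 (hfg x)
  have hg : ∀ x, g x =O[Filter.atTop] fun _ => (1 : ℝ) := fun x => by
    simpa using (hf x).sub (hfg' x).isBigO
  induction l with
  | nil => 
    refine ⟨?_, by simp⟩
    simpa using Asymptotics.isBigO_const_const (1 : R) (one_ne_zero (α := ℝ)) Filter.atTop
  | cons a l ih =>
    simp only [List.map_cons, List.prod_cons]
    refine ⟨by simpa using (hf a).mul ih.1, ?_⟩
    have h1 : (fun m => (f a m - g a m) * (l.map fun x => f x m).prod)
        =o[Filter.atTop] fun _ => (1 : ℝ) := by simpa using (hfg' a).mul_isBigO ih.1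
    have h2 : (fun m => g a m * ((l.map fun x => f x m).prod - (l.map fun x => g x m).prod))
        =o[Filter.atTop] fun _ => (1 : ℝ) := by simpa using (hg a).mul_isLittleO ih.2
    refine (h1.add h2).congr_left fun m => ?_
    noncomm_ring

end Limits

section Total

variable {d : ℕ}

/-! ### The tensor product representation -/

theorem tensorOp_apply (X : Fock ℤ →L[ℂ] Fock ℤ) (M : SampleOp d) (A B : Finset (Fin d)) :
    tensorOp X M A B = M A B • X := rfl

theorem tensorOp_mul (X Y : Fock ℤ →L[ℂ] Fock ℤ) (M N : SampleOp d) :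
    tensorOp X M * tensorOp Y N = tensorOp (X * Y) (M * N) := by
  refine CStarMatrix.ext fun A B => ?_
  rw [CStarMatrix.mul_apply, tensorOp_apply, Matrix.mul_apply, Finset.sum_smul]
  refine Finset.sum_congr rfl fun C _ => ?_
  rw [tensorOp_apply, tensorOp_apply, smul_mul_smul_comm]

theorem star_tensorOp (X : Fock ℤ →L[ℂ] Fock ℤ) (M : SampleOp d) :
    star (tensorOp X M) = tensorOp (star X) (star M) := by
  refine CStarMatrix.ext fun A B => ?_
  change star (M B A • X) = star (M B A) • star X
  rw [star_smul]

theorem tensorOp_one : tensorOp 1 (1 : SampleOp d) = 1 := by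
  refine CStarMatrix.ext fun A B => ?_
  rw [tensorOp_apply, CStarMatrix.one_apply, Matrix.one_apply]
  split_ifs
  · rw [one_smul]
  · rw [zero_smul]

theorem tensorOp_add_left (X Y : Fock ℤ →L[ℂ] Fock ℤ) (M : SampleOp d) :
    tensorOp (X + Y) M = tensorOp X M + tensorOp Y M := by
  refine CStarMatrix.ext fun A B => ?_
  exact smul_add (M A B) X Y

theorem tensorOp_add_right (X : Fock ℤ →L[ℂ] Fock ℤ) (M N : SampleOp d) :
    tensorOp X (M + N) = tensorOp X M + tensorOp X N := by
  refine CStarMatrix.ext fun A B => ?_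
  exact add_smul (M A B) (N A B) X

theorem tensorOp_smul_left (c : ℂ) (X : Fock ℤ →L[ℂ] Fock ℤ) (M : SampleOp d) :
    tensorOp (c • X) M = c • tensorOp X M := by
  refine CStarMatrix.ext fun A B => ?_
  exact smul_comm (M A B) c X

theorem tensorOp_smul_right (c : ℂ) (X : Fock ℤ →L[ℂ] Fock ℤ) (M : SampleOp d) :
    tensorOp X (c • M) = c • tensorOp X M := by
  refine CStarMatrix.ext fun A B => ?_
  exact mul_smul c (M A B) X

theorem tensorOp_neg_left (X : Fock ℤ →L[ℂ] Fock ℤ) (M : SampleOp d) :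
    tensorOp (-X) M = -tensorOp X M := by
  refine CStarMatrix.ext fun A B => ?_
  exact smul_neg (M A B) X

theorem tensorOp_neg_right (X : Fock ℤ →L[ℂ] Fock ℤ) (M : SampleOp d) :
    tensorOp X (-M) = -tensorOp X M := by
  refine CStarMatrix.ext fun A B => ?_
  exact neg_smul (M A B) X

theorem tensorOp_zero_left (M : SampleOp d) : tensorOp 0 M = 0 := by
  refine CStarMatrix.ext fun A B => ?_
  exact smul_zero (M A B)

/-! ### Parity of the sample -/

/-- The parity operator `(-1)^N` of the sample. -/
noncomputable def sampleParity (d : ℕ) : SampleOp d := secondQuant (-1)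

theorem sampleParity_mul_self : sampleParity d * sampleParity d = 1 := by
  rw [sampleParity, ← secondQuant_mul, neg_mul_neg, mul_one, secondQuant_one]

theorem star_sampleParity : star (sampleParity d) = sampleParity d := by
  rw [sampleParity, star_secondQuant, Matrix.conjTranspose_neg, Matrix.conjTranspose_one]

theorem sampleParity_mul_aStar (v : Fin d → ℂ) :
    sampleParity d * aStar v = -(aStar v * sampleParity d) := by
  have : aStar (-v) = -aStar v := by
    have := aStar_smul (-1) v
    rwa [neg_one_smul, neg_one_smul] at this
  rw [sampleParity, secondQuant_mul_aStar, Matrix.neg_mulVec, Matrix.one_mulVec, this, neg_mul]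

theorem sampleParity_mul_aOp (v : Fin d → ℂ) :
    sampleParity d * aOp v = -(aOp v * sampleParity d) := by
  have := congrArg star (sampleParity_mul_aStar v)
  rw [star_neg, star_mul, star_mul, star_sampleParity, star_aStar] at this
  rw [this, neg_neg]

theorem sampleParity_eq_diagonal :
    sampleParity d = Matrix.diagonal fun A => (-1 : ℂ) ^ A.card := by
  have : (-1 : Matrix (Fin d) (Fin d) ℂ) = Matrix.diagonal fun _ => -1 := by
    rw [← Matrix.diagonal_one, Matrix.diagonal_neg]
  rw [sampleParity, this, secondQuant_diagonal]
  simp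

/-! ### Anticommuting generators -/

/-- The sample annihilation operators `1 ⊗ i (-1)^N a(v)`. -/
noncomputable def sampleGen (v : Fin d → ℂ) : TotalOp d :=
  tensorOp 1 (Complex.I • (sampleParity d * aOp v))

/-- The reservoir annihilation operators `b(φ) ⊗ (-1)^N`. -/
noncomputable def reservoirGen (d : ℕ) (φ : L2 ℤ) : TotalOp d :=
  tensorOp (annihilate φ) (sampleParity d)

/-- The factor i is there for this: its conjugation offsets the sign from moving the parity across
the creator, so the adjoint has the same twisted form. -/
theorem star_sampleGen (v : Fin d → ℂ) :
    star (sampleGen v) = tensorOp 1 (Complex.I • (sampleParity d * aStar v)) := by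
  rw [sampleGen, star_tensorOp, star_one, star_smul, star_mul, star_aOp, star_sampleParity,
    ← neg_eq_iff_eq_neg.2 (sampleParity_mul_aStar v), smul_neg, Complex.star_def, Complex.conj_I,
    neg_smul, neg_neg]

theorem star_reservoirGen (φ : L2 ℤ) :
    star (reservoirGen d φ) = tensorOp (create φ) (sampleParity d) := by
  rw [reservoirGen, star_tensorOp, annihilate, star_star, star_sampleParity]

/-- The sign i² cancels the sign of moving the parity across M. Two twisted letters thus multiply to
the untwisted product, and the relations of the sample carry over. -/
theorem parity_pair (M N : SampleOp d) (hM : sampleParity d * M = -(M * sampleParity d)) :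
    Complex.I • (sampleParity d * M) * Complex.I • (sampleParity d * N) = M * N := by
  rw [smul_mul_smul_comm, Complex.I_mul_I, hM, neg_mul, neg_smul, smul_neg, neg_neg, one_smul,
    mul_assoc M, ← mul_assoc (sampleParity d), sampleParity_mul_self, one_mul]

theorem sampleGen_mul_sampleGen (v w : Fin d → ℂ) :
    sampleGen v * sampleGen w = tensorOp 1 (aOp v * aOp w) := by
  rw [sampleGen, sampleGen, tensorOp_mul, one_mul, parity_pair _ _ (sampleParity_mul_aOp v)]

theorem sampleGen_mul_star_sampleGen (v w : Fin d → ℂ) :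
    sampleGen v * star (sampleGen w) = tensorOp 1 (aOp v * aStar w) := by
  rw [star_sampleGen, sampleGen, tensorOp_mul, one_mul, parity_pair _ _ (sampleParity_mul_aOp v)]

theorem star_sampleGen_mul_sampleGen (v w : Fin d → ℂ) :
    star (sampleGen v) * sampleGen w = tensorOp 1 (aStar v * aOp w) := by
  rw [star_sampleGen, sampleGen, tensorOp_mul, one_mul, parity_pair _ _ (sampleParity_mul_aStar v)]

theorem sampleGen_anticomm (v w : Fin d → ℂ) :
    sampleGen v * sampleGen w = -(sampleGen w * sampleGen v) := by
  rw [sampleGen_mul_sampleGen, sampleGen_mul_sampleGen, aOp_anticomm, tensorOp_neg_right]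

theorem car_sampleGen (v w : Fin d → ℂ) :
    sampleGen v * star (sampleGen w) + star (sampleGen w) * sampleGen v
      = (star v ⬝ᵥ w) • (1 : TotalOp d) := by
  rw [sampleGen_mul_star_sampleGen, star_sampleGen_mul_sampleGen, ← tensorOp_add_right, car_sample,
    tensorOp_smul_right, tensorOp_one]

/-- The tensor factors commute; the sign comes from the parity carried by the reservoir generator.
-/
theorem parity_tensor_anticomm (X : Fock ℤ →L[ℂ] Fock ℤ) (M : SampleOp d)
    (hM : sampleParity d * M = -(M * sampleParity d)) :
    tensorOp 1 (Complex.I • (sampleParity d * M)) * tensorOp X (sampleParity d)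
      = -(tensorOp X (sampleParity d) * tensorOp 1 (Complex.I • (sampleParity d * M))) := by
  rw [tensorOp_mul, tensorOp_mul, one_mul, mul_one, ← tensorOp_neg_right, mul_smul_comm,
    smul_mul_assoc, mul_assoc, ← neg_eq_iff_eq_neg.2 hM, mul_neg, smul_neg]

theorem sampleGen_anticomm_reservoirGen (v : Fin d → ℂ) (φ : L2 ℤ) :
    sampleGen v * reservoirGen d φ = -(reservoirGen d φ * sampleGen v) :=
  parity_tensor_anticomm _ _ (sampleParity_mul_aOp v)

theorem sampleGen_anticomm_star_reservoirGen (v : Fin d → ℂ) (φ : L2 ℤ) :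
    sampleGen v * star (reservoirGen d φ) = -(star (reservoirGen d φ) * sampleGen v) := by
  rw [star_reservoirGen]
  exact parity_tensor_anticomm _ _ (sampleParity_mul_aOp v)

theorem reservoirGen_anticomm_star_sampleGen (φ : L2 ℤ) (v : Fin d → ℂ) :
    reservoirGen d φ * star (sampleGen v) = -(star (sampleGen v) * reservoirGen d φ) := by
  rw [star_sampleGen, reservoirGen, parity_tensor_anticomm _ _ (sampleParity_mul_aStar v), neg_neg]

theorem reservoirGen_single_anticomm (j k : ℤ) :
    reservoirGen d (lp.single 2 j 1) * reservoirGen d (lp.single 2 k 1)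
      = -(reservoirGen d (lp.single 2 k 1) * reservoirGen d (lp.single 2 j 1)) := by
  rw [reservoirGen, reservoirGen, tensorOp_mul, tensorOp_mul, annihilate_single, annihilate_single,
    annihilateAt_anticomm, tensorOp_neg_left]

theorem car_reservoirGen (φ χ : L2 ℤ) :
    reservoirGen d φ * star (reservoirGen d χ) + star (reservoirGen d χ) * reservoirGen d φ
      = inner ℂ φ χ • (1 : TotalOp d) := by
  rw [star_reservoirGen, reservoirGen, tensorOp_mul, tensorOp_mul, ← tensorOp_add_left, car_create,
    sampleParity_mul_self, tensorOp_smul_left, tensorOp_one]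

theorem dotProduct_eVec (i j : Fin d) : star (eVec i) ⬝ᵥ eVec j = if i = j then (1 : ℂ) else 0 := by
  simp [eVec, dotProduct, Pi.single_apply, eq_comm]

theorem inner_single_single (i j : ℤ) :
    inner ℂ (lp.single 2 i (1 : ℂ) : L2 ℤ) (lp.single 2 j (1 : ℂ)) = if i = j then (1 : ℂ) else 0 := by
  rw [lp.inner_single_left]
  simp [lp.single_apply, Pi.single_apply]

theorem mul_self_eq_zero_of_anticomm {a : TotalOp d} (h : a * a = -(a * a)) : a * a = 0 := by
  have h2 : (2 : ℂ) • (a * a) = 0 := by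
    rw [two_smul]; nth_rewrite 1 [h]; exact neg_add_cancel _
  exact (smul_eq_zero_iff_right (two_ne_zero)).1 h2

theorem sampleParity_comm_secondQuant (M : Matrix (Fin d) (Fin d) ℂ) :
    sampleParity d * secondQuant M = secondQuant M * sampleParity d := by
  rw [sampleParity, ← secondQuant_mul, ← secondQuant_mul]; simp

theorem reservoirGen_add (φ χ : L2 ℤ) :
    reservoirGen d (φ + χ) = reservoirGen d φ + reservoirGen d χ := by
  rw [reservoirGen, annihilate_add, tensorOp_add_left]; rfl

theorem reservoirGen_smul (c : ℂ) (φ : L2 ℤ) :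
    reservoirGen d (c • φ) = star c • reservoirGen d φ := by
  rw [reservoirGen, annihilate_smul, tensorOp_smul_left]; rfl

theorem reservoirGen_zero : reservoirGen d 0 = 0 := by
  rw [reservoirGen, annihilate_zero, tensorOp_zero_left]

theorem sampleGen_eq_sum (v : Fin d → ℂ) : sampleGen v = ∑ j, star (v j) • sampleGen (eVec j) := by
  let L : SampleOp d →ₗ[ℂ] TotalOp d :=
    { toFun := fun M => tensorOp 1 (Complex.I • (sampleParity d * M))
      map_add' := fun M N => by rw [mul_add, smul_add, tensorOp_add_right]
      map_smul' := fun c M => by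
        rw [mul_smul_comm, smul_comm, tensorOp_smul_right]; rfl }
  change L (aOp v) = ∑ j, star (v j) • L (aOp (eVec j))
  rw [aOp_eq_sum, map_sum]
  simp only [map_smul]

/-- The reservoir component of the evolved sample generators after `m` turns. -/
noncomputable def outgoing (d : ℕ) (α : ℝ) : ℕ → Fin d → L2 ℤ
  | 0, _ => 0
  | m + 1, j => (Real.cos α : ℂ) • outgoing d α m j
      + (Real.sin α : ℂ) • lp.single 2 ((j : ℤ) + m * d) 1

/-- The reservoir component of the evolution of `a(v)`. -/
noncomputable def outgoingVec (d : ℕ) (α : ℝ) (m : ℕ) (v : Fin d → ℂ) : L2 ℤ :=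
  ∑ j, v j • outgoing d α m j

theorem reservoirGen_outgoingVec (α : ℝ) (m : ℕ) (v : Fin d → ℂ) :
    reservoirGen d (outgoingVec d α m v)
      = ∑ j, star (v j) • reservoirGen d (outgoing d α m j) := by
  rw [outgoingVec]
  have : ∀ s : Finset (Fin d), reservoirGen d (∑ j ∈ s, v j • outgoing d α m j)
      = ∑ j ∈ s, star (v j) • reservoirGen d (outgoing d α m j) := by
    intro s
    induction s using Finset.induction_on with
    | empty => rw [Finset.sum_empty, Finset.sum_empty, reservoirGen_zero]
    | insert j s hj ih =>
      rw [Finset.sum_insert hj, Finset.sum_insert hj, reservoirGen_add, reservoirGen_smul, ih]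
  exact this _

/-- The generator of the coupling in terms of the anticommuting generators. -/
noncomputable def couplingGen (d : ℕ) [NeZero d] : TotalOp d :=
  star (reservoirGen d (lp.single 2 0 1)) * sampleGen (eVec 0)
    - star (sampleGen (eVec 0)) * reservoirGen d (lp.single 2 0 1)

variable [NeZero d]

theorem couplingGen_eq : couplingGen d = Complex.I •
    (tensorOp (createAt 0) (aOp (eVec 0)) + tensorOp (annihilateAt 0) (aStar (eVec 0))) := by
  rw [couplingGen, star_reservoirGen, star_sampleGen, sampleGen, reservoirGen, tensorOp_mul,
    tensorOp_mul, create_single, annihilate_single, mul_one, one_mul, mul_smul_comm, ← mul_assoc,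
    sampleParity_mul_self, one_mul, smul_mul_assoc, sampleParity_mul_aStar, neg_mul, mul_assoc,
    sampleParity_mul_self, mul_one, smul_neg, tensorOp_neg_right, sub_neg_eq_add,
    tensorOp_smul_right, tensorOp_smul_right, smul_add]

theorem star_couplingGen : star (couplingGen d) = -couplingGen d := by
  rw [couplingGen, star_sub, star_mul, star_mul, star_star, star_star, neg_sub]

theorem coupling_eq (α : ℝ) :
    coupling d α = NormedSpace.exp ((-(α : ℂ)) • couplingGen d) := by
  rw [coupling, couplingGen_eq, smul_smul]
  congr 2
  ring

theorem star_coupling (α : ℝ) :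
    star (coupling d α) = NormedSpace.exp ((α : ℂ) • couplingGen d) := by
  rw [coupling_eq, NormedSpace.star_exp, star_smul, star_couplingGen]
  simp

theorem star_coupling_mul (α : ℝ) : star (coupling d α) * coupling d α = 1 := by
  rw [star_coupling, coupling_eq]
  exact exp_smul_mul_exp_neg_smul _ _

theorem coupling_mul_star (α : ℝ) : coupling d α * star (coupling d α) = 1 := by
  rw [star_coupling, coupling_eq]
  simpa using exp_smul_mul_exp_neg_smul (couplingGen d) (-(α : ℂ))

/-- By the anticommutation relations the commutator with `couplingGen d` is the infinitesimal
rotation of the two generators at site 0, and `exp_conj_rotation` integrates it. -/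
theorem coupling_conj_sampleGen_zero (α : ℝ) :
    star (coupling d α) * sampleGen (eVec 0) * coupling d α
      = (Real.cos α : ℂ) • sampleGen (eVec 0)
        + (Real.sin α : ℂ) • reservoirGen d (lp.single 2 0 1) := by
  rw [star_coupling, coupling_eq]
  refine exp_conj_rotation ?_ ?_ α
  · refine quadratic_commutator_left ?_ (mul_self_eq_zero_of_anticomm (sampleGen_anticomm _ _))
      (sampleGen_anticomm_reservoirGen _ _) (sampleGen_anticomm_star_reservoirGen _ _)
    rw [car_sampleGen, dotProduct_eVec, if_pos rfl, one_smul]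
  · refine quadratic_commutator_right ?_
      (mul_self_eq_zero_of_anticomm (reservoirGen_single_anticomm _ _))
      (sampleGen_anticomm_reservoirGen _ _) (reservoirGen_anticomm_star_sampleGen _ _)
    rw [car_reservoirGen, inner_single_single, if_pos rfl, one_smul]

/-- A generator away from site 0 anticommutes with all four letters of the coupling, hence commutes
with their quadratic expression and its exponential. -/
theorem coupling_conj_sampleGen (α : ℝ) {j : Fin d} (hj : j ≠ 0) :
    star (coupling d α) * sampleGen (eVec j) * coupling d α = sampleGen (eVec j) := by
  rw [star_coupling, coupling_eq]
  refine exp_conj_of_commute (quadratic_commute (sampleGen_anticomm _ _) ?_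
    (sampleGen_anticomm_reservoirGen _ _) (sampleGen_anticomm_star_reservoirGen _ _)) _
  refine eq_neg_of_add_eq_zero_left ?_
  rw [car_sampleGen, dotProduct_eVec, if_neg hj, zero_smul]

theorem coupling_conj_reservoirGen (α : ℝ) {k : ℤ} (hk : k ≠ 0) :
    star (coupling d α) * reservoirGen d (lp.single 2 k 1) * coupling d α
      = reservoirGen d (lp.single 2 k 1) := by
  rw [star_coupling, coupling_eq]
  refine exp_conj_of_commute (quadratic_commute ?_ (reservoirGen_anticomm_star_sampleGen _ _)
    (reservoirGen_single_anticomm _ _) ?_) _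
  · rw [sampleGen_anticomm_reservoirGen, neg_neg]
  · refine eq_neg_of_add_eq_zero_left ?_
    rw [car_reservoirGen, inner_single_single, if_neg hk, zero_smul]

/-! ### The free dynamics -/

theorem cyclicShift_mul_conjTranspose : cyclicShift d * (cyclicShift d).conjTranspose = 1 := by
  ext i j
  rw [Matrix.mul_apply, Matrix.one_apply]
  simp only [cyclicShift, Matrix.of_apply, Matrix.conjTranspose_apply]
  rw [Finset.sum_eq_single (i + 1)]
  · by_cases h : i = j <;> simp [h, eq_comm]
  · intro b _ hb
    rw [if_neg fun h => hb (by rw [h, sub_add_cancel]), zero_mul]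
  · simp

theorem conjTranspose_mul_cyclicShift : (cyclicShift d).conjTranspose * cyclicShift d = 1 :=
  mul_eq_one_comm.1 cyclicShift_mul_conjTranspose

theorem cyclicShift_conjTranspose_mulVec (j : Fin d) :
    (cyclicShift d).conjTranspose.mulVec (eVec j) = eVec (j + 1) := by
  funext i
  rw [eVec, Matrix.mulVec_single_one, Matrix.col_apply, Matrix.conjTranspose_apply, cyclicShift,
    Matrix.of_apply, eVec, Pi.single_apply]
  have : j = i - 1 ↔ i = j + 1 := by rw [eq_sub_iff_add_eq, eq_comm]
  simp only [this]
  split_ifs <;> simp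

theorem star_secondQuant_cyclicShift_mul :
    star (secondQuant (cyclicShift d)) * secondQuant (cyclicShift d) = 1 := by
  rw [star_secondQuant, ← secondQuant_mul, conjTranspose_mul_cyclicShift, secondQuant_one]

theorem secondQuant_cyclicShift_mul_star :
    secondQuant (cyclicShift d) * star (secondQuant (cyclicShift d)) = 1 := by
  rw [star_secondQuant, ← secondQuant_mul, cyclicShift_mul_conjTranspose, secondQuant_one]

theorem free_conj_sampleGen (j : Fin d) :
    star (tensorOp fockShift (secondQuant (cyclicShift d))) * sampleGen (eVec j)
      * tensorOp fockShift (secondQuant (cyclicShift d)) = sampleGen (eVec (j + 1)) := by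
  rw [sampleGen, star_tensorOp, tensorOp_mul, tensorOp_mul, mul_one, star_fockShift_mul,
    mul_assoc, smul_mul_assoc, mul_assoc, aOp_mul_secondQuant, cyclicShift_conjTranspose_mulVec,
    ← mul_assoc (sampleParity d), sampleParity_comm_secondQuant, mul_assoc, mul_smul_comm,
    ← mul_assoc, star_secondQuant_cyclicShift_mul, one_mul, sampleGen]

theorem free_conj_reservoirGen (k : ℤ) :
    star (tensorOp fockShift (secondQuant (cyclicShift d))) * reservoirGen d (lp.single 2 k 1)
      * tensorOp fockShift (secondQuant (cyclicShift d))
      = reservoirGen d (lp.single 2 (k + 1) 1) := by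
  have h : star fockShift * annihilateAt k * fockShift = annihilateAt (k + 1) := by
    have := congrArg star (conj_createAt k)
    rwa [star_mul, star_mul, star_star, ← mul_assoc] at this
  rw [reservoirGen, star_tensorOp, tensorOp_mul, tensorOp_mul, annihilate_single, h, mul_assoc,
    sampleParity_comm_secondQuant, ← mul_assoc, star_secondQuant_cyclicShift_mul, one_mul,
    reservoirGen, annihilate_single]

theorem star_evolution_mul (α : ℝ) : star (evolution d α) * evolution d α = 1 := by
  rw [evolution, star_mul, mul_assoc, ← mul_assoc (star (tensorOp _ _)), star_tensorOp, tensorOp_mul,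
    star_fockShift_mul, star_secondQuant_cyclicShift_mul, tensorOp_one, one_mul, star_coupling_mul]

theorem evolution_mul_star (α : ℝ) : evolution d α * star (evolution d α) = 1 := by
  rw [evolution, star_mul, mul_assoc, ← mul_assoc (coupling d α), coupling_mul_star, one_mul,
    star_tensorOp, tensorOp_mul, fockShift_mul_star, secondQuant_cyclicShift_mul_star, tensorOp_one]

/-- One step of the Heisenberg dynamics. -/
noncomputable def heisenbergStep (d : ℕ) [NeZero d] (α : ℝ) : TotalOp d →ₗ[ℂ] TotalOp d :=
  LinearMap.mulRight ℂ (evolution d α) ∘ₗ LinearMap.mulLeft ℂ (star (evolution d α))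

theorem heisenbergStep_apply (α : ℝ) (T : TotalOp d) :
    heisenbergStep d α T = star (evolution d α) * T * evolution d α := rfl

theorem heisenberg_eq (α : ℝ) (t : ℕ) (T : TotalOp d) :
    heisenberg d α t T = (heisenbergStep d α ^ t) T := by
  induction t with
  | zero => simp [heisenberg]
  | succ t ih =>
    rw [pow_succ', Module.End.mul_apply, ← ih, heisenbergStep_apply]
    simp only [heisenberg, pow_succ', pow_succ (evolution d α), mul_assoc]

theorem heisenbergStep_eq (α : ℝ) (T : TotalOp d) :
    heisenbergStep d α T = star (coupling d α)
      * (star (tensorOp fockShift (secondQuant (cyclicShift d))) * T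
        * tensorOp fockShift (secondQuant (cyclicShift d))) * coupling d α := by
  rw [heisenbergStep_apply, evolution, star_mul]
  simp only [mul_assoc]

/-- An instance of `iterate_full_turns`: the free step moves a reservoir mode of index k ≥ 0 to k +
1 ≠ 0, out of reach of the coupling, and only the last sample site moves to site 0. -/
theorem heisenberg_sampleGen_eVec (α : ℝ) (m : ℕ) (j : Fin d) :
    heisenberg d α (m * d) (sampleGen (eVec j))
      = (Real.cos α : ℂ) ^ m • sampleGen (eVec j) + reservoirGen d (outgoing d α m j) := by
  rw [heisenberg_eq]
  refine iterate_full_turns (heisenbergStep d α) (fun j => sampleGen (eVec j))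
    (fun k => reservoirGen d (lp.single 2 k 1)) (Real.cos α) (Real.sin α) ?_ ?_ ?_
    (fun m j => reservoirGen d (outgoing d α m j)) ?_ ?_ m j
  · intro k
    rw [heisenbergStep_eq, free_conj_reservoirGen, coupling_conj_reservoirGen]
    omega
  · intro j hj
    rw [heisenbergStep_eq, free_conj_sampleGen, coupling_conj_sampleGen α hj]
  · intro j hj
    rw [heisenbergStep_eq, free_conj_sampleGen, hj, coupling_conj_sampleGen_zero]
  · intro j
    exact reservoirGen_zero
  · intro m j
    rw [outgoing, reservoirGen_add, reservoirGen_smul, reservoirGen_smul, Complex.star_def, Complex.conj_ofReal,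
      Complex.conj_ofReal]

theorem heisenberg_sampleGen (α : ℝ) (m : ℕ) (v : Fin d → ℂ) :
    heisenberg d α (m * d) (sampleGen v)
      = (Real.cos α : ℂ) ^ m • sampleGen v + reservoirGen d (outgoingVec d α m v) := by
  rw [sampleGen_eq_sum v, heisenberg_eq, map_sum, reservoirGen_outgoingVec, Finset.smul_sum,
    ← Finset.sum_add_distrib]
  refine Finset.sum_congr rfl fun j _ => ?_
  rw [map_smul, ← heisenberg_eq, heisenberg_sampleGen_eVec, smul_add, smul_comm]

end Total

section Total

variable {d : ℕ}

/-! ### Words in the generators -/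

/-- `a*(v)` or `a(v)`. -/
noncomputable def sampleLetter (p : (Fin d → ℂ) × Bool) : SampleOp d :=
  if p.2 then aStar p.1 else aOp p.1

/-- The anticommuting generator corresponding to `a*(v)` or `a(v)`. -/
noncomputable def genLetter (p : (Fin d → ℂ) × Bool) : TotalOp d :=
  if p.2 then star (sampleGen p.1) else sampleGen p.1

/-- `b*(φ)` or `b(φ)` for the reservoir component `φ` of the evolution of `a(v)`. -/
noncomputable def outLetter (α : ℝ) (m : ℕ) (p : (Fin d → ℂ) × Bool) : Fock ℤ →L[ℂ] Fock ℤ :=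
  if p.2 then create (outgoingVec d α m p.1) else annihilate (outgoingVec d α m p.1)

theorem sampleParity_mul_sampleLetter (p : (Fin d → ℂ) × Bool) :
    sampleParity d * sampleLetter p = -(sampleLetter p * sampleParity d) := by
  rw [sampleLetter]
  split_ifs
  · exact sampleParity_mul_aStar _
  · exact sampleParity_mul_aOp _

theorem genLetter_eq (p : (Fin d → ℂ) × Bool) :
    genLetter p = tensorOp 1 (Complex.I • (sampleParity d * sampleLetter p)) := by
  rw [genLetter, sampleLetter]
  split_ifs
  · exact star_sampleGen _
  · rfl

/-- The twists cancel in pairs by `parity_pair`, so an even word is unaffected by them; one twist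
survives in an odd word. -/
theorem prod_genLetter (l : List ((Fin d → ℂ) × Bool)) : (l.map genLetter).prod
    = tensorOp 1 (if Even l.length then (l.map sampleLetter).prod
      else Complex.I • (sampleParity d * (l.map sampleLetter).prod)) := by
  induction l with
  | nil => simp [tensorOp_one]
  | cons p l ih =>
    rw [List.map_cons, List.prod_cons, ih, genLetter_eq, tensorOp_mul, one_mul, List.length_cons,
      List.map_cons, List.prod_cons]
    congr 1
    by_cases h : Even l.length
    · rw [if_pos h, if_neg (by simpa [Nat.even_add_one] using h), smul_mul_assoc, mul_assoc]
    · rw [if_neg h, if_pos (by simpa [Nat.even_add_one] using h),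
        parity_pair _ _ (sampleParity_mul_sampleLetter p)]

theorem prod_tensorOp_parity {L : Type*} (f : L → Fock ℤ →L[ℂ] Fock ℤ) (l : List L) :
    (l.map fun p => (tensorOp (f p) (sampleParity d) : TotalOp d)).prod
      = tensorOp (l.map f).prod (sampleParity d ^ l.length) := by
  induction l with
  | nil => simp [tensorOp_one]
  | cons p l ih =>
    rw [List.map_cons, List.prod_cons, ih, tensorOp_mul, List.map_cons, List.prod_cons,
      List.length_cons, pow_succ']

variable [NeZero d]

theorem evolution_mem_unitary (α : ℝ) : evolution d α ∈ unitary (TotalOp d) :=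
  Unitary.mem_iff.2 ⟨star_evolution_mul α, evolution_mul_star α⟩

theorem evolution_pow_mem_unitary (α : ℝ) (t : ℕ) : evolution d α ^ t ∈ unitary (TotalOp d) :=
  pow_mem (evolution_mem_unitary α) t

theorem heisenberg_def (α : ℝ) (t : ℕ) (T : TotalOp d) :
    heisenberg d α t T = star (evolution d α ^ t) * T * evolution d α ^ t := by
  rw [heisenberg, star_pow]

theorem heisenberg_mul (α : ℝ) (t : ℕ) (S T : TotalOp d) :
    heisenberg d α t (S * T) = heisenberg d α t S * heisenberg d α t T := by
  have h : evolution d α ^ t * star (evolution d α ^ t) = 1 :=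
    (Unitary.mem_iff.1 (evolution_pow_mem_unitary α t)).2
  rw [heisenberg_def, heisenberg_def, heisenberg_def]
  calc _ = star (evolution d α ^ t) * S * 1 * T * evolution d α ^ t := by
        rw [mul_one, ← mul_assoc]
    _ = _ := by rw [← h]; simp only [mul_assoc]

theorem heisenberg_one (α : ℝ) (t : ℕ) : heisenberg d α t (1 : TotalOp d) = 1 := by
  rw [heisenberg_def, mul_one]
  exact (Unitary.mem_iff.1 (evolution_pow_mem_unitary α t)).1

theorem heisenberg_star (α : ℝ) (t : ℕ) (T : TotalOp d) :
    heisenberg d α t (star T) = star (heisenberg d α t T) := by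
  rw [heisenberg_def, heisenberg_def, star_mul, star_mul, star_star, mul_assoc]

theorem heisenberg_list_prod (α : ℝ) (t : ℕ) (l : List (TotalOp d)) :
    heisenberg d α t l.prod = (l.map (heisenberg d α t)).prod := by
  induction l with
  | nil => exact heisenberg_one α t
  | cons a l ih => rw [List.prod_cons, heisenberg_mul, ih, List.map_cons, List.prod_cons]

theorem norm_heisenberg (α : ℝ) (t : ℕ) (T : TotalOp d) : ‖heisenberg d α t T‖ = ‖T‖ := by
  rw [heisenberg_def, CStarRing.norm_mul_mem_unitary _ (evolution_pow_mem_unitary α t),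
    CStarRing.norm_mem_unitary_mul _ (Unitary.star_mem (evolution_pow_mem_unitary α t))]

theorem heisenberg_genLetter (α : ℝ) (m : ℕ) (p : (Fin d → ℂ) × Bool) :
    heisenberg d α (m * d) (genLetter p) = (Real.cos α : ℂ) ^ m • genLetter p
      + tensorOp (outLetter α m p) (sampleParity d) := by
  rw [genLetter, outLetter]
  split_ifs
  · rw [heisenberg_star, heisenberg_sampleGen, star_add, star_smul, star_reservoirGen, star_pow,
      Complex.star_def, Complex.conj_ofReal]
  · exact heisenberg_sampleGen α m p.1

/-- The evolution is unitary, so the evolved letters stay bounded, and each differs from its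
reservoir part by a multiple cos^m α of a fixed operator. In an even word the parities of the
reservoir letters multiply to 1. -/
theorem tendsto_heisenberg_word {α : ℝ} (hα : |Real.cos α| < 1) (l : List ((Fin d → ℂ) × Bool))
    (hl : Even l.length) :
    Filter.Tendsto (fun m : ℕ => heisenberg d α (m * d) (tensorOp 1 (l.map sampleLetter).prod)
      - tensorOp (l.map (outLetter α m)).prod 1) Filter.atTop (nhds 0) := by
  have h := tendsto_list_prod_sub (R := TotalOp d)
    (fun (p : (Fin d → ℂ) × Bool) m => heisenberg d α (m * d) (genLetter p))
    (fun p m => tensorOp (outLetter α m p) (sampleParity d)) (fun p => ?_) (fun p => ?_) l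
  · refine h.congr fun m => ?_
    congr 1
    · have := prod_genLetter l
      rw [if_pos hl] at this
      rw [← this, heisenberg_list_prod, List.map_map]
      rfl
    · obtain ⟨k, hk⟩ := hl
      rw [prod_tensorOp_parity, hk, ← two_mul, pow_mul, pow_two, sampleParity_mul_self, one_pow]
  · refine Asymptotics.IsBigO.of_bound ‖(genLetter p : TotalOp d)‖ ?_
    filter_upwards with m
    rw [norm_heisenberg]
    simp
  · have h0 : Filter.Tendsto (fun m : ℕ => (Real.cos α : ℂ) ^ m) Filter.atTop (nhds 0) := by
      refine tendsto_pow_atTop_nhds_zero_of_norm_lt_one ?_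
      rwa [Complex.norm_real]
    have h1 := h0.smul_const (genLetter p : TotalOp d)
    rw [zero_smul] at h1
    refine h1.congr fun m => ?_
    rw [heisenberg_genLetter, add_sub_cancel_right]

/-! ### Total parity -/

/-- The parity operator of the whole system. -/
noncomputable def totalParity (d : ℕ) : TotalOp d := tensorOp (fockParity ℤ) (sampleParity d)

/-- Each term of the coupling is odd in the reservoir and odd in the sample, so the two signs
cancel; the shifts preserve particle numbers. -/
theorem totalParity_commute_evolution (α : ℝ) : Commute (totalParity d) (evolution d α) := by
  let _ : NormedAlgebra ℚ (TotalOp d) := .restrictScalars ℚ ℂ (TotalOp d)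
  have h1 : Commute (totalParity d) (tensorOp fockShift (secondQuant (cyclicShift d))) := by
    rw [Commute, SemiconjBy, totalParity, tensorOp_mul, tensorOp_mul, fockParity_mul_fockShift,
      sampleParity_comm_secondQuant]
  have h2 : Commute (totalParity d)
      (tensorOp (createAt 0) (aOp (eVec 0)) + tensorOp (annihilateAt 0) (aStar (eVec 0))) := by
    refine Commute.add_right ?_ ?_
    · rw [Commute, SemiconjBy, totalParity, tensorOp_mul, tensorOp_mul, fockParity_mul_createAt,
        sampleParity_mul_aOp, tensorOp_neg_left, tensorOp_neg_right, neg_neg]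
    · rw [Commute, SemiconjBy, totalParity, tensorOp_mul, tensorOp_mul, fockParity_mul_annihilateAt,
        sampleParity_mul_aStar, tensorOp_neg_left, tensorOp_neg_right, neg_neg]
  exact h1.mul_right ((h2.smul_right _).exp_right)

theorem heisenberg_parity (α : ℝ) (t : ℕ) (T : TotalOp d) :
    totalParity d * heisenberg d α t T * totalParity d
      = heisenberg d α t (totalParity d * T * totalParity d) := by
  have hs : star (totalParity d) = totalParity d := by
    rw [totalParity, star_tensorOp, star_fockParity, star_sampleParity]
  have h1 : Commute (totalParity d) (evolution d α ^ t) :=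
    (totalParity_commute_evolution α).pow_right t
  have h2 : totalParity d * star (evolution d α ^ t) = star (evolution d α ^ t) * totalParity d := by
    have := congrArg star h1.eq
    rw [star_mul, star_mul, hs] at this
    exact this.symm
  rw [heisenberg_def, heisenberg_def]
  calc _ = totalParity d * star (evolution d α ^ t) * T * (evolution d α ^ t * totalParity d) := by
        simp only [mul_assoc]
    _ = star (evolution d α ^ t) * totalParity d * T * (totalParity d * evolution d α ^ t) := by
        rw [h2, h1.eq]
    _ = _ := by simp only [mul_assoc]

end Total

/-! ### Parity invariance of even density matrices -/

section Even

variable {d : ℕ}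

theorem parity_conj_word (l : List ((Fin d → ℂ) × Bool)) :
    sampleParity d * (l.map sampleLetter).prod * sampleParity d
      = (-1 : ℂ) ^ l.length • (l.map sampleLetter).prod := by
  induction l with
  | nil => simp [sampleParity_mul_self]
  | cons p l ih =>
    rw [List.map_cons, List.prod_cons, ← mul_assoc, sampleParity_mul_sampleLetter, neg_mul, neg_mul,
      mul_assoc, mul_assoc, ← mul_assoc _ (l.map _).prod, ih, mul_smul_comm, List.length_cons,
      pow_succ]
    simp

/-- Even density matrices commute with the parity. -/
theorem IsEven.parity_conj {ρ : SampleOp d} (h : IsEven ρ) :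
    sampleParity d * ρ * sampleParity d = ρ := by
  -- Conjugation by the parity multiplies a word by (-1)^length, and against ρ the odd words have
  -- trace zero.
  have key : ∀ M : SampleOp d, (ρ * (sampleParity d * M * sampleParity d)).trace
      = (ρ * M).trace := by
    intro M
    have hM : M ∈ Subalgebra.toSubmodule (Algebra.adjoin ℂ
        (Set.range (fun j : Fin d => aStar (eVec j)) ∪ Set.range (fun j : Fin d => aOp (eVec j)))) := by
      rw [adjoin_eVec]; trivial
    rw [Algebra.adjoin_eq_span] at hM
    induction hM using Submodule.span_induction with
    | mem x hx =>
      obtain ⟨l, hl, rfl⟩ := Submonoid.exists_list_of_mem_closure hx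
      have hl' : ∃ q : List (Fin d × Bool), l
          = q.map fun p => if p.2 then aStar (eVec p.1) else aOp (eVec p.1) := by
        clear hx
        induction l with
        | nil => exact ⟨[], rfl⟩
        | cons a l ih =>
          obtain ⟨q, hq⟩ := ih fun y hy => hl y (List.mem_cons_of_mem a hy)
          rcases hl a (by simp) with ⟨j, rfl⟩ | ⟨j, rfl⟩
          · exact ⟨(j, true) :: q, by simp [hq]⟩
          · exact ⟨(j, false) :: q, by simp [hq]⟩
      obtain ⟨q, rfl⟩ := hl'
      have hq : (q.map fun p => if p.2 then aStar (eVec p.1) else aOp (eVec p.1))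
          = (q.map fun p => (eVec (d := d) p.1, p.2)).map sampleLetter := by
        rw [List.map_map]; rfl
      have hc := parity_conj_word (q.map fun p => (eVec (d := d) p.1, p.2))
      rw [← hq, List.length_map] at hc
      rw [hc, mul_smul_comm, Matrix.trace_smul]
      rcases Nat.even_or_odd q.length with hp | hp
      · rw [hp.neg_one_pow, one_smul]
      · rw [h q hp, smul_zero]
    | zero => simp
    | add x y _ _ hx hy =>
      rw [mul_add (sampleParity d), add_mul, mul_add, mul_add, Matrix.trace_add, Matrix.trace_add,
        hx, hy]
    | smul c x _ hx =>
      rw [mul_smul_comm, smul_mul_assoc, mul_smul_comm, mul_smul_comm, Matrix.trace_smul,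
        Matrix.trace_smul, hx]
  ext A B
  have := key (Matrix.single B A 1)
  rw [← mul_assoc, Matrix.trace_mul_comm, ← mul_assoc, ← mul_assoc] at this
  simpa [Matrix.trace_mul_single] using this

end Even

/-! ### Correlation functions of the reduced density matrix -/

section State

variable {d : ℕ}

/-- The product functional `ω' ⊗ tr(ρ ·)` on all bounded operators. -/
noncomputable def productFunctional (ω' : (Fock ℤ →L[ℂ] Fock ℤ) →L[ℂ] ℂ) (ρ : SampleOp d)
    (T : TotalOp d) : ℂ := ∑ A, ∑ B, ρ B A * ω' (T A B)

theorem productState_eq {ω : carAlgebra →L[ℂ] ℂ} {ω' : (Fock ℤ →L[ℂ] Fock ℤ) →L[ℂ] ℂ}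
    (h : ∀ x : carAlgebra, ω' x = ω x) (ρ : SampleOp d) (T : totalAlgebra d) :
    productState ω ρ T = productFunctional ω' ρ (T : TotalOp d) := by
  rw [productState, productFunctional]
  refine Finset.sum_congr rfl fun A _ => Finset.sum_congr rfl fun B _ => ?_
  rw [← h]

theorem continuous_productFunctional (ω' : (Fock ℤ →L[ℂ] Fock ℤ) →L[ℂ] ℂ) (ρ : SampleOp d) :
    Continuous (productFunctional ω' ρ) := by
  refine continuous_finsetSum _ fun A _ => continuous_finsetSum _ fun B _ => ?_
  have : Continuous fun T : TotalOp d => T A B := (continuous_apply B).comp (continuous_apply A)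
  exact continuous_const.mul (ω'.continuous.comp this)

theorem productFunctional_sub (ω' : (Fock ℤ →L[ℂ] Fock ℤ) →L[ℂ] ℂ) (ρ : SampleOp d)
    (S T : TotalOp d) :
    productFunctional ω' ρ (S - T) = productFunctional ω' ρ S - productFunctional ω' ρ T := by
  simp only [productFunctional, ← Finset.sum_sub_distrib, ← mul_sub, ← map_sub]
  rfl

theorem productFunctional_tensorOp_one (ω' : (Fock ℤ →L[ℂ] Fock ℤ) →L[ℂ] ℂ) (ρ : SampleOp d)
    (X : Fock ℤ →L[ℂ] Fock ℤ) :
    productFunctional ω' ρ (tensorOp X 1) = ω' X * ρ.trace := by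
  simp only [productFunctional, tensorOp_apply, map_smul, smul_eq_mul, Matrix.one_apply, ite_mul,
    one_mul, zero_mul, mul_ite, mul_zero]
  simp only [Finset.sum_ite_eq, Finset.mem_univ, if_true, Matrix.trace, Matrix.diag,
    ← Finset.sum_mul, mul_comm]

theorem tensorOp_diagonal_mul_apply (X : Fock ℤ →L[ℂ] Fock ℤ) (f : Finset (Fin d) → ℂ)
    (T : TotalOp d) (A B : Finset (Fin d)) :
    (tensorOp X (Matrix.diagonal f) * T) A B = f A • (X * T A B) := by
  rw [CStarMatrix.mul_apply, Finset.sum_eq_single A]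
  · rw [tensorOp_apply, Matrix.diagonal_apply_eq, smul_mul_assoc]
  · intro C _ hC
    rw [tensorOp_apply, Matrix.diagonal_apply_ne' _ hC, zero_smul, zero_mul]
  · simp

theorem mul_tensorOp_diagonal_apply (X : Fock ℤ →L[ℂ] Fock ℤ) (f : Finset (Fin d) → ℂ)
    (T : TotalOp d) (A B : Finset (Fin d)) :
    (T * tensorOp X (Matrix.diagonal f)) A B = f B • (T A B * X) := by
  rw [CStarMatrix.mul_apply, Finset.sum_eq_single B]
  · rw [tensorOp_apply, Matrix.diagonal_apply_eq, mul_smul_comm]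
  · intro C _ hC
    rw [tensorOp_apply, Matrix.diagonal_apply_ne _ hC, zero_smul, mul_zero]
  · simp

/-- The product functional vanishes on odd elements. -/
theorem productFunctional_eq_zero_of_odd {ω' : (Fock ℤ →L[ℂ] Fock ℤ) →L[ℂ] ℂ}
    (h : ∀ (m n : ℕ) (φ : Fin m → L2 ℤ) (ψ : Fin n → L2 ℤ), m ≠ n → ω' (reservoirWord φ ψ) = 0)
    {ρ : SampleOp d} (hρ : IsEven ρ) {T : TotalOp d} (hT : T ∈ totalAlgebra d)
    (hodd : totalParity d * T * totalParity d = -T) : productFunctional ω' ρ T = 0 := by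
  refine Finset.sum_eq_zero fun A _ => Finset.sum_eq_zero fun B _ => ?_
  -- If |A| and |B| have opposite parity, the entry of ρ vanishes; if they have equal parity, the
  -- block `T A B` is odd in the reservoir and `even_of_quasiFree` applies.
  have hρ' : (-1 : ℂ) ^ B.card * ρ B A * (-1) ^ A.card = ρ B A := by
    have := congrFun (congrFun hρ.parity_conj B) A
    rwa [sampleParity_eq_diagonal, Matrix.mul_diagonal, Matrix.diagonal_mul] at this
  have hTAB : ((-1 : ℂ) ^ A.card * (-1) ^ B.card) • (fockParity ℤ * T A B * fockParity ℤ)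
      = -(T A B) := by
    have := congrArg (fun T : TotalOp d => T A B) hodd
    simp only [totalParity, sampleParity_eq_diagonal] at this
    rw [mul_tensorOp_diagonal_apply, tensorOp_diagonal_mul_apply, smul_mul_assoc, smul_smul,
      mul_comm ((-1 : ℂ) ^ B.card)] at this
    exact this
  rw [mul_comm _ ((-1 : ℂ) ^ A.card), ← mul_assoc] at hρ'
  rcases neg_one_pow_eq_or ℂ A.card with hA | hA <;> rcases neg_one_pow_eq_or ℂ B.card with hB | hB <;>
    rw [hA, hB] at hρ' hTAB
  · rw [even_of_quasiFree h (hT A B) (by simpa using hTAB), mul_zero]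
  · rw [show ρ B A = 0 by linear_combination (-1 / 2 : ℂ) * hρ', zero_mul]
  · rw [show ρ B A = 0 by linear_combination (-1 / 2 : ℂ) * hρ', zero_mul]
  · rw [even_of_quasiFree h (hT A B) (by simpa using hTAB), mul_zero]

variable [NeZero d]

theorem trace_reducedDensity_word {ω : carAlgebra →L[ℂ] ℂ} {ω' : (Fock ℤ →L[ℂ] Fock ℤ) →L[ℂ] ℂ}
    (h : ∀ x : carAlgebra, ω' x = ω x) (α : ℝ) (ρ M : SampleOp d) (t : ℕ) :
    (reducedDensity d α ω ρ t * M).trace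
      = productFunctional ω' ρ (heisenberg d α t (tensorOp 1 M)) := by
  rw [trace_reducedDensity_mul, productState_eq h]
  rfl

/-- Correlation functions of even order are asymptotically those of the reservoir. -/
theorem tendsto_trace_reducedDensity_even {ω : carAlgebra →L[ℂ] ℂ}
    {ω' : (Fock ℤ →L[ℂ] Fock ℤ) →L[ℂ] ℂ} (h : ∀ x : carAlgebra, ω' x = ω x) {α : ℝ}
    (hα : |Real.cos α| < 1) {ρ : SampleOp d} (hρ : ρ.trace = 1) {m n : ℕ}
    (φ : Fin m → Fin d → ℂ) (ψ : Fin n → Fin d → ℂ) (hmn : Even (m + n)) :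
    Filter.Tendsto (fun k : ℕ => (reducedDensity d α ω ρ (k * d) * sampleWord φ ψ).trace
      - ω' (reservoirWord (fun i => outgoingVec d α k (φ i)) fun i => outgoingVec d α k (ψ i)))
      Filter.atTop (nhds 0) := by
  set l : List ((Fin d → ℂ) × Bool) := (List.ofFn fun i => (φ i, true)).reverse
    ++ List.ofFn fun i => (ψ i, false) with hl
  have hlen : Even l.length := by simpa [hl] using hmn
  have h1 : (l.map sampleLetter).prod = sampleWord φ ψ := by
    rw [hl, List.map_append, List.prod_append, List.map_reverse, List.map_ofFn, List.map_ofFn]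
    rfl
  have h2 : ∀ k, (l.map (outLetter α k)).prod
      = reservoirWord (fun i => outgoingVec d α k (φ i)) fun i => outgoingVec d α k (ψ i) := by
    intro k
    rw [hl, List.map_append, List.prod_append, List.map_reverse, List.map_ofFn, List.map_ofFn]
    rfl
  have h3 := ((continuous_productFunctional ω' ρ).tendsto 0).comp (tendsto_heisenberg_word hα l hlen)
  have h0 : productFunctional ω' ρ 0 = 0 := by
    have := productFunctional_sub ω' ρ 0 0
    rwa [sub_self, sub_self] at this
  rw [h0] at h3
  refine h3.congr fun k => ?_
  rw [Function.comp_apply, productFunctional_sub, productFunctional_tensorOp_one, hρ, mul_one, h1,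
    h2, trace_reducedDensity_word h]

/-- The evolution conserves total parity, so an odd observable stays odd at every time, and the
product state is even. -/
theorem trace_reducedDensity_odd {ω : carAlgebra →L[ℂ] ℂ}
    {ω' : (Fock ℤ →L[ℂ] Fock ℤ) →L[ℂ] ℂ} (h : ∀ x : carAlgebra, ω' x = ω x)
    (h' : ∀ (m n : ℕ) (φ : Fin m → L2 ℤ) (ψ : Fin n → L2 ℤ), m ≠ n → ω' (reservoirWord φ ψ) = 0)
    (α : ℝ) {ρ : SampleOp d} (hρ : IsEven ρ) {m n : ℕ}
    (φ : Fin m → Fin d → ℂ) (ψ : Fin n → Fin d → ℂ) (hmn : Odd (m + n)) (t : ℕ) :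
    (reducedDensity d α ω ρ t * sampleWord φ ψ).trace = 0 := by
  set l : List ((Fin d → ℂ) × Bool) := (List.ofFn fun i => (φ i, true)).reverse
    ++ List.ofFn fun i => (ψ i, false) with hl
  have hlen : Odd l.length := by simpa [hl] using hmn
  have h1 : (l.map sampleLetter).prod = sampleWord φ ψ := by
    rw [hl, List.map_append, List.prod_append, List.map_reverse, List.map_ofFn, List.map_ofFn]
    rfl
  rw [trace_reducedDensity_word h]
  refine productFunctional_eq_zero_of_odd h' hρ
    (heisenberg_mem d α t (tensorOp_mem (one_mem _) _)) ?_
  rw [heisenberg_parity, totalParity, tensorOp_mul, tensorOp_mul, mul_one, fockParity_mul_self, ← h1,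
    parity_conj_word, hlen.neg_one_pow, neg_one_smul, tensorOp_neg_right, heisenberg_def,
    heisenberg_def, mul_neg, neg_mul]

end State

/-! ### The asymptotic one-body density -/

/-- Each step averages x with y using the fixed weights q and 1 - q. Once y is within ε/2 of L, the
distance of x to L is at most ε/2 plus a geometrically decaying term. -/
theorem tendsto_of_affine_recursion {q : ℝ} (hq0 : 0 ≤ q) (hq1 : q < 1) {x y : ℕ → ℂ} {L : ℂ}
    (hx : ∀ m, x (m + 1) = q * x m + (1 - q) * y m)
    (hy : Filter.Tendsto y Filter.atTop (nhds L)) : Filter.Tendsto x Filter.atTop (nhds L) := by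
  rw [Metric.tendsto_atTop] at hy ⊢
  intro ε hε
  obtain ⟨N, hN⟩ := hy (ε / 2) (by positivity)
  have hstep : ∀ k, dist (x (N + k)) L ≤ q ^ k * dist (x N) L + ε / 2 := by
    intro k
    induction k with
    | zero => simp only [add_zero, pow_zero, one_mul]; linarith
    | succ k ih =>
      have e : x (N + k + 1) - L = q * (x (N + k) - L) + (1 - q) * (y (N + k) - L) := by
        rw [hx]; ring
      have h1 : dist (x (N + k + 1)) L ≤ q * dist (x (N + k)) L + (1 - q) * dist (y (N + k)) L := by
        rw [dist_eq_norm, dist_eq_norm, dist_eq_norm, e]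
        refine (norm_add_le _ _).trans ?_
        rw [norm_mul, norm_mul, Complex.norm_real, Real.norm_of_nonneg hq0, ← Complex.ofReal_one,
          ← Complex.ofReal_sub, Complex.norm_real, Real.norm_of_nonneg (by linarith)]
      have h2 := hN (N + k) (by omega)
      rw [← add_assoc, pow_succ]
      nlinarith [mul_le_mul_of_nonneg_left ih hq0,
        mul_le_mul_of_nonneg_left h2.le (sub_nonneg.2 hq1.le)]
  have hpow : Filter.Tendsto (fun k : ℕ => q ^ k * dist (x N) L) Filter.atTop (nhds 0) := by
    simpa using (tendsto_pow_atTop_nhds_zero_of_lt_one hq0 hq1).mul_const (dist (x N) L)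
  obtain ⟨K, hK⟩ := Filter.eventually_atTop.1 (hpow.eventually (gt_mem_nhds (half_pos hε)))
  refine ⟨N + K, fun n hn => ?_⟩
  obtain ⟨k, rfl⟩ : ∃ k, n = N + k := ⟨n - N, by omega⟩
  have := hK k (by omega)
  linarith [hstep k]

theorem shift_single (k : ℤ) :
    shift (lp.single 2 k (1 : ℂ)) = lp.single 2 (k - 1) (1 : ℂ) := by
  ext i
  rw [shift, permute_apply]
  simp only [Equiv.coe_addRight, lp.single_apply, Pi.single_apply, eq_sub_iff_add_eq]

theorem inner_shift_shift (x y : L2 ℤ) : inner ℂ (shift x) (shift y) = inner ℂ x y := by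
  rw [← ContinuousLinearMap.adjoint_inner_right, ← ContinuousLinearMap.star_eq_adjoint]
  have h : star shift * shift = 1 := by
    rw [shift, star_permute, permute_mul, Equiv.symm_trans_self, permute_refl]
  have := congrArg (fun T : L2 ℤ →L[ℂ] L2 ℤ => T y) h
  exact congrArg (inner ℂ x) this

theorem inner_single_apply_single {D : L2 ℤ →L[ℂ] L2 ℤ} (hD : Commute D shift) (i k : ℤ) :
    inner ℂ (lp.single 2 i (1 : ℂ) : L2 ℤ) (D (lp.single 2 k (1 : ℂ))) = symbol D (k - i) := by
  have hstep : ∀ i k : ℤ, inner ℂ (lp.single 2 (i - 1) (1 : ℂ) : L2 ℤ)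
      (D (lp.single 2 (k - 1) (1 : ℂ)))
      = inner ℂ (lp.single 2 i (1 : ℂ) : L2 ℤ) (D (lp.single 2 k (1 : ℂ))) := by
    intro i k
    have h : D (shift (lp.single 2 k (1 : ℂ))) = shift (D (lp.single 2 k (1 : ℂ))) :=
      congrArg (fun T : L2 ℤ →L[ℂ] L2 ℤ => T (lp.single 2 k (1 : ℂ))) hD.eq
    rw [← shift_single, ← shift_single, h, inner_shift_shift]
  have hn : ∀ (n : ℕ) (i k : ℤ), inner ℂ (lp.single 2 (i - n) (1 : ℂ) : L2 ℤ)
      (D (lp.single 2 (k - n) (1 : ℂ)))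
      = inner ℂ (lp.single 2 i (1 : ℂ) : L2 ℤ) (D (lp.single 2 k (1 : ℂ))) := by
    intro n
    induction n with
    | zero => intro i k; simp
    | succ n ih =>
      intro i k
      rw [Nat.cast_succ, ← sub_sub, ← sub_sub, hstep, ih]
  rw [symbol]
  -- For i ≥ 0 the pair (i, k) is shifted down to (0, k - i); for i = -n the pair (0, k + n) is
  -- shifted down to (i, k).
  rcases Int.eq_nat_or_neg i with ⟨n, rfl | rfl⟩
  · rw [← hn n n k, sub_self]
  · have := hn n 0 (k + n)
    rw [zero_sub, add_sub_cancel_right] at this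
    rw [this, sub_neg_eq_add]

theorem norm_symbol_le (D : L2 ℤ →L[ℂ] L2 ℤ) (k : ℤ) : ‖symbol D k‖ ≤ ‖D‖ := by
  have h : ∀ j : ℤ, ‖(lp.single 2 j (1 : ℂ) : L2 ℤ)‖ = 1 := fun j => by
    rw [lp.norm_single (by norm_num)]; simp
  rw [symbol]
  refine (norm_inner_le_norm _ _).trans ?_
  rw [h, one_mul]
  refine (D.le_opNorm _).trans ?_
  rw [h, mul_one]

/-! ### Gram matrices of the outgoing vectors and their limit -/

section OneBody

variable {d : ℕ}

/-- The outgoing vector contains the mode j + (m - 1 - u) d with weight sin α cos^u α, at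
displacement k - j + (u + 1) d from k + m d. In the induction k is replaced by k + d, hence the
generalization over k. -/
theorem inner_outgoing_apply_single {D : L2 ℤ →L[ℂ] L2 ℤ} (hD : Commute D shift) (α : ℝ) (m : ℕ)
    (j : Fin d) (k : ℤ) :
    inner ℂ (outgoing d α m j) (D (lp.single 2 (k + m * d) (1 : ℂ)))
      = Real.sin α * ∑ u ∈ Finset.range m, (Real.cos α : ℂ) ^ u * symbol D (k - j + (u + 1) * d) := by
  induction m generalizing k with
  | zero => simp [outgoing]
  | succ m ih =>
    have e : k + ((m + 1 : ℕ) : ℤ) * d = (k + d) + m * d := by push_cast; ring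
    rw [outgoing, inner_add_left, inner_smul_left, inner_smul_left, Complex.conj_ofReal,
      Complex.conj_ofReal, inner_single_apply_single hD, e, ih, Finset.sum_range_succ',
      mul_add, Finset.mul_sum, Finset.mul_sum, Finset.mul_sum]
    congr 1
    · refine Finset.sum_congr rfl fun u _ => ?_
      have e2 : k + d - j + ((u : ℤ) + 1) * d = k - j + (((u + 1 : ℕ) : ℤ) + 1) * d := by
        push_cast; ring
      rw [e2]; ring
    · have e2 : k + d + m * d - (j + m * d) = k - j + (((0 : ℕ) : ℤ) + 1) * d := by
        push_cast; ring
      rw [e2]; ring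

theorem inner_single_apply_outgoing {D : L2 ℤ →L[ℂ] L2 ℤ} (hD : Commute D shift) (α : ℝ) (m : ℕ)
    (j : ℤ) (k : Fin d) :
    inner ℂ (lp.single 2 (j + m * d) (1 : ℂ)) (D (outgoing d α m k))
      = Real.sin α * ∑ u ∈ Finset.range m, (Real.cos α : ℂ) ^ u * symbol D (k - j + -(u + 1) * d) := by
  induction m generalizing j with
  | zero => simp [outgoing]
  | succ m ih =>
    have e : j + ((m + 1 : ℕ) : ℤ) * d = (j + d) + m * d := by push_cast; ring
    rw [outgoing, map_add, map_smul, map_smul, inner_add_right, inner_smul_right, inner_smul_right,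
      inner_single_apply_single hD, e, ih, Finset.sum_range_succ',
      mul_add, Finset.mul_sum, Finset.mul_sum, Finset.mul_sum]
    congr 1
    · refine Finset.sum_congr rfl fun u _ => ?_
      have e2 : (k : ℤ) - (j + d) + -((u : ℤ) + 1) * d = k - j + -(((u + 1 : ℕ) : ℤ) + 1) * d := by
        push_cast; ring
      rw [e2]; ring
    · have e2 : (k : ℤ) + m * d - (j + d + m * d) = k - j + -(((0 : ℕ) : ℤ) + 1) * d := by
        push_cast; ring
      rw [e2]; ring

/-- The matrices `⟨T_m e_j, D T_m e_k⟩`. -/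
noncomputable def outgoingGram (d : ℕ) (α : ℝ) (D : L2 ℤ →L[ℂ] L2 ℤ) (m : ℕ) :
    Matrix (Fin d) (Fin d) ℂ :=
  Matrix.of fun j k => inner ℂ (outgoing d α m j) (D (outgoing d α m k))

/-- Both vectors are split into cos α times the old vector and sin α times the new mode. The cross
terms carry cos α sin α and a further sin α from the inner product, so with the diagonal term they
are sin²α times a partial sum of the series for the asymptotic density. -/
theorem outgoingGram_succ {D : L2 ℤ →L[ℂ] L2 ℤ} (hD : Commute D shift) (α : ℝ) (m : ℕ)
    (j k : Fin d) :
    outgoingGram d α D (m + 1) j k = ((Real.cos α ^ 2 : ℝ) : ℂ) * outgoingGram d α D m j k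
      + (1 - ((Real.cos α ^ 2 : ℝ) : ℂ)) * (sigmaBlock d D 0 j k + ∑ u ∈ Finset.range m,
        (((Real.cos α : ℂ) ^ (u + 1)) •
          (sigmaBlock d D ((u : ℤ) + 1) + sigmaBlock d D (-((u : ℤ) + 1)))) j k) := by
  have hs : (1 - ((Real.cos α ^ 2 : ℝ) : ℂ)) = (Real.sin α : ℂ) * Real.sin α := by
    rw [← Complex.ofReal_one, ← Complex.ofReal_sub, ← Complex.ofReal_mul]
    congr 1
    nlinarith [Real.sin_sq_add_cos_sq α]
  have e : ∀ u : ℕ, (((Real.cos α : ℂ) ^ (u + 1)) •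
      (sigmaBlock d D ((u : ℤ) + 1) + sigmaBlock d D (-((u : ℤ) + 1)))) j k
      = Real.cos α * ((Real.cos α : ℂ) ^ u * symbol D ((k : ℤ) - j + ((u : ℤ) + 1) * d))
        + Real.cos α * ((Real.cos α : ℂ) ^ u * symbol D ((k : ℤ) - j + -((u : ℤ) + 1) * d)) := by
    intro u
    simp only [sigmaBlock, Matrix.smul_apply, Matrix.add_apply, Matrix.of_apply, smul_eq_mul]
    ring
  rw [Finset.sum_congr rfl fun u _ => e u, Finset.sum_add_distrib, ← Finset.mul_sum, ← Finset.mul_sum]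
  simp only [outgoingGram, Matrix.of_apply]
  rw [outgoing, outgoing]
  simp only [map_add, map_smul, inner_add_left, inner_add_right, inner_smul_left, inner_smul_right,
    Complex.conj_ofReal]
  rw [inner_outgoing_apply_single hD, inner_single_apply_outgoing hD, inner_single_apply_single hD, hs]
  have e3 : (k : ℤ) + m * d - (j + m * d) = k - j + 0 * d := by ring
  rw [e3, sigmaBlock, Matrix.of_apply]
  push_cast
  ring

theorem summable_sigmaBlock {α : ℝ} (hα : |Real.cos α| < 1) (D : L2 ℤ →L[ℂ] L2 ℤ) :
    Summable fun u : ℕ => ((Real.cos α : ℂ) ^ (u + 1)) •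
      (sigmaBlock d D ((u : ℤ) + 1) + sigmaBlock d D (-((u : ℤ) + 1))) := by
  refine Pi.summable.2 fun j => Pi.summable.2 fun k => ?_
  have hg : Summable fun u : ℕ => |Real.cos α| ^ (u + 1) * (2 * ‖D‖) :=
    ((summable_nat_add_iff 1).2 (summable_geometric_of_lt_one (abs_nonneg _) hα)).mul_right _
  refine Summable.of_norm_bounded hg fun u => ?_
  rw [Matrix.smul_apply, smul_eq_mul, norm_mul, norm_pow, Complex.norm_real, Real.norm_eq_abs]
  gcongr
  rw [Matrix.add_apply, two_mul]
  exact (norm_add_le _ _).trans (add_le_add (norm_symbol_le D _) (norm_symbol_le D _))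

theorem tendsto_outgoingGram {α : ℝ} (hα : |Real.cos α| < 1) {D : L2 ℤ →L[ℂ] L2 ℤ}
    (hD : Commute D shift) : Filter.Tendsto (outgoingGram d α D) Filter.atTop
      (nhds (asymptoticOneBody d α D)) := by
  refine tendsto_pi_nhds.2 fun j => tendsto_pi_nhds.2 fun k => ?_
  have hq : Real.cos α ^ 2 < 1 := (sq_lt_one_iff_abs_lt_one _).2 hα
  refine tendsto_of_affine_recursion (sq_nonneg _) hq (fun m => outgoingGram_succ hD α m j k) ?_
  have h := (summable_sigmaBlock (d := d) hα D).hasSum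
  have h' := (Pi.hasSum.1 (Pi.hasSum.1 h j) k).tendsto_sum_nat
  exact h'.const_add _

theorem inner_outgoingVec (α : ℝ) (D : L2 ℤ →L[ℂ] L2 ℤ) (m : ℕ) (v w : Fin d → ℂ) :
    inner ℂ (outgoingVec d α m v) (D (outgoingVec d α m w))
      = star v ⬝ᵥ (outgoingGram d α D m).mulVec w := by
  rw [outgoingVec, outgoingVec, map_sum, sum_inner]
  refine Finset.sum_congr rfl fun j _ => ?_
  rw [inner_sum, Matrix.mulVec, dotProduct, Finset.mul_sum]
  refine Finset.sum_congr rfl fun k _ => ?_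
  rw [map_smul, inner_smul_left, inner_smul_right, outgoingGram, Matrix.of_apply, Pi.star_apply,
    Complex.star_def]
  ring

theorem posSemidef_asymptoticOneBody {α : ℝ} (hα : |Real.cos α| < 1) {D : L2 ℤ →L[ℂ] L2 ℤ}
    (hD : Commute D shift) (hpos : D.IsPositive) : (asymptoticOneBody d α D).PosSemidef := by
  refine isClosed_posSemidef.mem_of_tendsto (tendsto_outgoingGram hα hD)
    (Filter.Eventually.of_forall fun m => ?_)
  refine Matrix.PosSemidef.of_dotProduct_mulVec_nonneg ?_ fun v => ?_
  · ext j k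
    rw [Matrix.conjTranspose_apply, outgoingGram, Matrix.of_apply, Matrix.of_apply, Complex.star_def,
      inner_conj_symm]
    exact hpos.isSymmetric _ _
  · rw [← inner_outgoingVec]
    exact hpos.inner_nonneg_right _

/-- Since |k - j| < d, only the block s = 0 meets the diagonal of the identity. -/
theorem asymptoticOneBody_one (α : ℝ) : asymptoticOneBody d α 1 = 1 := by
  have hsym : ∀ n : ℤ, symbol 1 n = if n = 0 then 1 else 0 := by
    intro n
    rw [symbol]
    change inner ℂ (lp.single 2 (0 : ℤ) (1 : ℂ) : L2 ℤ) (lp.single 2 n (1 : ℂ)) = _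
    rw [inner_single_single]
    simp only [eq_comm]
  have h0 : sigmaBlock d 1 0 = 1 := by
    ext j k
    rw [sigmaBlock, Matrix.of_apply, hsym, Matrix.one_apply]
    have : (k : ℤ) - j + 0 * d = 0 ↔ j = k := by
      rw [Fin.ext_iff]; constructor <;> intro h <;> [skip; rw [h]] <;> omega
    simp only [this]
  have h1 : ∀ u : ℕ, sigmaBlock d 1 ((u : ℤ) + 1) = 0 := by
    intro u
    ext j k
    rw [sigmaBlock, Matrix.of_apply, hsym, if_neg, Matrix.zero_apply]
    have := j.2
    nlinarith
  have h2 : ∀ u : ℕ, sigmaBlock d 1 (-((u : ℤ) + 1)) = 0 := by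
    intro u
    ext j k
    rw [sigmaBlock, Matrix.of_apply, hsym, if_neg, Matrix.zero_apply]
    have := k.2
    nlinarith
  rw [asymptoticOneBody, h0]
  simp only [h1, h2, add_zero, smul_zero, tsum_zero]

/-- The Gram matrices are linear in D for each m, and so is their limit. This turns the upper bound
on the symbol into positivity for 1 - D. -/
theorem asymptoticOneBody_one_sub {α : ℝ} (hα : |Real.cos α| < 1) {D : L2 ℤ →L[ℂ] L2 ℤ}
    (hD : Commute D shift) :
    asymptoticOneBody d α (1 - D) = 1 - asymptoticOneBody d α D := by
  have h1 := tendsto_outgoingGram (d := d) hα ((Commute.one_left shift).sub_left hD)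
  have h2 := (tendsto_outgoingGram (d := d) hα (Commute.one_left shift)).sub
    (tendsto_outgoingGram hα hD)
  rw [asymptoticOneBody_one] at h2
  refine tendsto_nhds_unique h1 (h2.congr fun m => ?_)
  ext j k
  simp only [outgoingGram, Matrix.sub_apply, Matrix.of_apply, ← inner_sub_right]
  rfl

end OneBody

end FermionWalk

/-! ### The asymptotic state of the sample -/

theorem mainTheorem8 (d : ℕ) [NeZero d] (α : ℝ) (hα : |Real.cos α| < 1)
    (D : L2 ℤ →L[ℂ] L2 ℤ) (hD₀ : D.IsPositive) (hD₁ : (1 - D).IsPositive)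
    (hDS : Commute D shift)
    (ω : carAlgebra →L[ℂ] ℂ) (hω : IsState ω) (hωD : IsQuasiFree ω D)
    (ρ : SampleOp d) (hρ : IsDensityMatrix ρ) (heven : IsEven ρ) :
    ∃ ρinf : SampleOp d,
      Filter.Tendsto (fun m : ℕ => reducedDensity d α ω ρ (m * d)) Filter.atTop (nhds ρinf) ∧
      IsDensityMatrix ρinf ∧
      IsQuasiFreeSample ρinf (asymptoticOneBody d α D) ∧
      Filter.Tendsto (fun m : ℕ => oneBody (reducedDensity d α ω ρ (m * d))) Filter.atTop
        (nhds (asymptoticOneBody d α D)) ∧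
      (asymptoticOneBody d α D).PosSemidef ∧ (1 - asymptoticOneBody d α D).PosSemidef ∧
      ((1 - asymptoticOneBody d α D).PosDef →
        ρinf = quasiFreeDensity (asymptoticOneBody d α D)) ∧
      ((asymptoticOneBody d α D).PosDef → (1 - asymptoticOneBody d α D).PosDef →
        ρinf = gibbsDensity (asymptoticOneBody d α D)) ∧
      Filter.Tendsto quasiFreeDensity
        (nhdsWithin (asymptoticOneBody d α D)
          {R : Matrix (Fin d) (Fin d) ℂ | R.PosDef ∧ (1 - R).PosDef})
        (nhds ρinf) := by
  set R := asymptoticOneBody d α D with hR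
  obtain ⟨ω', hext, hdet, hzero⟩ := exists_extension hωD
  have hodd : ∀ (m n : ℕ) (φ : Fin m → Fin d → ℂ) (ψ : Fin n → Fin d → ℂ), Odd (m + n) →
      ∀ t, (reducedDensity d α ω ρ t * sampleWord φ ψ).trace = 0 := fun m n φ ψ hmn t =>
    trace_reducedDensity_odd hext hzero α heven φ ψ hmn t
  have hG := tendsto_outgoingGram (d := d) hα hDS
  have hlim : ∀ (n : ℕ) (φ ψ : Fin n → Fin d → ℂ), Filter.Tendsto
      (fun m : ℕ => (reducedDensity d α ω ρ (m * d) * sampleWord φ ψ).trace) Filter.atTop (nhds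
        (Matrix.of fun j k : Fin n => dotProduct (star (ψ j)) (R.mulVec (φ k))).det) := by
    intro n φ ψ
    have h1 := tendsto_trace_reducedDensity_even hext hα hρ.2 φ ψ ⟨n, rfl⟩
    have hc : Continuous fun R' : Matrix (Fin d) (Fin d) ℂ =>
        (Matrix.of fun j k : Fin n => dotProduct (star (ψ j)) (R'.mulVec (φ k))).det :=
      Continuous.matrix_det (continuous_matrix fun i j =>
        continuous_const.dotProduct (continuous_id.matrix_mulVec continuous_const))
    -- For each m the reservoir correlation is the determinant formed with the Gram matrix in place
    -- of R.
    have h2 := h1.add ((hc.tendsto R).comp hG)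
    rw [zero_add] at h2
    refine h2.congr fun m => ?_
    rw [hdet]
    simp only [inner_outgoingVec, Function.comp_apply, sub_add_cancel]
  have hlim0 : ∀ (m n : ℕ) (φ : Fin m → Fin d → ℂ) (ψ : Fin n → Fin d → ℂ), m ≠ n →
      Filter.Tendsto (fun k : ℕ => (reducedDensity d α ω ρ (k * d) * sampleWord φ ψ).trace)
        Filter.atTop (nhds 0) := by
    intro m n φ ψ hmn
    rcases Nat.even_or_odd (m + n) with hp | hp
    · refine (tendsto_trace_reducedDensity_even hext hα hρ.2 φ ψ hp).congr fun k => ?_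
      rw [hzero _ _ _ _ hmn, sub_zero]
    · simp only [hodd m n φ ψ hp]
      exact tendsto_const_nhds
  obtain ⟨ρinf, htend, hqf⟩ := exists_tendsto_of_tendsto_sampleWord _ R hlim hlim0
  have hpos : R.PosSemidef := posSemidef_asymptoticOneBody hα hDS hD₀
  have hpos' : (1 - R).PosSemidef := by
    rw [hR, ← asymptoticOneBody_one_sub hα hDS]
    exact posSemidef_asymptoticOneBody hα ((Commute.one_left shift).sub_left hDS) hD₁
  obtain ⟨hdens, hcont⟩ := tendsto_quasiFreeDensity hqf hpos hpos'
  have hqfd : (1 - R).PosDef → ρinf = quasiFreeDensity R := fun h =>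
    hqf.unique (isQuasiFreeSample_quasiFreeDensity h)
  refine ⟨ρinf, htend, hdens, hqf, ?_, hpos, hpos', hqfd,
    fun h h' => (hqfd h').trans (quasiFreeDensity_eq_gibbsDensity h h'), hcont⟩
  refine tendsto_pi_nhds.2 fun j => tendsto_pi_nhds.2 fun k => ?_
  -- The entries of the one-body matrix are the correlations with one creator and one annihilator.
  have h := hlim 1 (fun _ => eVec k) (fun _ => eVec j)
  have e : (Matrix.of fun i l : Fin 1 => star (eVec (d := d) j) ⬝ᵥ R.mulVec (eVec k)).det = R j k := by
    rw [Matrix.det_fin_one, Matrix.of_apply, eVec, eVec, Matrix.mulVec_single_one]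
    simp [dotProduct, Pi.single_apply]
  rw [e] at h
  refine h.congr fun m => ?_
  simp [sampleWord, oneBody]
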